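/- Fix an elementary gate set consisting of the Hadamard gate, the $T$ gate, CNOT, and finitely many (possibly no) further one-qubit unitaries. An efficient quantum algorithm is a polynomial-time uniform family of circuits over this gate set, i.e. one classical machine writes the circuit for given classical input in time $\mathrm{poly}(n)$; the circuit may use $\mathrm{poly}(n)$ ancilla qubits initialised to $|0\rangle$, and qubits that are not output are discarded at the end. Let $m,\kappa:\mathbb N\to\mathbb N$. The ensemble $\eta_{n,m}$ is the distribution of $\operatorname{tr}_m(|\psi\rangle\langle\psi|)$ for an $(n+m)$-qubit Haar random pure state $|\psi\rangle$, where $m$ qubits are traced out. A keyed family of $n$-qubit density matrices $\{\rho_{n,k}\}_{k\in\{0,1\}^{\kappa(n)}}$, $n\in\mathbb N$, is a *pseudorandom density matrix (PRDM)* with security parameter $\kappa$ and mixedness parameter $m$ if $\kappa(n)$ is bounded by a polynomial in $n$ and 1. (efficiently preparable) there is an efficient quantum algorithm that, given $1^n$, $1^{\kappa(n)}$, $m(n)$ and $k\in\{0,1\}^{\kappa(n)}$, outputs $\rho_{n,k}$; 2. (computational indistinguishability) for every polynomial $t$ and every efficient quantum algorithm $\mathcal A$ with one output bit (which is also given $1^n$,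 $1^{\kappa(n)}$, $m(n)$ and $1^{t(n)}$), $$\Big|\Pr_{k\leftarrow\{0,1\}^{\kappa(n)}}[\mathcal A(\rho_{n,k}^{\otimes t(n)})=1]-\Pr_{\rho\leftarrow\eta_{n,m(n)}}[\mathcal A(\rho^{\otimes t(n)})=1]\Big|$$ is negligible, i.e. for every $c\in\mathbb N$ it is smaller than $n^{-c}$ for all sufficiently large $n$. A family $\Gamma=(\Gamma_n)_n$ of quantum channels $\Gamma_n$ on $n$ qubits is *unital* if $\Gamma_n(I)=I$ for all $n$, and *efficiently implementable* if there is an efficient quantum algorithm that, given $1^n$ and an $n$-qubit state, implements $\Gamma_n$. A PRDM is *noise robust* to $\Gamma$ if $\{\Gamma_n(\rho_{n,k})\}_k$ is again a PRDM with the same $\kappa$ and $m$. **Theorem.** Let $\{\rho_{n,k}\}$ be a PRDM with security parameter $\kappa$ and mixedness parameter $m$. Then $\{\rho_{n,k}\}$ is noise robust to every efficiently implementable family of unital channels if and only if $m=\omega(\log n)$, i.e. $\log n=o(m(n))$ as $n\to\infty$. -/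

import Mathlib

open MeasureTheory

noncomputable section

/-! ## Qubit registers

The computational basis of a register of `N` qubits is `Fin N → Bool`, and its operators are the
complex matrices indexed by that basis. -/

/-- Operators on `N` qubits. -/
abbrev QOp (N : ℕ) : Type := Matrix (Fin N → Bool) (Fin N → Bool) ℂ

/-- The pure state `|0…0⟩⟨0…0|` on `N` qubits. -/
def zeroState (N : ℕ) : QOp N :=
  Matrix.of fun x y => if (∀ i, x i = false) ∧ (∀ i, y i = false) then 1 else 0

/-- `ρ ⊗ |0…0⟩⟨0…0|`: a state on `n` qubits together with `a` fresh ancilla qubits, which come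
after the first `n` qubits. -/
def addAncillas (n a : ℕ) (ρ : QOp n) : QOp (n + a) :=
  Matrix.of fun x y => ρ (fun i => x (Fin.castAdd a i)) (fun i => y (Fin.castAdd a i)) *
    zeroState a (fun j => x (Fin.natAdd n j)) (fun j => y (Fin.natAdd n j))

/-- Partial trace over the last `a` of `n + a` qubits. -/
def traceOutLast (n a : ℕ) (M : QOp (n + a)) : QOp n :=
  Matrix.of fun x y => ∑ z : Fin a → Bool, M (Fin.append x z) (Fin.append y z)

/-- `ρ^{⊗ t}` for an `n`-qubit operator `ρ`: copy number `j` sits on the qubits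
`n * j, …, n * j + n - 1`. -/
def copies (n t : ℕ) (ρ : QOp n) : QOp (t * n) :=
  Matrix.of fun x y => ∏ j : Fin t,
    ρ (fun i => x (finProdFinEquiv (j, i))) (fun i => y (finProdFinEquiv (j, i)))

/-! ## Gates and circuits -/

/-- Elementary gates: Hadamard, `T`, controlled-NOT, and further one-qubit gates named by `ι`.
The gates act on qubits named by `Q`. -/
inductive Gate (ι Q : Type) : Type
  | hadamard (q : Q)
  | tgate (q : Q)
  | cnot (control target : Q)
  | extra (i : ι) (q : Q)

/-- Rename the qubits of a gate. -/
def Gate.map {ι Q Q' : Type} (f : Q → Q') : Gate ι Q → Gate ι Q'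
  | .hadamard q => .hadamard (f q)
  | .tgate q => .tgate (f q)
  | .cnot c t => .cnot (f c) (f t)
  | .extra i q => .extra i (f q)

/-- The gate acts on (distinct) qubits with numbers below `N`. -/
def Gate.Valid {ι : Type} (N : ℕ) : Gate ι ℕ → Prop
  | .hadamard q => q < N
  | .tgate q => q < N
  | .cnot c t => c < N ∧ t < N ∧ c ≠ t
  | .extra _ q => q < N

/-- The Hadamard matrix. -/
def hadamardMatrix : Matrix Bool Bool ℂ :=
  Matrix.of fun a b => (if a = true ∧ b = true then -1 else 1) / (Real.sqrt 2 : ℂ)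

/-- The matrix of the `T` gate, `diag(1, e^{iπ/4})`. -/
def tMatrix : Matrix Bool Bool ℂ :=
  Matrix.diagonal fun b => if b = true then Complex.exp (Complex.I * (Real.pi / 4 : ℝ)) else 1

/-- The one-qubit operator `u` applied to qubit `q` of `N` (the identity if there is no such
qubit). -/
def onQubit (N q : ℕ) (u : Matrix Bool Bool ℂ) : QOp N :=
  if h : q < N then
    Matrix.of fun x y =>
      if ∀ j : Fin N, j ≠ ⟨q, h⟩ → x j = y j then u (x ⟨q, h⟩) (y ⟨q, h⟩) else 0
  else 1

/-- The controlled-NOT gate on `N` qubits (the identity if control and target are not two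
distinct qubits of the register). -/
def cnotMatrix (N c t : ℕ) : QOp N :=
  if h : c < N ∧ t < N ∧ c ≠ t then
    Matrix.of fun x y =>
      if x = Function.update y ⟨t, h.2.1⟩ (xor (y ⟨t, h.2.1⟩) (y ⟨c, h.1⟩)) then 1 else 0
  else 1

/-- The unitary of a gate on `N` qubits, where `𝒢` gives the matrices of the further one-qubit
gates. -/
def Gate.toMatrix {ι : Type} (𝒢 : ι → Matrix.unitaryGroup Bool ℂ) (N : ℕ) : Gate ι ℕ → QOp N
  | .hadamard q => onQubit N q hadamardMatrix
  | .tgate q => onQubit N q tMatrix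
  | .cnot c t => cnotMatrix N c t
  | .extra i q => onQubit N q (𝒢 i : Matrix Bool Bool ℂ)

/-- The unitary of a circuit on `N` qubits; the head of the list is the gate applied first. -/
def circuitMatrix {ι : Type} (𝒢 : ι → Matrix.unitaryGroup Bool ℂ) (N : ℕ) :
    List (Gate ι ℕ) → QOp N
  | [] => 1
  | g :: C => circuitMatrix 𝒢 N C * g.toMatrix 𝒢 N

/-- The state of the `n + a` qubits after running the circuit `C` on the `n`-qubit input `ρ` and
`a` ancilla qubits in state `0`. -/
def runCircuit {ι : Type} (𝒢 : ι → Matrix.unitaryGroup Bool ℂ) (n a : ℕ)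
    (C : List (Gate ι ℕ)) (ρ : QOp n) : QOp (n + a) :=
  circuitMatrix 𝒢 (n + a) C * addAncillas n a ρ * (circuitMatrix 𝒢 (n + a) C).conjTranspose

/-- The map on `n`-qubit operators implemented by a circuit with `a` ancilla qubits, which are
discarded at the end. -/
def circuitChannel {ι : Type} (𝒢 : ι → Matrix.unitaryGroup Bool ℂ) (n a : ℕ)
    (C : List (Gate ι ℕ)) (ρ : QOp n) : QOp n :=
  traceOutLast n a (runCircuit 𝒢 n a C ρ)

/-- The probability that the circuit `C` outputs `1` on input `ρ`, that is, that a measurement of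
qubit number `0` after the run of the circuit gives `1`. -/
def acceptProb {ι : Type} (𝒢 : ι → Matrix.unitaryGroup Bool ℂ) (n a : ℕ)
    (C : List (Gate ι ℕ)) (ρ : QOp n) : ℝ :=
  ∑ x : Fin (n + a) → Bool,
    open Classical in
    if ∃ i : Fin (n + a), (i : ℕ) = 0 ∧ x i = true then (runCircuit 𝒢 n a C ρ x x).re else 0

/-! ## Polynomial-time uniform circuit families

The classical machine that writes the circuits is a multi-stack machine (equivalently, up to
polynomial overhead, a multi-tape Turing machine) with structured control. A program mentions
finitely many stacks of bits, and can append gates to a write-only output. -/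

/-- Programs of the machine; stacks are named by natural numbers. -/
inductive Prog (ι : Type) : Type
  | skip
  | push (r : ℕ) (b : Bool)
  | pop (r : ℕ)
  /-- Write a gate; the number of each of its qubits is the current height of the named stack. -/
  | emit (g : Gate ι ℕ)
  | seq (P Q : Prog ι)
  /-- Run `P` if the top of stack `r` is `1`, and `Q` otherwise. -/
  | branch (r : ℕ) (P Q : Prog ι)
  /-- Repeat `P` as long as stack `r` is not empty. -/
  | loop (r : ℕ) (P : Prog ι)

/-- The contents of all stacks, with the top of a stack first. -/
abbrev Store : Type := ℕ → List Bool

/-- `Runs P s s' C T`: started with stacks `s`, the program `P` halts after `T` steps with stacks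
`s'`, having written the gates `C`. -/
inductive Runs {ι : Type} : Prog ι → Store → Store → List (Gate ι ℕ) → ℕ → Prop
  | skip (s : Store) : Runs .skip s s [] 1
  | push (s : Store) (r : ℕ) (b : Bool) :
      Runs (.push r b) s (Function.update s r (b :: s r)) [] 1
  | pop (s : Store) (r : ℕ) : Runs (.pop r) s (Function.update s r (s r).tail) [] 1
  | emit (s : Store) (g : Gate ι ℕ) : Runs (.emit g) s s [g.map fun r => (s r).length] 1
  | seq {P Q : Prog ι} {s₀ s₁ s₂ : Store} {C D : List (Gate ι ℕ)} {T U : ℕ}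
      (hP : Runs P s₀ s₁ C T) (hQ : Runs Q s₁ s₂ D U) : Runs (.seq P Q) s₀ s₂ (C ++ D) (T + U)
  | branch_true {r : ℕ} {P Q : Prog ι} {s s' : Store} {C : List (Gate ι ℕ)} {T : ℕ}
      (hr : (s r).head? = some true) (h : Runs P s s' C T) : Runs (.branch r P Q) s s' C (T + 1)
  | branch_false {r : ℕ} {P Q : Prog ι} {s s' : Store} {C : List (Gate ι ℕ)} {T : ℕ}
      (hr : (s r).head? ≠ some true) (h : Runs Q s s' C T) : Runs (.branch r P Q) s s' C (T + 1)
  | loop_done {r : ℕ} {P : Prog ι} {s : Store} (hr : s r = []) : Runs (.loop r P) s s [] 1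
  | loop_step {r : ℕ} {P : Prog ι} {s₀ s₁ s₂ : Store} {C D : List (Gate ι ℕ)} {T U : ℕ}
      (hr : s₀ r ≠ []) (hP : Runs P s₀ s₁ C T) (hQ : Runs (.loop r P) s₁ s₂ D U) :
      Runs (.loop r P) s₀ s₂ (C ++ D) (T + U + 1)

/-- The stacks `0, 1, 2, …` hold the given inputs, and all other stacks are empty. -/
def inputStore (l : List (List Bool)) : Store := fun r => l.getD r []

/-- The unary string `1ⁿ`. -/
def unary (n : ℕ) : List Bool := List.replicate n true

/-- `C` is a polynomial-time uniform family of quantum circuits: a single program, on the classical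
input `input x`, writes the circuit `C x` within polynomially many (in `size x`) steps, and this
circuit is one on `width x` qubits. -/
def UniformCircuits {ι X : Type} (size : X → ℕ) (input : X → List (List Bool)) (width : X → ℕ)
    (C : X → List (Gate ι ℕ)) : Prop :=
  ∃ (P : Prog ι) (p : Polynomial ℕ), ∀ x : X,
    (∃ (s : Store) (T : ℕ), Runs P (inputStore (input x)) s (C x) T ∧ T ≤ p.eval (size x)) ∧
    ∀ g ∈ C x, g.Valid (width x)

/-! ## Quantum channels -/

/-- A quantum channel on `n` qubits, in Kraus form. -/
def IsQuantumChannel (n : ℕ) (Γ : QOp n → QOp n) : Prop :=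
  ∃ (r : ℕ) (K : Fin r → QOp n), (∑ j, (K j).conjTranspose * K j = 1) ∧
    ∀ ρ, Γ ρ = ∑ j, K j * ρ * (K j).conjTranspose

/-- The channel fixes the identity. -/
def IsUnital (n : ℕ) (Γ : QOp n → QOp n) : Prop := Γ 1 = 1

/-- The channels `Γ n` on `n` qubits are implemented by a quantum polynomial-time algorithm that
is given `1ⁿ` and the `n`-qubit state, with polynomially many ancilla qubits. -/
def EfficientlyImplementable {ι : Type} (𝒢 : ι → Matrix.unitaryGroup Bool ℂ)
    (Γ : (n : ℕ) → QOp n → QOp n) : Prop :=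
  ∃ (a : Polynomial ℕ) (C : ℕ → List (Gate ι ℕ)),
    UniformCircuits (fun n => n) (fun n => [unary n]) (fun n => n + a.eval n) C ∧
    ∀ n ρ, Γ n ρ = circuitChannel 𝒢 n (a.eval n) (C n) ρ

/-! ## The generalized Hilbert–Schmidt ensemble -/

/-- The Hilbert space of `n + m` qubits, split into the first `n` and the last `m`. -/
abbrev PureSpace (n m : ℕ) : Type := EuclideanSpace ℂ ((Fin n → Bool) × (Fin m → Bool))

/-- The Haar measure on pure states: the uniform probability measure on the unit sphere. -/
def haarState (n m : ℕ) : Measure (Metric.sphere (0 : PureSpace n m) 1) :=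
  ((volume : Measure (PureSpace n m)).toSphere Set.univ)⁻¹ •
    (volume : Measure (PureSpace n m)).toSphere

/-- `tr_m(|ψ⟩⟨ψ|)`, the state of the first `n` qubits. -/
def reducedState (n m : ℕ) (ψ : PureSpace n m) : QOp n :=
  Matrix.of fun x y => ∑ z : Fin m → Bool, ψ (x, z) * star (ψ (y, z))

/-- Operators carry the Borel σ-algebra. -/
instance (N : ℕ) : MeasurableSpace (QOp N) := borel _

instance (N : ℕ) : BorelSpace (QOp N) := ⟨rfl⟩

/-- The `(n, m)` generalized Hilbert–Schmidt ensemble, as a measure on `n`-qubit operators: the law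
of the state of the first `n` qubits of an `(n + m)`-qubit Haar random state. -/
def ghse (n m : ℕ) : Measure (QOp n) :=
  (haarState n m).map fun ψ : Metric.sphere (0 : PureSpace n m) 1 => reducedState n m ψ

/-! ## Pseudorandom density matrices -/

/-- Negligible functions. -/
def Negligible (f : ℕ → ℝ) : Prop :=
  ∀ c : ℕ, ∃ n₀ : ℕ, ∀ n > n₀, f n < ((n : ℝ) ^ c)⁻¹

/-- A keyed family of `n`-qubit operators with keys in `{0,1}^{κ(n)}`. -/
abbrev KeyedFamily (κ : ℕ → ℕ) : Type := (n : ℕ) → (Fin (κ n) → Bool) → QOp n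

/-- The public parameters `1ⁿ`, `1^{κ(n)}` and `m(n)` (in binary). -/
def publicParams (κ m : ℕ → ℕ) (n : ℕ) : List (List Bool) :=
  [unary n, unary (κ n), Nat.bits (m n)]

/-- The family is prepared by a quantum polynomial-time algorithm that is given the public
parameters and the key. -/
def EfficientlyPreparable {ι : Type} (𝒢 : ι → Matrix.unitaryGroup Bool ℂ) (κ m : ℕ → ℕ)
    (ρ : KeyedFamily κ) : Prop :=
  ∃ (a : Polynomial ℕ) (C : (Σ n : ℕ, Fin (κ n) → Bool) → List (Gate ι ℕ)),
    UniformCircuits (fun x => x.1) (fun x => publicParams κ m x.1 ++ [List.ofFn x.2])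
      (fun x => x.1 + a.eval x.1) C ∧
    ∀ n k, ρ n k = circuitChannel 𝒢 n (a.eval n) (C ⟨n, k⟩) (zeroState n)

/-- The distinguishing advantage of the circuit `C` with `a` ancilla qubits, given `t` copies,
between `ρ_k` with a uniformly random key `k` and the `(n, m)` generalized Hilbert–Schmidt
ensemble. -/
def advantage {ι : Type} (𝒢 : ι → Matrix.unitaryGroup Bool ℂ) {κ : ℕ} (n m t a : ℕ)
    (C : List (Gate ι ℕ)) (ρ : (Fin κ → Bool) → QOp n) : ℝ :=
  |(∑ k : Fin κ → Bool, acceptProb 𝒢 (t * n) a C (copies n t (ρ k))) / 2 ^ κ -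
    ∫ σ, acceptProb 𝒢 (t * n) a C (copies n t σ) ∂(ghse n m)|

/-- For every polynomial `t`, every quantum polynomial-time adversary, given the public parameters,
`1^{t(n)}` and `t(n)` copies of the state, has negligible advantage. -/
def ComputationallyIndistinguishable {ι : Type} (𝒢 : ι → Matrix.unitaryGroup Bool ℂ)
    (κ m : ℕ → ℕ) (ρ : KeyedFamily κ) : Prop :=
  ∀ (t a : Polynomial ℕ) (C : ℕ → List (Gate ι ℕ)),
    UniformCircuits (fun n => n) (fun n => publicParams κ m n ++ [unary (t.eval n)])
      (fun n => t.eval n * n + a.eval n) C →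
    Negligible fun n => advantage 𝒢 n (m n) (t.eval n) (a.eval n) (C n) (ρ n)

/-- Pseudorandom density matrices with security parameter `κ` and mixedness parameter `m`. -/
structure IsPRDM {ι : Type} (𝒢 : ι → Matrix.unitaryGroup Bool ℂ) (κ m : ℕ → ℕ)
    (ρ : KeyedFamily κ) : Prop where
  poly_key : ∃ p : Polynomial ℕ, ∀ n, κ n ≤ p.eval n
  preparable : EfficientlyPreparable 𝒢 κ m ρ
  indistinguishable : ComputationallyIndistinguishable 𝒢 κ m ρ

/-- The PRDM `ρ` is noise robust to `Γ` if it remains a PRDM after application of `Γ`. -/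
def NoiseRobust {ι : Type} (𝒢 : ι → Matrix.unitaryGroup Bool ℂ) (κ m : ℕ → ℕ)
    (ρ : KeyedFamily κ) (Γ : (n : ℕ) → QOp n → QOp n) : Prop :=
  IsPRDM 𝒢 κ m ρ → IsPRDM 𝒢 κ m fun n k => Γ n (ρ n k)

end

/-! Both directions rest on comparing the Haar-induced ensemble with the maximally mixed state
I/2^n.

Expand ψ = ∑_z ψ_z ⊗ |z⟩ along the traced-out register, so that t copies of the reduced state become
a sum over t-tuples z of rank-one operators. If the entries of z are distinct, the Haar average of
its term is a multiple of the identity: sign flips of coordinates kill the off-diagonal entries, and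
permutations inside the components equalise the diagonal ones. Tuples with a repetition carry
expected weight at most t² ∑_w E‖ψ_w‖⁴ ≤ 2t²/2^m. Hence no circuit, efficient or not, separates t
copies of the ensemble from t copies of I/2^n by more than 2t²/2^m
(`abs_integral_acceptProb_sub_le`).

Sufficiency of m = ω(log n): a unital channel fixes I/2^n, so the noisy and the noiseless ensemble
are within 4t²/2^m for any adversary (`abs_integral_channel_sub_le`), which is negligible. The noisy
keyed states are indistinguishable from the noisy ensemble because an adversary preceded by t
parallel runs of the channel circuit is again an efficient adversary
(`negligible_advantage_channel`). Preparability survives by appending the channel circuit to the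
preparation.

Necessity: complete dephasing in the computational basis is unital and efficient, and it lowers the
mean purity of the ensemble by E ∑_{x≠y} |σ_xy|², which is of order 2^{-m}. The swap test on two
copies sees this: its acceptance probabilities differ by at least 1/(8·2^m)
(`le_integral_swapTest_sub`). If dephasing preserves pseudorandomness, both the noisy and the
noiseless ensemble are negligibly close to the dephased keyed states, so 2^{-m} is negligible, which
means log n = o(m) (`isLittleO_log_of_negligible`).

The Haar moments are derived from invariance alone, under coordinate phases, coordinate permutations
and one two-coordinate reflection. The remaining effort goes into uniformity: one machine has to
write the composed circuits. Because a gate refers to its qubits by stack heights, composition needs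
a program transformation that recomputes each qubit number before the gate is written
(`Runs.transform`, `does_emitIndexed`), with polynomial overhead. -/

noncomputable section

/-! ## Operators on some of the qubits of a register -/

open Classical in
/-- The operator `M` on the qubits in the image of `f`, and the identity on all others. -/
def liftOp {Q W : Type} (f : Q → W) (M : Matrix (Q → Bool) (Q → Bool) ℂ) :
    Matrix (W → Bool) (W → Bool) ℂ :=
  Matrix.of fun x y => if ∀ w, w ∉ Set.range f → x w = y w then M (x ∘ f) (y ∘ f) else 0

open Classical in
/-- The basis states that agree with `x` outside of the image of `f`. -/
def fillIn {Q W : Type} (f : Q → W) (x : W → Bool) (z : Q → Bool) : W → Bool :=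
  Function.extend f z x

theorem fillIn_comp {Q W : Type} {f : Q → W} (hf : f.Injective) (x : W → Bool) (z : Q → Bool) :
    fillIn f x z ∘ f = z := Function.extend_comp hf _ _

theorem fillIn_of_notMem {Q W : Type} {f : Q → W} (x : W → Bool) (z : Q → Bool) {w : W}
    (hw : w ∉ Set.range f) : fillIn f x z w = x w :=
  Function.extend_apply' _ _ _ (by simpa using hw)

theorem fillIn_eq {Q W : Type} {f : Q → W} (hf : f.Injective) (x y : W → Bool)
    (h : ∀ w, w ∉ Set.range f → x w = y w) : fillIn f x (y ∘ f) = y := by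
  funext w
  by_cases hw : w ∈ Set.range f
  · obtain ⟨q, rfl⟩ := hw
    exact congrFun (fillIn_comp hf x (y ∘ f)) q
  · rw [fillIn_of_notMem _ _ hw, h w hw]

theorem fillIn_injective {Q W : Type} {f : Q → W} (hf : f.Injective) (x : W → Bool) :
    (fillIn f x).Injective := fun z z' h => by
  rw [← fillIn_comp hf x z, h, fillIn_comp hf]

/-- A sum over basis states that vanishes unless the state agrees with `x` outside of `f`. -/
theorem sum_fillIn {Q W : Type} [Fintype Q] [Fintype W] [DecidableEq Q] [DecidableEq W]
    {f : Q → W} (hf : f.Injective) (x : W → Bool) (F : (W → Bool) → ℂ)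
    (hF : ∀ y, ¬ (∀ w, w ∉ Set.range f → x w = y w) → F y = 0) :
    ∑ y, F y = ∑ z : Q → Bool, F (fillIn f x z) := by
  classical
  rw [← Finset.sum_image (s := Finset.univ) (g := fillIn f x) (f := F)
    fun a _ b _ h => fillIn_injective hf x h]
  symm
  apply Finset.sum_subset (Finset.subset_univ _)
  intro y _ hy
  apply hF
  intro h
  exact hy (Finset.mem_image.2 ⟨y ∘ f, Finset.mem_univ _, fillIn_eq hf x y h⟩)

/-- A nonzero entry of either factor forces agreement outside the image of `f`, so the inner sum of
the product runs only over fillings of that image, where it is the product on the small register. -/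
theorem liftOp_mul {Q W : Type} [Fintype Q] [Fintype W] [DecidableEq Q] [DecidableEq W]
    {f : Q → W} (hf : f.Injective) (M N : Matrix (Q → Bool) (Q → Bool) ℂ) :
    liftOp f (M * N) = liftOp f M * liftOp f N := by
  classical
  ext x y
  rw [Matrix.mul_apply, sum_fillIn hf x]
  · have h1 : ∀ z, liftOp f M x (fillIn f x z) = M (x ∘ f) z := by
      intro z
      simp only [liftOp, Matrix.of_apply, fillIn_comp hf]
      rw [if_pos]
      intro w hw
      rw [fillIn_of_notMem _ _ hw]
    have h2 : ∀ z, liftOp f N (fillIn f x z) y =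
        if ∀ w, w ∉ Set.range f → x w = y w then N z (y ∘ f) else 0 := by
      intro z
      simp only [liftOp, Matrix.of_apply, fillIn_comp hf]
      congr 1
      apply propext
      refine forall_congr' fun w => forall_congr' fun hw => ?_
      rw [fillIn_of_notMem _ _ hw]
    simp only [h1, h2]
    simp only [liftOp, Matrix.of_apply]
    split_ifs
    · simp [Matrix.mul_apply]
    · simp
  · intro z hz
    rw [liftOp, Matrix.of_apply, if_neg hz, zero_mul]

theorem liftOp_one {Q W : Type} [Fintype W] [Fintype Q] {f : Q → W} :
    liftOp f (1 : Matrix (Q → Bool) (Q → Bool) ℂ) = 1 := by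
  classical
  ext x y
  simp only [liftOp, Matrix.of_apply, Matrix.one_apply]
  by_cases h : x = y
  · simp [h]
  · rw [if_neg h]
    split_ifs with h1 h2
    · exact absurd (funext fun w => by
        by_cases hw : w ∈ Set.range f
        · obtain ⟨q, rfl⟩ := hw
          exact congrFun h2 q
        · exact h1 w hw) h
    · rfl
    · rfl

theorem liftOp_conjTranspose {Q W : Type} {f : Q → W} (M : Matrix (Q → Bool) (Q → Bool) ℂ) :
    liftOp f M.conjTranspose = (liftOp f M).conjTranspose := by
  classical
  ext x y
  simp only [liftOp, Matrix.of_apply, Matrix.conjTranspose_apply, eq_comm, apply_ite star,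
    star_zero]

/-! ## Gates and circuits under renaming of qubits -/

/-- `f` describes the renaming `φ` of the first `N` qubits to qubits below `N'`. -/
structure Renames (φ : ℕ → ℕ) {N N' : ℕ} (f : Fin N → Fin N') : Prop where
  inj : f.Injective
  val : ∀ i, (f i : ℕ) = φ i

theorem onQubit_rename {φ : ℕ → ℕ} {N N' : ℕ} {f : Fin N → Fin N'} (h : Renames φ f) {q : ℕ}
    (hq : q < N) (u : Matrix Bool Bool ℂ) : onQubit N' (φ q) u = liftOp f (onQubit N q u) := by
  classical
  have e : φ q = (f ⟨q, hq⟩ : ℕ) := (h.val ⟨q, hq⟩).symm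
  have hq' : φ q < N' := e ▸ (f ⟨q, hq⟩).2
  have e' : (⟨φ q, hq'⟩ : Fin N') = f ⟨q, hq⟩ := Fin.ext e
  ext x y
  simp only [onQubit, dif_pos hq, dif_pos hq', liftOp, Matrix.of_apply, e', Function.comp]
  by_cases h1 : ∀ j : Fin N', j ≠ f ⟨q, hq⟩ → x j = y j
  · rw [if_pos h1, if_pos, if_pos]
    · exact fun j hj => h1 _ (h.inj.ne hj)
    · intro w hw
      exact h1 w fun e => hw ⟨_, e.symm⟩
  · rw [if_neg h1]
    split_ifs with h2 h3
    · refine absurd (fun j hj => ?_) h1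
      by_cases hw : j ∈ Set.range f
      · obtain ⟨i, rfl⟩ := hw
        exact h3 i fun e => hj (by rw [e])
      · exact h2 j hw
    · rfl
    · rfl

theorem cnotMatrix_rename {φ : ℕ → ℕ} {N N' : ℕ} {f : Fin N → Fin N'} (h : Renames φ f) {c t : ℕ}
    (hc : c < N) (ht : t < N) (hct : c ≠ t) :
    cnotMatrix N' (φ c) (φ t) = liftOp f (cnotMatrix N c t) := by
  classical
  have ec : φ c = (f ⟨c, hc⟩ : ℕ) := (h.val ⟨c, hc⟩).symm
  have et : φ t = (f ⟨t, ht⟩ : ℕ) := (h.val ⟨t, ht⟩).symm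
  have hc' : φ c < N' := ec ▸ (f ⟨c, hc⟩).2
  have ht' : φ t < N' := et ▸ (f ⟨t, ht⟩).2
  have ec' : (⟨φ c, hc'⟩ : Fin N') = f ⟨c, hc⟩ := Fin.ext ec
  have et' : (⟨φ t, ht'⟩ : Fin N') = f ⟨t, ht⟩ := Fin.ext et
  have hne : φ c ≠ φ t := fun e => hct (by
    have : f ⟨c, hc⟩ = f ⟨t, ht⟩ := Fin.ext (ec.symm.trans (e.trans et))
    simpa using h.inj this)
  ext x y
  have k1 : c < N ∧ t < N ∧ c ≠ t := ⟨hc, ht, hct⟩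
  have k2 : φ c < N' ∧ φ t < N' ∧ φ c ≠ φ t := ⟨hc', ht', hne⟩
  simp only [cnotMatrix, dif_pos k1, dif_pos k2, liftOp, Matrix.of_apply, ec', et', Function.comp]
  by_cases h1 : x = Function.update y (f ⟨t, ht⟩) (y (f ⟨t, ht⟩) ^^ y (f ⟨c, hc⟩))
  · rw [if_pos h1, if_pos, if_pos]
    · funext i
      rw [h1]
      by_cases hi : i = ⟨t, ht⟩
      · subst hi; simp
      · rw [Function.update_of_ne hi, Function.comp, Function.update_of_ne (h.inj.ne hi)]
        rfl
    · intro w hw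
      rw [h1, Function.update_of_ne]
      exact fun e => hw ⟨_, e.symm⟩
  · rw [if_neg h1]
    split_ifs with h2 h3
    · refine absurd (funext fun j => ?_) h1
      by_cases hw : j ∈ Set.range f
      · obtain ⟨i, rfl⟩ := hw
        have := congrFun h3 i
        dsimp at this
        rw [this]
        by_cases hi : i = ⟨t, ht⟩
        · subst hi; simp
        · rw [Function.update_of_ne hi, Function.update_of_ne (h.inj.ne hi)]
          rfl
      · rw [h2 j hw, Function.update_of_ne]
        exact fun e => hw ⟨_, e.symm⟩
    · rfl
    · rfl

section
variable {ι : Type} (𝒢 : ι → Matrix.unitaryGroup Bool ℂ)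

theorem toMatrix_rename {φ : ℕ → ℕ} {N N' : ℕ} {f : Fin N → Fin N'} (h : Renames φ f)
    {g : Gate ι ℕ} (hg : g.Valid N) : (g.map φ).toMatrix 𝒢 N' = liftOp f (g.toMatrix 𝒢 N) := by
  cases g with
  | hadamard q => exact onQubit_rename h hg _
  | tgate q => exact onQubit_rename h hg _
  | cnot c t => exact cnotMatrix_rename h hg.1 hg.2.1 hg.2.2
  | extra i q => exact onQubit_rename h hg _

/-- Gates rename one at a time and `liftOp` is multiplicative. Validity matters: an out-of-range
gate is read as the identity on the small register, but its renamed version may act on the larger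
one. -/
theorem circuitMatrix_rename {φ : ℕ → ℕ} {N N' : ℕ} {f : Fin N → Fin N'} (h : Renames φ f)
    {C : List (Gate ι ℕ)} (hC : ∀ g ∈ C, g.Valid N) :
    circuitMatrix 𝒢 N' (C.map (Gate.map φ)) = liftOp f (circuitMatrix 𝒢 N C) := by
  induction C with
  | nil => simp [circuitMatrix, liftOp_one]
  | cons g C ih =>
    simp only [List.map_cons, circuitMatrix]
    rw [ih fun g hg => hC g (List.mem_cons_of_mem _ hg), toMatrix_rename 𝒢 h (hC g (by simp)),
      liftOp_mul h.inj]

theorem circuitMatrix_append (N : ℕ) (C D : List (Gate ι ℕ)) :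
    circuitMatrix 𝒢 N (C ++ D) = circuitMatrix 𝒢 N D * circuitMatrix 𝒢 N C := by
  induction C with
  | nil => simp [circuitMatrix]
  | cons g C ih => simp only [List.cons_append, circuitMatrix, ih, mul_assoc]

theorem Gate.Valid.map {φ : ℕ → ℕ} {N N' : ℕ} {f : Fin N → Fin N'} (h : Renames φ f)
    {g : Gate ι ℕ} (hg : g.Valid N) : (g.map φ).Valid N' := by
  have lt : ∀ q, q < N → φ q < N' := fun q hq => by
    have := h.val ⟨q, hq⟩
    dsimp at this
    exact this ▸ (f ⟨q, hq⟩).2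
  cases g with
  | hadamard q => exact lt _ hg
  | tgate q => exact lt _ hg
  | cnot c t =>
    refine ⟨lt _ hg.1, lt _ hg.2.1, fun e => hg.2.2 ?_⟩
    have := h.inj (a₁ := ⟨c, hg.1⟩) (a₂ := ⟨t, hg.2.1⟩)
      (Fin.ext (by rw [h.val, h.val]; exact e))
    simpa using this
  | extra i q => exact lt _ hg

theorem Gate.map_map {Q Q' Q'' : Type} (φ : Q → Q') (ψ : Q' → Q'') (g : Gate ι Q) :
    (g.map φ).map ψ = g.map (ψ ∘ φ) := by
  cases g <;> rfl

theorem Gate.Valid.mono {N N' : ℕ} (h : N ≤ N') {g : Gate ι ℕ} (hg : g.Valid N) :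
    g.Valid N' := by
  cases g with
  | cnot c t => exact ⟨hg.1.trans_le h, hg.2.1.trans_le h, hg.2.2⟩
  | hadamard q => exact lt_of_lt_of_le hg h
  | tgate q => exact lt_of_lt_of_le hg h
  | extra i q => exact lt_of_lt_of_le hg h

theorem renames_castLE {N N' : ℕ} (h : N ≤ N') : Renames id (Fin.castLE h) :=
  ⟨Fin.castLE_injective h, fun _ => rfl⟩

theorem circuitMatrix_castLE {N N' : ℕ} (h : N ≤ N') {C : List (Gate ι ℕ)}
    (hC : ∀ g ∈ C, g.Valid N) :
    circuitMatrix 𝒢 N' C = liftOp (Fin.castLE h) (circuitMatrix 𝒢 N C) := by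
  rw [← circuitMatrix_rename 𝒢 (renames_castLE h) hC]
  congr 1
  exact ((List.map_congr_left fun g _ => by cases g <;> rfl).trans (List.map_id C)).symm

/-! ## Unitarity -/

/-- Viewing a one-qubit gate as a lift from a one-element register lets its products, identity and
adjoint be inherited from `liftOp`. -/
theorem onQubit_eq_liftOp {N q : ℕ} (h : q < N) (u : Matrix Bool Bool ℂ) :
    onQubit N q u = liftOp (fun _ : Unit => (⟨q, h⟩ : Fin N))
      (Matrix.of fun x y => u (x ()) (y ())) := by
  classical
  ext x y
  simp [onQubit, h, liftOp]

theorem unit_mul (u v : Matrix Bool Bool ℂ) :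
    (Matrix.of fun x y => (u * v) (x ()) (y ()) : Matrix (Unit → Bool) (Unit → Bool) ℂ) =
      Matrix.of (fun x y => u (x ()) (y ())) * Matrix.of (fun x y => v (x ()) (y ())) := by
  ext x y
  simp only [Matrix.of_apply, Matrix.mul_apply]
  exact (Equiv.sum_comp (Equiv.funUnique Unit Bool) fun b => u (x ()) b * v b (y ())).symm

theorem unit_one :
    (Matrix.of fun x y => (1 : Matrix Bool Bool ℂ) (x ()) (y ()) :
      Matrix (Unit → Bool) (Unit → Bool) ℂ) = 1 := by
  ext x y
  have : x = y ↔ x () = y () := ⟨fun h => by rw [h], fun h => funext fun _ => h⟩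
  simp [Matrix.one_apply, this]

theorem onQubit_mul (N q : ℕ) (u v : Matrix Bool Bool ℂ) :
    onQubit N q (u * v) = onQubit N q u * onQubit N q v := by
  by_cases h : q < N
  · rw [onQubit_eq_liftOp h, onQubit_eq_liftOp h, onQubit_eq_liftOp h, unit_mul,
      liftOp_mul fun _ _ _ => rfl]
  · simp [onQubit, h]

theorem onQubit_one (N q : ℕ) : onQubit N q 1 = 1 := by
  by_cases h : q < N
  · rw [onQubit_eq_liftOp h, unit_one, liftOp_one]
  · simp [onQubit, h]

theorem onQubit_conjTranspose (N q : ℕ) (u : Matrix Bool Bool ℂ) :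
    onQubit N q u.conjTranspose = (onQubit N q u).conjTranspose := by
  by_cases h : q < N
  · rw [onQubit_eq_liftOp h, onQubit_eq_liftOp h, ← liftOp_conjTranspose]
    rfl
  · simp [onQubit, h]

theorem hadamardMatrix_unitary : hadamardMatrix.conjTranspose * hadamardMatrix = 1 := by
  have h : (Real.sqrt 2 : ℂ) * (Real.sqrt 2 : ℂ) = 2 := by
    rw [← Complex.ofReal_mul, Real.mul_self_sqrt (by norm_num)]; norm_num
  have h0 : (Real.sqrt 2 : ℂ) ≠ 0 := by
    intro h0; rw [h0] at h; norm_num at h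
  ext a b
  simp only [Matrix.mul_apply, Matrix.conjTranspose_apply, hadamardMatrix, Matrix.of_apply,
    Fintype.sum_bool, Matrix.one_apply]
  cases a <;> cases b <;> simp <;> field_simp <;> first | linear_combination (-1) * h | ring

theorem tMatrix_unitary : tMatrix.conjTranspose * tMatrix = 1 := by
  rw [tMatrix, Matrix.diagonal_conjTranspose, Matrix.diagonal_mul_diagonal, ← Matrix.diagonal_one]
  congr 1
  funext b
  cases b
  · simp
  · simp only [Pi.star_apply, if_true, RCLike.star_def, ← Complex.exp_conj, ← Complex.exp_add,
      map_mul, Complex.conj_I, Complex.conj_ofReal]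
    simp

theorem cnotMatrix_unitary (N c t : ℕ) :
    (cnotMatrix N c t).conjTranspose * cnotMatrix N c t = 1 := by
  unfold cnotMatrix
  split_ifs with h
  · ext x y
    simp only [Matrix.mul_apply, Matrix.conjTranspose_apply, Matrix.of_apply]
    simp only [apply_ite star, star_one, star_zero, mul_ite, mul_one, mul_zero,
      Finset.sum_ite_eq', Finset.mem_univ, if_true, Matrix.one_apply]
    congr 1
    apply propext
    have hne : (⟨c, h.1⟩ : Fin N) ≠ ⟨t, h.2.1⟩ := by simpa using h.2.2
    constructor
    · intro e
      have hc : y ⟨c, h.1⟩ = x ⟨c, h.1⟩ := by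
        simpa [Function.update_of_ne hne] using congrFun e ⟨c, h.1⟩
      funext i
      have := congrFun e i
      by_cases hi : i = ⟨t, h.2.1⟩
      · subst hi
        simp only [Function.update_self, hc, Bool.xor_left_inj] at this
        exact this.symm
      · rw [Function.update_of_ne hi, Function.update_of_ne hi] at this
        exact this.symm
    · rintro rfl; rfl
  · simp

theorem toMatrix_unitary (N : ℕ) (g : Gate ι ℕ) :
    (g.toMatrix 𝒢 N).conjTranspose * g.toMatrix 𝒢 N = 1 := by
  cases g with
  | hadamard q =>
    simp only [Gate.toMatrix]
    rw [← onQubit_conjTranspose, ← onQubit_mul, hadamardMatrix_unitary, onQubit_one]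
  | tgate q =>
    simp only [Gate.toMatrix]
    rw [← onQubit_conjTranspose, ← onQubit_mul, tMatrix_unitary, onQubit_one]
  | cnot c t => exact cnotMatrix_unitary N c t
  | extra i q =>
    simp only [Gate.toMatrix]
    rw [← onQubit_conjTranspose, ← onQubit_mul, ← Matrix.star_eq_conjTranspose,
      Matrix.mem_unitaryGroup_iff'.1 (𝒢 i).2, onQubit_one]

theorem circuitMatrix_unitary (N : ℕ) (C : List (Gate ι ℕ)) :
    (circuitMatrix 𝒢 N C).conjTranspose * circuitMatrix 𝒢 N C = 1 := by
  induction C with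
  | nil => simp [circuitMatrix]
  | cons g C ih =>
    rw [circuitMatrix, Matrix.conjTranspose_mul, mul_assoc, ← mul_assoc _ (circuitMatrix 𝒢 N C), ih,
      one_mul, toMatrix_unitary]

end

/-! ## Kraus operators of a circuit -/

theorem sum_append {R : Type*} [AddCommMonoid R] (n a : ℕ) (F : (Fin (n + a) → Bool) → R) :
    ∑ x, F x = ∑ x : Fin n → Bool, ∑ z : Fin a → Bool, F (Fin.append x z) := by
  rw [← Fintype.sum_prod_type']
  exact (Fintype.sum_equiv (Fin.appendEquiv n a) _ _ fun _ => rfl).symm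

theorem append_inj {n a : ℕ} {x x' : Fin n → Bool} {z z' : Fin a → Bool} :
    Fin.append x z = Fin.append x' z' ↔ x = x' ∧ z = z' := by
  constructor
  · intro h
    have := (Fin.appendEquiv n a).injective (a₁ := (x, z)) (a₂ := (x', z')) h
    simpa using this
  · rintro ⟨rfl, rfl⟩; rfl

section
variable {ι : Type} (𝒢 : ι → Matrix.unitaryGroup Bool ℂ)

/-- The Kraus operator of a circuit that belongs to the final value `z` of the ancillas. -/
def krausOp (n a : ℕ) (C : List (Gate ι ℕ)) (z : Fin a → Bool) : QOp n :=
  Matrix.of fun x y => circuitMatrix 𝒢 (n + a) C (Fin.append x z) (Fin.append y fun _ => false)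

theorem addAncillas_append (n a : ℕ) (ρ : QOp n) (x y : Fin n → Bool) (z w : Fin a → Bool) :
    addAncillas n a ρ (Fin.append x z) (Fin.append y w) =
      if w = (fun _ => false) then (if z = (fun _ => false) then ρ x y else 0) else 0 := by
  simp only [addAncillas, zeroState, Matrix.of_apply, Fin.append_left, Fin.append_right,
    funext_iff]
  split_ifs <;> simp_all

/-- Ancillas start in 0, so only the columns of the unitary with zero ancilla part survive; grouping
the rows by the final ancilla value gives the Kraus operators. -/
theorem runCircuit_append (n a : ℕ) (C : List (Gate ι ℕ)) (ρ : QOp n) (x y : Fin n → Bool)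
    (z w : Fin a → Bool) :
    runCircuit 𝒢 n a C ρ (Fin.append x z) (Fin.append y w) =
      (krausOp 𝒢 n a C z * ρ * (krausOp 𝒢 n a C w).conjTranspose) x y := by
  simp only [runCircuit, Matrix.mul_apply, sum_append, addAncillas_append, mul_ite, mul_zero,
    Matrix.conjTranspose_apply, krausOp, Matrix.of_apply]
  refine Finset.sum_congr rfl fun y' _ => ?_
  rw [Finset.sum_eq_single (fun _ => false)]
  · simp
  · intro w' _ hw'
    simp [hw']
  · simp

theorem circuitChannel_eq_sum (n a : ℕ) (C : List (Gate ι ℕ)) (ρ : QOp n) :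
    circuitChannel 𝒢 n a C ρ =
      ∑ z, krausOp 𝒢 n a C z * ρ * (krausOp 𝒢 n a C z).conjTranspose := by
  ext x y
  simp only [circuitChannel, traceOutLast, Matrix.of_apply, runCircuit_append, Matrix.sum_apply]

/-- This is the block of U†U = 1 with both ancilla indices zero. -/
theorem krausOp_complete (n a : ℕ) (C : List (Gate ι ℕ)) :
    ∑ z, (krausOp 𝒢 n a C z).conjTranspose * krausOp 𝒢 n a C z = 1 := by
  ext x y
  have := congrFun (congrFun (circuitMatrix_unitary 𝒢 (n + a) C) (Fin.append x fun _ => false))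
    (Fin.append y fun _ => false)
  rw [Matrix.mul_apply, sum_append, Finset.sum_comm] at this
  simp only [Matrix.sum_apply, Matrix.mul_apply, Matrix.conjTranspose_apply, krausOp,
    Matrix.of_apply] at this ⊢
  rw [this]
  simp [Matrix.one_apply, append_inj]

/-- The output bit in the basis state `(x, z)`. -/
def outputBit {n a : ℕ} (x : Fin n → Bool) (z : Fin a → Bool) : Prop :=
  ∃ i : Fin (n + a), (i : ℕ) = 0 ∧ Fin.append x z i = true

open Classical in
theorem acceptProb_eq_sum (n a : ℕ) (C : List (Gate ι ℕ)) (ρ : QOp n) :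
    acceptProb 𝒢 n a C ρ = ∑ x, ∑ z : Fin a → Bool, if outputBit x z then
      ((krausOp 𝒢 n a C z * ρ * (krausOp 𝒢 n a C z).conjTranspose) x x).re else 0 := by
  simp only [acceptProb, sum_append, runCircuit_append]
  refine Finset.sum_congr rfl fun x _ => Finset.sum_congr rfl fun z _ => ?_
  exact if_congr Iff.rfl rfl rfl

theorem circuitChannel_smul (n a : ℕ) (C : List (Gate ι ℕ)) (c : ℂ) (ρ : QOp n) :
    circuitChannel 𝒢 n a C (c • ρ) = c • circuitChannel 𝒢 n a C ρ := by
  simp only [circuitChannel_eq_sum, Matrix.mul_smul, Matrix.smul_mul, Finset.smul_sum]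

theorem circuitChannel_isQuantumChannel (n a : ℕ) (C : List (Gate ι ℕ)) :
    IsQuantumChannel n (circuitChannel 𝒢 n a C) := by
  let e := Fintype.equivFin (Fin a → Bool)
  refine ⟨_, fun j => krausOp 𝒢 n a C (e.symm j), ?_, fun ρ => ?_⟩
  · rw [← krausOp_complete 𝒢 n a C]
    exact Fintype.sum_equiv e.symm _ _ fun _ => rfl
  · rw [circuitChannel_eq_sum]
    exact (Fintype.sum_equiv e.symm _ _ fun _ => rfl).symm

/-! ### The effect measured by a circuit -/

open Classical in
/-- The effect of the circuit for a set `B` of final basis states. -/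
def effect (n a : ℕ) (C : List (Gate ι ℕ)) (B : (Fin n → Bool) → (Fin a → Bool) → Prop) : QOp n :=
  ∑ z, (krausOp 𝒢 n a C z).conjTranspose * Matrix.diagonal (fun x => if B x z then 1 else 0) *
    krausOp 𝒢 n a C z

open scoped ComplexOrder in
theorem effect_posSemidef (n a : ℕ) (C : List (Gate ι ℕ))
    (B : (Fin n → Bool) → (Fin a → Bool) → Prop) : (effect 𝒢 n a C B).PosSemidef := by
  classical
  refine Matrix.posSemidef_sum _ fun z _ => Matrix.PosSemidef.conjTranspose_mul_mul_same ?_ _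
  refine Matrix.PosSemidef.diagonal fun x => ?_
  dsimp
  split_ifs <;> simp

/-- Completeness of the Kraus operators, split along the final basis states. It allows a lower bound
valid for every effect to be turned into a two-sided bound by applying it to the complement too. -/
theorem effect_add_compl (n a : ℕ) (C : List (Gate ι ℕ))
    (B : (Fin n → Bool) → (Fin a → Bool) → Prop) :
    effect 𝒢 n a C B + effect 𝒢 n a C (fun x z => ¬ B x z) = 1 := by
  classical
  rw [← krausOp_complete 𝒢 n a C, effect, effect, ← Finset.sum_add_distrib]
  refine Finset.sum_congr rfl fun z _ => ?_
  rw [← Matrix.add_mul, ← Matrix.mul_add, Matrix.diagonal_add]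
  have : ∀ D : (Fin n → Bool) → ℂ, (∀ x, D x = 1) → (krausOp 𝒢 n a C z).conjTranspose *
      Matrix.diagonal D * krausOp 𝒢 n a C z =
      (krausOp 𝒢 n a C z).conjTranspose * krausOp 𝒢 n a C z := fun D hD => by
    rw [show D = fun _ => 1 from funext hD, Matrix.diagonal_one, mul_one]
  refine this _ fun x => ?_
  by_cases h : B x z <;> simp [h]

theorem acceptProb_eq_trace (n a : ℕ) (C : List (Gate ι ℕ)) (ρ : QOp n) :
    acceptProb 𝒢 n a C ρ = (effect 𝒢 n a C outputBit * ρ).trace.re := by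
  classical
  rw [acceptProb_eq_sum, effect, Finset.sum_mul, Matrix.trace_sum, Complex.re_sum,
    Finset.sum_comm]
  refine Finset.sum_congr rfl fun z _ => ?_
  have : ∀ K D : QOp n, (K.conjTranspose * D * K * ρ).trace =
      (D * (K * ρ * K.conjTranspose)).trace := fun K D => by
    rw [mul_assoc, mul_assoc, Matrix.trace_mul_comm]
    simp only [mul_assoc]
  rw [this, Matrix.trace, Complex.re_sum]
  refine Finset.sum_congr rfl fun x _ => ?_
  rw [Matrix.diag, Matrix.diagonal_mul]
  split_ifs <;> simp

/-! ## Sequential composition -/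

/-- Move the ancillas of a circuit on `d` qubits behind `a` further ancillas. -/
def shiftAncillas (d a h : ℕ) : ℕ := if h < d then h else h + a

theorem renames_shiftAncillas (d a b : ℕ) : Renames (shiftAncillas d a)
    (Fin.addCases (fun i => Fin.castAdd (a + b) i) (fun j => Fin.natAdd d (Fin.natAdd a j)) :
      Fin (d + b) → Fin (d + (a + b))) := by
  have val : ∀ i, ((Fin.addCases (fun i => Fin.castAdd (a + b) i)
      (fun j => Fin.natAdd d (Fin.natAdd a j)) : Fin (d + b) → Fin (d + (a + b))) i : ℕ) =
      shiftAncillas d a i := by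
    intro i
    refine Fin.addCases (fun i => ?_) (fun j => ?_) i
    · simp [shiftAncillas]
    · simp [shiftAncillas]; omega
  refine ⟨fun i j h => ?_, val⟩
  have h2 := congrArg Fin.val h
  rw [val, val, shiftAncillas, shiftAncillas] at h2
  apply Fin.ext
  split_ifs at h2 <;> omega

theorem append_comp_castLE {d a b : ℕ} (h : d + a ≤ d + (a + b)) (x : Fin d → Bool)
    (w : Fin a → Bool) (z : Fin b → Bool) :
    Fin.append x (Fin.append w z) ∘ Fin.castLE h = Fin.append x w := by
  funext i
  refine Fin.addCases (fun i => ?_) (fun j => ?_) i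
  · have : Fin.castLE h (Fin.castAdd a i) = Fin.castAdd (a + b) i := rfl
    simp [this]
  · have : Fin.castLE h (Fin.natAdd d j) = Fin.natAdd d (Fin.castAdd b j) := rfl
    simp [this]

theorem liftOp_castLE_append (d a b : ℕ) (M : QOp (d + a)) (x x' : Fin d → Bool)
    (w w' : Fin a → Bool) (z z' : Fin b → Bool) (h : d + a ≤ d + (a + b)) :
    liftOp (Fin.castLE h) M (Fin.append x (Fin.append w z)) (Fin.append x' (Fin.append w' z')) =
      if z = z' then M (Fin.append x w) (Fin.append x' w') else 0 := by
  classical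
  simp only [liftOp, Matrix.of_apply, append_comp_castLE]
  congr 1
  apply propext
  constructor
  · intro hw
    funext i
    simpa using hw (Fin.natAdd d (Fin.natAdd a i)) (by
      rintro ⟨j, hj⟩
      have := congrArg Fin.val hj
      simp at this
      omega)
  · rintro rfl i hi
    revert hi
    refine Fin.addCases (fun i => ?_) (fun j => ?_) i
    · exact fun hi => absurd ⟨Fin.castAdd a i, rfl⟩ hi
    · refine Fin.addCases (fun j => ?_) (fun k => ?_) j
      · exact fun hi => absurd ⟨Fin.natAdd d j, rfl⟩ hi
      · intro _; simp

theorem liftOp_shift_append (d a b : ℕ) (M : QOp (d + b)) (x x' : Fin d → Bool)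
    (w w' : Fin a → Bool) (z z' : Fin b → Bool) :
    liftOp (Fin.addCases (fun i => Fin.castAdd (a + b) i) (fun j => Fin.natAdd d (Fin.natAdd a j)) :
      Fin (d + b) → Fin (d + (a + b))) M
      (Fin.append x (Fin.append w z)) (Fin.append x' (Fin.append w' z')) =
      if w = w' then M (Fin.append x z) (Fin.append x' z') else 0 := by
  classical
  set f := (Fin.addCases (fun i => Fin.castAdd (a + b) i)
    (fun j => Fin.natAdd d (Fin.natAdd a j)) : Fin (d + b) → Fin (d + (a + b))) with hf
  have f1 : ∀ i, f (Fin.castAdd b i) = Fin.castAdd (a + b) i := fun i => by simp [hf]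
  have f2 : ∀ j, f (Fin.natAdd d j) = Fin.natAdd d (Fin.natAdd a j) := fun i => by simp [hf]
  have hc : ∀ (x : Fin d → Bool) (w : Fin a → Bool) (z : Fin b → Bool),
      Fin.append x (Fin.append w z) ∘ f = Fin.append x z := by
    intro x w z
    funext i
    refine Fin.addCases (fun i => ?_) (fun j => ?_) i
    · simp [f1]
    · simp [f2]
  simp only [liftOp, Matrix.of_apply, hc]
  congr 1
  apply propext
  constructor
  · intro hw
    funext i
    simpa using hw (Fin.natAdd d (Fin.castAdd b i)) (by
      rintro ⟨j, hj⟩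
      revert hj
      refine Fin.addCases (fun j => ?_) (fun k => ?_) j
      · rw [f1]; intro hj
        have := congrArg Fin.val hj
        simp at this
        omega
      · rw [f2]; intro hj
        have := congrArg Fin.val hj
        simp at this
        omega)
  · rintro rfl i hi
    revert hi
    refine Fin.addCases (fun i => ?_) (fun j => ?_) i
    · exact fun hi => absurd ⟨Fin.castAdd b i, f1 i⟩ hi
    · refine Fin.addCases (fun j => ?_) (fun k => ?_) j
      · intro _; simp
      · exact fun hi => absurd ⟨Fin.natAdd d k, f2 k⟩ hi

theorem append_false (a b : ℕ) :
    (fun _ => false : Fin (a + b) → Bool) = Fin.append (fun _ => false) (fun _ => false) := by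
  funext i
  refine Fin.addCases (fun i => ?_) (fun j => ?_) i <;> simp

theorem krausOp_comp {d a b : ℕ} {C D : List (Gate ι ℕ)} (hC : ∀ g ∈ C, g.Valid (d + b))
    (hD : ∀ g ∈ D, g.Valid (d + a)) (w : Fin a → Bool) (z : Fin b → Bool) :
    krausOp 𝒢 d (a + b) (C.map (Gate.map (shiftAncillas d a)) ++ D) (Fin.append w z) =
      krausOp 𝒢 d a D w * krausOp 𝒢 d b C z := by
  ext x y
  simp only [krausOp, Matrix.of_apply, Matrix.mul_apply]
  rw [circuitMatrix_append, circuitMatrix_rename 𝒢 (renames_shiftAncillas d a b) hC,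
    circuitMatrix_castLE 𝒢 (show d + a ≤ d + (a + b) by omega) hD, Matrix.mul_apply, append_false]
  simp only [sum_append, liftOp_castLE_append, liftOp_shift_append, ite_mul, mul_ite, zero_mul,
    mul_zero]
  refine Finset.sum_congr rfl fun x' _ => ?_
  rw [Finset.sum_eq_single (fun _ => false)]
  · simp
  · intro w' _ hw'
    simp [hw']
  · simp

theorem circuitChannel_comp {d a b : ℕ} {C D : List (Gate ι ℕ)} (hC : ∀ g ∈ C, g.Valid (d + b))
    (hD : ∀ g ∈ D, g.Valid (d + a)) (ρ : QOp d) :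
    circuitChannel 𝒢 d (a + b) (C.map (Gate.map (shiftAncillas d a)) ++ D) ρ =
      circuitChannel 𝒢 d a D (circuitChannel 𝒢 d b C ρ) := by
  simp only [circuitChannel_eq_sum, sum_append, krausOp_comp 𝒢 hC hD, Finset.mul_sum,
    Finset.sum_mul, Matrix.conjTranspose_mul, mul_assoc]

theorem outputBit_append {d a b : ℕ} (x : Fin d → Bool) (w : Fin a → Bool) (z : Fin b → Bool)
    (h : 0 < d + a) : outputBit x (Fin.append w z) ↔ outputBit x w := by
  have hle : d + a ≤ d + (a + b) := by omega
  rw [outputBit, outputBit, ← append_comp_castLE hle x w z]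
  constructor
  · rintro ⟨i, hi, h1⟩
    refine ⟨⟨0, h⟩, rfl, ?_⟩
    rw [← h1]
    have : i = Fin.castLE hle ⟨0, h⟩ := Fin.ext hi
    rw [this]
    rfl
  · rintro ⟨i, hi, h1⟩
    exact ⟨Fin.castLE hle i, hi, h1⟩

/-- The condition `0 < d + a` ensures that qubit 0 belongs to `D`; with no such qubit, the measured
qubit of the composition could be an ancilla of `C`. -/
theorem acceptProb_comp {d a b : ℕ} {C D : List (Gate ι ℕ)} (hC : ∀ g ∈ C, g.Valid (d + b))
    (hD : ∀ g ∈ D, g.Valid (d + a)) (ρ : QOp d) (h : 0 < d + a) :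
    acceptProb 𝒢 d (a + b) (C.map (Gate.map (shiftAncillas d a)) ++ D) ρ =
      acceptProb 𝒢 d a D (circuitChannel 𝒢 d b C ρ) := by
  classical
  simp only [acceptProb_eq_sum, circuitChannel_eq_sum, sum_append, krausOp_comp 𝒢 hC hD,
    Finset.mul_sum, Finset.sum_mul, Matrix.conjTranspose_mul, mul_assoc, Matrix.sum_apply,
    Complex.re_sum, outputBit_append _ _ _ h]
  refine Finset.sum_congr rfl fun x _ => Finset.sum_congr rfl fun w _ => ?_
  split_ifs <;> simp

end

/-! ## Tensor products -/

/-- `⨂ⱼ A j` on a register `W` that consists of `t` registers `Q`. -/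
def tensorOp {Q W : Type} {t : ℕ} (e : Fin t × Q ≃ W)
    (A : Fin t → Matrix (Q → Bool) (Q → Bool) ℂ) : Matrix (W → Bool) (W → Bool) ℂ :=
  Matrix.of fun X Y => ∏ j, A j (fun q => X (e (j, q))) (fun q => Y (e (j, q)))

section
set_option linter.unusedSectionVars false
variable {Q W : Type} [Fintype Q] [Fintype W] [DecidableEq Q] [DecidableEq W] {t : ℕ}
  (e : Fin t × Q ≃ W)

/-- Basis states of a register that consists of `t` registers. -/
def splitState {Q W : Type} {t : ℕ} (e : Fin t × Q ≃ W) :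
    (W → Bool) ≃ (Fin t → Q → Bool) :=
  (Equiv.arrowCongr e.symm (Equiv.refl Bool)).trans (Equiv.curry _ _ _)

theorem splitState_apply {Q W : Type} {t : ℕ} (e : Fin t × Q ≃ W) (X : W → Bool) (j : Fin t) :
    splitState e X j = fun q => X (e (j, q)) := rfl

/-- Distributivity of products over sums, read along the splitting of the register; every
factorisation of tensor products below comes down to it. -/
theorem sum_prod_split {R : Type*} [CommSemiring R] (F : Fin t → (Q → Bool) → R) :
    ∑ X : W → Bool, ∏ j, F j (fun q => X (e (j, q))) = ∏ j, ∑ x, F j x := by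
  classical
  rw [Finset.prod_univ_sum, Fintype.piFinset_univ]
  exact Fintype.sum_equiv (splitState e) _ _ fun _ => rfl

theorem tensorOp_mul (A B : Fin t → Matrix (Q → Bool) (Q → Bool) ℂ) :
    tensorOp e A * tensorOp e B = tensorOp e (fun j => A j * B j) := by
  ext X Y
  simp only [tensorOp, Matrix.mul_apply, Matrix.of_apply, ← Finset.prod_mul_distrib]
  exact sum_prod_split e fun j x => A j (fun q => X (e (j, q))) x * B j x fun q => Y (e (j, q))

theorem tensorOp_conjTranspose (A : Fin t → Matrix (Q → Bool) (Q → Bool) ℂ) :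
    (tensorOp e A).conjTranspose = tensorOp e fun j => (A j).conjTranspose := by
  ext X Y
  simp [tensorOp]

theorem sum_tensorOp {Q' W' : Type} [Fintype Q'] [Fintype W'] [DecidableEq Q'] [DecidableEq W']
    (e' : Fin t × Q' ≃ W') (F : Fin t → (Q' → Bool) → Matrix (Q → Bool) (Q → Bool) ℂ) :
    ∑ z : W' → Bool, tensorOp e (fun j => F j fun q => z (e' (j, q))) =
      tensorOp e fun j => ∑ w, F j w := by
  ext X Y
  simp only [tensorOp, Matrix.sum_apply, Matrix.of_apply]
  exact sum_prod_split e' fun j w => F j w (fun q => X (e (j, q))) fun q => Y (e (j, q))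

theorem tensorOp_one : tensorOp e (fun _ => 1) = 1 := by
  ext X Y
  simp only [tensorOp, Matrix.of_apply, Matrix.one_apply]
  rw [Finset.prod_ite_zero]
  simp only [Finset.prod_const_one, Finset.mem_univ, true_imp_iff]
  congr 1
  apply propext
  constructor
  · intro h
    exact (splitState e).injective (funext h)
  · rintro rfl _; rfl

/-- Agreement outside register j is agreement in every other register, that is, a product of entries
of identity matrices. -/
theorem liftOp_eq_tensorOp (j : Fin t) (M : Matrix (Q → Bool) (Q → Bool) ℂ) :
    liftOp (fun q => e (j, q)) M = tensorOp e (fun l => if l = j then M else 1) := by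
  classical
  ext X Y
  simp only [liftOp, tensorOp, Matrix.of_apply]
  rw [← Finset.mul_prod_erase Finset.univ _ (Finset.mem_univ j), if_pos rfl]
  have : ∏ x ∈ Finset.univ.erase j, (if x = j then M else 1) (fun q => X (e (x, q)))
      (fun q => Y (e (x, q))) =
      ∏ x ∈ Finset.univ.erase j, if (fun q => X (e (x, q))) = (fun q => Y (e (x, q))) then 1
        else 0 :=
    Finset.prod_congr rfl fun x hx => by
      rw [if_neg (Finset.ne_of_mem_erase hx), Matrix.one_apply]
  rw [this, Finset.prod_ite_zero, Finset.prod_const_one, mul_ite, mul_one, mul_zero]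
  congr 1
  apply propext
  constructor
  · intro h l hl
    funext q
    refine h _ ?_
    rintro ⟨q', hq'⟩
    have := e.injective hq'
    simp only [Prod.mk.injEq] at this
    exact Finset.ne_of_mem_erase hl this.1.symm
  · intro h w hw
    obtain ⟨⟨l, q⟩, rfl⟩ := e.surjective w
    exact congrFun (h l (Finset.mem_erase.2 ⟨fun hl => hw ⟨q, by rw [hl]⟩, Finset.mem_univ _⟩)) q

end

theorem copies_eq_tensorOp (n t : ℕ) (ρ : QOp n) :
    copies n t ρ = tensorOp finProdFinEquiv fun _ => ρ := rfl

/-! ## Parallel runs of a circuit -/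

/-- Qubit numbers of run number `j` among `t` runs of a circuit with `n` input qubits and `a`
ancillas. -/
def parallelIndex (n t a j h : ℕ) : ℕ := if h < n then h + n * j else h + (t * n - n + a * j)

/-- The circuit `C` on each of `t` inputs. -/
def parallelCircuit {ι : Type} (n t a : ℕ) (C : List (Gate ι ℕ)) : List (Gate ι ℕ) :=
  (List.range t).flatMap fun j => C.map (Gate.map (parallelIndex n t a j))

/-- The qubits of `t` runs of a circuit. -/
def parallelEquiv (n t a : ℕ) : Fin t × Fin (n + a) ≃ Fin (t * n + t * a) :=
  (((Equiv.refl _).prodCongr finSumFinEquiv.symm).trans (Equiv.prodSumDistrib _ _ _)).trans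
    ((Equiv.sumCongr finProdFinEquiv finProdFinEquiv).trans finSumFinEquiv)

theorem parallelEquiv_castAdd (n t a : ℕ) (j : Fin t) (i : Fin n) :
    parallelEquiv n t a (j, Fin.castAdd a i) = Fin.castAdd (t * a) (finProdFinEquiv (j, i)) := by
  simp [parallelEquiv]

theorem parallelEquiv_natAdd (n t a : ℕ) (j : Fin t) (i : Fin a) :
    parallelEquiv n t a (j, Fin.natAdd n i) = Fin.natAdd (t * n) (finProdFinEquiv (j, i)) := by
  simp [parallelEquiv]

theorem renames_parallelIndex (n t a : ℕ) (j : Fin t) :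
    Renames (parallelIndex n t a j) fun q => parallelEquiv n t a (j, q) := by
  refine ⟨fun q q' h => by simpa using h, fun i => ?_⟩
  refine Fin.addCases (fun i => ?_) (fun i => ?_) i
  · rw [parallelEquiv_castAdd]
    simp [parallelIndex]
  · rw [parallelEquiv_natAdd]
    have : n ≤ t * n := Nat.le_mul_of_pos_left _ j.pos
    simp [parallelIndex]
    omega

section
variable {ι : Type} (𝒢 : ι → Matrix.unitaryGroup Bool ℂ)

theorem parallelCircuit_valid {n t a : ℕ} {C : List (Gate ι ℕ)} (hC : ∀ g ∈ C, g.Valid (n + a)) :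
    ∀ g ∈ parallelCircuit n t a C, g.Valid (t * n + t * a) := by
  intro g hg
  simp only [parallelCircuit, List.mem_flatMap, List.mem_range, List.mem_map] at hg
  obtain ⟨j, hj, g, hg, rfl⟩ := hg
  exact (hC g hg).map (renames_parallelIndex n t a ⟨j, hj⟩)

/-- Induction over the runs already performed: each run multiplies its own tensor factor by the
circuit unitary. `Nodup` prevents any factor from receiving it twice. -/
theorem circuitMatrix_flatMap_parallel {n t a : ℕ} {C : List (Gate ι ℕ)}
    (hC : ∀ g ∈ C, g.Valid (n + a)) (L : List (Fin t)) (hL : L.Nodup) :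
    circuitMatrix 𝒢 (t * n + t * a)
      (L.flatMap fun j : Fin t => C.map (Gate.map (parallelIndex n t a j))) =
      tensorOp (parallelEquiv n t a) fun j => if j ∈ L then circuitMatrix 𝒢 (n + a) C else 1 := by
  induction L with
  | nil => simp [circuitMatrix, tensorOp_one]
  | cons j L ih =>
    rw [List.nodup_cons] at hL
    rw [List.flatMap_cons, circuitMatrix_append, ih hL.2,
      circuitMatrix_rename 𝒢 (renames_parallelIndex n t a j) hC, liftOp_eq_tensorOp, tensorOp_mul]
    congr 1
    funext l
    by_cases h : l = j
    · subst h; simp [hL.1]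
    · simp [h]

theorem circuitMatrix_parallelCircuit {n t a : ℕ} {C : List (Gate ι ℕ)}
    (hC : ∀ g ∈ C, g.Valid (n + a)) :
    circuitMatrix 𝒢 (t * n + t * a) (parallelCircuit n t a C) =
      tensorOp (parallelEquiv n t a) fun _ => circuitMatrix 𝒢 (n + a) C := by
  have h := circuitMatrix_flatMap_parallel 𝒢 hC (List.finRange t) (List.nodup_finRange t)
  simp only [List.mem_finRange, if_true] at h
  rw [← h, parallelCircuit, ← List.map_coe_finRange_eq_range, List.flatMap_map]

theorem krausOp_parallelCircuit {n t a : ℕ} {C : List (Gate ι ℕ)}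
    (hC : ∀ g ∈ C, g.Valid (n + a)) (z : Fin (t * a) → Bool) :
    krausOp 𝒢 (t * n) (t * a) (parallelCircuit n t a C) z =
      tensorOp finProdFinEquiv fun j => krausOp 𝒢 n a C fun i => z (finProdFinEquiv (j, i)) := by
  ext x y
  simp only [krausOp, circuitMatrix_parallelCircuit 𝒢 hC, tensorOp, Matrix.of_apply]
  have key : ∀ (x : Fin (t * n) → Bool) (z : Fin (t * a) → Bool) (j : Fin t),
      (fun q => Fin.append x z (parallelEquiv n t a (j, q))) =
        Fin.append (fun i => x (finProdFinEquiv (j, i))) fun i => z (finProdFinEquiv (j, i)) := by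
    intro x z j
    funext q
    refine Fin.addCases (fun i => ?_) (fun i => ?_) q
    · rw [parallelEquiv_castAdd]; simp
    · rw [parallelEquiv_natAdd]; simp
  simp only [key]

theorem circuitChannel_parallelCircuit {n t a : ℕ} {C : List (Gate ι ℕ)}
    (hC : ∀ g ∈ C, g.Valid (n + a)) (ρ : QOp n) :
    circuitChannel 𝒢 (t * n) (t * a) (parallelCircuit n t a C) (copies n t ρ) =
      copies n t (circuitChannel 𝒢 n a C ρ) := by
  simp only [circuitChannel_eq_sum, krausOp_parallelCircuit 𝒢 hC, copies_eq_tensorOp,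
    tensorOp_conjTranspose, tensorOp_mul]
  exact sum_tensorOp finProdFinEquiv finProdFinEquiv
    fun _ z => krausOp 𝒢 n a C z * ρ * (krausOp 𝒢 n a C z).conjTranspose

end

/-! ## Invariance of the Haar measure on pure states -/

/-- The homeomorphism of the unit sphere given by a linear isometry. -/
def sphereHomeomorph {E : Type*} [NormedAddCommGroup E] [NormedSpace ℝ E] (L : E ≃ₗᵢ[ℝ] E) :
    Metric.sphere (0 : E) 1 ≃ₜ Metric.sphere (0 : E) 1 where
  toFun ψ := ⟨L ψ, by simp⟩
  invFun ψ := ⟨L.symm ψ, by simp⟩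
  left_inv ψ := by simp
  right_inv ψ := by simp
  continuous_toFun := by fun_prop
  continuous_invFun := by fun_prop

-- Up to the dimension factor, the spherical measure of a set is the volume of the cone over it. A
-- linear isometry carries cones to cones and preserves volume.
open scoped Pointwise in
theorem toSphere_measurePreserving {E : Type*} [NormedAddCommGroup E] [InnerProductSpace ℝ E]
    [FiniteDimensional ℝ E] [MeasurableSpace E] [BorelSpace E] (L : E ≃ₗᵢ[ℝ] E) :
    MeasurePreserving (sphereHomeomorph L) (volume : Measure E).toSphere
      (volume : Measure E).toSphere := by
  refine ⟨(sphereHomeomorph L).measurable, ?_⟩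
  ext s hs
  rw [Measure.map_apply (sphereHomeomorph L).measurable hs, Measure.toSphere_apply' _ hs,
    Measure.toSphere_apply' _ ((sphereHomeomorph L).measurable hs)]
  congr 1
  have : Set.Ioo (0 : ℝ) 1 • (Subtype.val '' (sphereHomeomorph L ⁻¹' s)) =
      L ⁻¹' (Set.Ioo (0 : ℝ) 1 • (Subtype.val '' s)) := by
    ext v
    simp only [Set.mem_smul, Set.mem_image, Set.mem_preimage]
    constructor
    · rintro ⟨r, hr, _, ⟨ψ, hψ, rfl⟩, rfl⟩
      exact ⟨r, hr, _, ⟨_, hψ, rfl⟩, by simp [sphereHomeomorph]⟩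
    · rintro ⟨r, hr, _, ⟨ψ, hψ, rfl⟩, h⟩
      refine ⟨r, hr, _, ⟨(sphereHomeomorph L).symm ψ, by simpa using hψ, rfl⟩, ?_⟩
      apply L.injective
      rw [← h]
      simp [sphereHomeomorph]
  rw [this]
  exact (L.measurePreserving).measure_preimage_equiv (f := L.toHomeomorph.toMeasurableEquiv) _

instance haarState_isProbabilityMeasure (n m : ℕ) : IsProbabilityMeasure (haarState n m) := by
  refine ⟨?_⟩
  rw [haarState, Measure.smul_apply, smul_eq_mul]
  refine ENNReal.inv_mul_cancel ?_ (measure_ne_top _ _)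
  rw [Measure.toSphere_apply_univ]
  have h1 : Module.finrank ℝ (PureSpace n m) ≠ 0 := by
    have : Nontrivial (PureSpace n m) := inferInstance
    exact (Module.finrank_pos).ne'
  have h2 : (volume : Measure (PureSpace n m)) (Metric.ball 0 1) ≠ 0 :=
    (Metric.measure_ball_pos _ _ one_pos).ne'
  simp [h1, h2]

section
variable {n m : ℕ}

/-- The source of all symmetry arguments below. `F` needs no regularity, since the change of
variables is along a measurable equivalence. -/
theorem integral_haarState_comp {E : Type*} [NormedAddCommGroup E] [NormedSpace ℝ E]
    (L : PureSpace n m ≃ₗᵢ[ℝ] PureSpace n m) (F : PureSpace n m → E) :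
    ∫ ψ, F (L ψ.1) ∂(haarState n m) = ∫ ψ, F ψ.1 ∂(haarState n m) := by
  have h : MeasurePreserving (sphereHomeomorph L).toMeasurableEquiv (haarState n m)
      (haarState n m) := by
    refine ⟨(sphereHomeomorph L).measurable, ?_⟩
    rw [haarState, Measure.map_smul]
    congr 1
    exact (toSphere_measurePreserving L).map_eq
  exact h.integral_comp' fun ψ => F ψ.1

/-- Multiplication of the coordinates by phases. -/
def phaseIsometry (θ : (Fin n → Bool) × (Fin m → Bool) → Circle) :
    PureSpace n m ≃ₗᵢ[ℝ] PureSpace n m :=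
  LinearIsometryEquiv.piLpCongrRight 2 fun j => rotation (θ j)

theorem phaseIsometry_apply (θ : (Fin n → Bool) × (Fin m → Bool) → Circle) (ψ : PureSpace n m) (j) :
    phaseIsometry θ ψ j = θ j * ψ j := by
  simp [phaseIsometry]

/-- Permutation of the coordinates. -/
def permIsometry (σ : Equiv.Perm ((Fin n → Bool) × (Fin m → Bool))) :
    PureSpace n m ≃ₗᵢ[ℝ] PureSpace n m :=
  LinearIsometryEquiv.piLpCongrLeft 2 ℝ ℂ σ.symm

theorem permIsometry_apply (σ : Equiv.Perm ((Fin n → Bool) × (Fin m → Bool))) (ψ : PureSpace n m)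
    (j) : permIsometry σ ψ j = ψ (σ j) := by
  simp [permIsometry]

/-- The reflection that mixes coordinates `j` and `k`. -/
def mixIsometry (j k : (Fin n → Bool) × (Fin m → Bool)) :
    PureSpace n m ≃ₗᵢ[ℝ] PureSpace n m where
  toLinearEquiv := ((Submodule.span ℂ {(EuclideanSpace.single j (1 : ℂ) +
    EuclideanSpace.single k 2 : PureSpace n m)}).reflection.toLinearEquiv).restrictScalars ℝ
  norm_map' ψ := LinearIsometryEquiv.norm_map (Submodule.span ℂ
    {(EuclideanSpace.single j (1 : ℂ) + EuclideanSpace.single k 2 : PureSpace n m)}).reflection ψ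

/-- The reflecting vector e_j + 2e_k has squared norm 5, so the coordinate is 2(ψ_j + 2ψ_k)/5 − ψ_j.
This choice makes the coefficients the rational pair 3/5, 4/5 and avoids square roots. -/
theorem mixIsometry_apply {j k : (Fin n → Bool) × (Fin m → Bool)} (hjk : j ≠ k)
    (ψ : PureSpace n m) : mixIsometry j k ψ j = (4 * ψ k - 3 * ψ j) / 5 := by
  have h : mixIsometry j k ψ = (Submodule.span ℂ {(EuclideanSpace.single j (1 : ℂ) +
    EuclideanSpace.single k 2 : PureSpace n m)}).reflection ψ := rfl
  rw [h, Submodule.reflection_singleton_apply]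
  have h2 : (starRingEnd ℂ) 2 = 2 := Complex.conj_ofNat 2
  have h1 : (RCLike.ofReal ‖(EuclideanSpace.single j (1 : ℂ) + EuclideanSpace.single k 2 :
      PureSpace n m)‖ : ℂ) ^ 2 = 5 := by
    refine (inner_self_eq_norm_sq_to_K (𝕜 := ℂ) _).symm.trans ?_
    rw [inner_add_left, EuclideanSpace.inner_single_left, EuclideanSpace.inner_single_left]
    simp [hjk, hjk.symm, h2]
    norm_num
  rw [h1, inner_add_left, EuclideanSpace.inner_single_left, EuclideanSpace.inner_single_left]
  simp [hjk, h2]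
  ring

theorem integrable_haarState {E : Type*} [NormedAddCommGroup E] {F : PureSpace n m → E}
    (hF : Continuous F) : Integrable (fun ψ => F ψ.1) (haarState n m) := by
  have : Continuous fun ψ : Metric.sphere (0 : PureSpace n m) 1 => F ψ.1 := by fun_prop
  exact this.integrable_of_hasCompactSupport (HasCompactSupport.of_compactSpace _)

/-! ## Moments -/

theorem sum_normSq_sphere (ψ : Metric.sphere (0 : PureSpace n m) 1) :
    ∑ j, ‖ψ.1 j‖ ^ 2 = 1 := by
  have := EuclideanSpace.norm_sq_eq ψ.1
  rw [← this]
  simp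

/-- The dimension of the space of pure states. -/
abbrev pureDim (n m : ℕ) : ℝ := 2 ^ n * 2 ^ m

theorem card_basis : (Fintype.card ((Fin n → Bool) × (Fin m → Bool)) : ℝ) = pureDim n m := by
  simp [pureDim]

theorem integral_normSq (j : (Fin n → Bool) × (Fin m → Bool)) :
    ∫ ψ, ‖ψ.1 j‖ ^ 2 ∂(haarState n m) = 1 / pureDim n m := by
  have h : ∀ k, ∫ ψ, ‖ψ.1 k‖ ^ 2 ∂(haarState n m) = ∫ ψ, ‖ψ.1 j‖ ^ 2 ∂(haarState n m) := by
    intro k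
    rw [← integral_haarState_comp (permIsometry (Equiv.swap k j)) fun ψ => ‖ψ k‖ ^ 2]
    simp only [permIsometry_apply, Equiv.swap_apply_left]
  have h2 : ∑ k, ∫ ψ, ‖ψ.1 k‖ ^ 2 ∂(haarState n m) = 1 := by
    rw [← integral_finsetSum _ fun k _ => integrable_haarState (F := fun ψ => ‖ψ k‖ ^ 2)
      (by fun_prop)]
    simp only [sum_normSq_sphere]
    simp
  simp only [h, Finset.sum_const, nsmul_eq_mul, Finset.card_univ, card_basis] at h2
  have : pureDim n m ≠ 0 := by positivity
  field_simp
  linarith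

/-- Reflection invariance equates the fourth moment of ψ_j with that of (4cψ_k − 3ψ_j)/5 for each
phase c. Averaging over c in {1, −1, i, −i} leaves only fourth moments and the mixed moment, which
gives a linear relation: 1348·I + 2304·J = 2500·I for the two moments I and J. -/
theorem integral_fourth_eq {j k : (Fin n → Bool) × (Fin m → Bool)} (hjk : j ≠ k) :
    ∫ ψ, ‖ψ.1 j‖ ^ 4 ∂(haarState n m) =
      2 * ∫ ψ, ‖ψ.1 j‖ ^ 2 * ‖ψ.1 k‖ ^ 2 ∂(haarState n m) := by
  set I := ∫ ψ, ‖ψ.1 j‖ ^ 4 ∂(haarState n m) with hI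
  have hk : ∫ ψ, ‖ψ.1 k‖ ^ 4 ∂(haarState n m) = I := by
    rw [← integral_haarState_comp (permIsometry (Equiv.swap k j)) fun ψ => ‖ψ k‖ ^ 4]
    simp only [permIsometry_apply, Equiv.swap_apply_left, hI]
  -- The constant is 5⁴, from clearing the denominator of the reflected coordinate.
  have hs : ∀ c : Circle, ∫ ψ, ‖4 * (c * ψ.1 k) - 3 * ψ.1 j‖ ^ 4 ∂(haarState n m) = 625 * I := by
    intro c
    rw [hI, ← integral_haarState_comp (mixIsometry j k) fun ψ => ‖ψ j‖ ^ 4,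
      ← integral_haarState_comp (phaseIsometry (Function.update 1 k c))
      fun ψ => ‖mixIsometry j k ψ j‖ ^ 4, ← integral_const_mul]
    congr 1
    funext ψ
    rw [mixIsometry_apply hjk, phaseIsometry_apply, phaseIsometry_apply, norm_div, div_pow]
    simp [Function.update_of_ne hjk]
    norm_num
    ring
  -- The four phases cancel the terms linear in Re(c b ā) and average its square to ‖a‖²‖b‖²/2.
  have key : ∀ a b : ℂ, ‖4 * (1 * b) - 3 * a‖ ^ 4 + ‖4 * ((-1) * b) - 3 * a‖ ^ 4 +
      ‖4 * (Complex.I * b) - 3 * a‖ ^ 4 + ‖4 * (-Complex.I * b) - 3 * a‖ ^ 4 =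
      1024 * ‖b‖ ^ 4 + 324 * ‖a‖ ^ 4 + 2304 * (‖a‖ ^ 2 * ‖b‖ ^ 2) := by
    intro a b
    have h4 : ∀ z : ℂ, ‖z‖ ^ 4 = (z.re * z.re + z.im * z.im) ^ 2 := fun z => by
      rw [show ‖z‖ ^ 4 = (‖z‖ ^ 2) ^ 2 by ring, ← Complex.normSq_eq_norm_sq, Complex.normSq_apply]
    have h2 : ∀ z : ℂ, ‖z‖ ^ 2 = z.re * z.re + z.im * z.im := fun z => by
      rw [← Complex.normSq_eq_norm_sq, Complex.normSq_apply]
    simp only [h4, h2]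
    simp
    ring
  let G : Circle → Metric.sphere (0 : PureSpace n m) 1 → ℝ := fun c ψ =>
    ‖4 * (c * ψ.1 k) - 3 * ψ.1 j‖ ^ 4
  have hint : ∀ c : Circle, Integrable (G c) (haarState n m) := fun c =>
    integrable_haarState (F := fun ψ => ‖4 * (c * ψ k) - 3 * ψ j‖ ^ 4) (by fun_prop)
  have hsum : ∀ c₁ c₂ c₃ c₄, ∫ ψ, (G c₁ ψ + G c₂ ψ + G c₃ ψ + G c₄ ψ) ∂(haarState n m) =
      2500 * I := by
    intro c₁ c₂ c₃ c₄
    have h12 : Integrable (fun ψ => G c₁ ψ + G c₂ ψ) (haarState n m) := (hint c₁).add (hint c₂)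
    have h123 : Integrable (fun ψ => G c₁ ψ + G c₂ ψ + G c₃ ψ) (haarState n m) :=
      h12.add (hint c₃)
    rw [integral_add h123 (hint c₄), integral_add h12 (hint c₃), integral_add (hint c₁) (hint c₂)]
    have := hs c₁
    have := hs c₂
    have := hs c₃
    have := hs c₄
    linarith
  let i : Circle := ⟨Complex.I, by simp [Submonoid.unitSphere]⟩
  have hsum2 : ∫ ψ, (1024 * ‖ψ.1 k‖ ^ 4 + 324 * ‖ψ.1 j‖ ^ 4 +
      2304 * (‖ψ.1 j‖ ^ 2 * ‖ψ.1 k‖ ^ 2)) ∂(haarState n m) = 2500 * I := by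
    rw [← hsum 1 (-1) i (-i)]
    simp only [← key]
    have e1 : ((1 : Circle) : ℂ) = 1 := rfl
    have e2 : ((-1 : Circle) : ℂ) = -1 := rfl
    have e3 : ((i : Circle) : ℂ) = Complex.I := rfl
    have e4 : ((-i : Circle) : ℂ) = -Complex.I := rfl
    simp only [G, e1, e2, e3, e4]
  rw [integral_add, integral_add, integral_const_mul, integral_const_mul, integral_const_mul, hk,
    ← hI] at hsum2
  · linarith
  · exact integrable_haarState (F := fun ψ => 1024 * ‖ψ k‖ ^ 4) (by fun_prop)
  · exact integrable_haarState (F := fun ψ => 324 * ‖ψ j‖ ^ 4) (by fun_prop)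
  · exact integrable_haarState (F := fun ψ => 1024 * ‖ψ k‖ ^ 4 + 324 * ‖ψ j‖ ^ 4) (by fun_prop)
  · exact integrable_haarState (F := fun ψ => 2304 * (‖ψ j‖ ^ 2 * ‖ψ k‖ ^ 2)) (by fun_prop)

/-- Multiplying the normalisation ∑_k |ψ_k|² = 1 by |ψ_j|² and integrating gives D·I/2 + I/2 = 1/D,
where I is the fourth moment: each k contributes I/2, and k = j contributes I/2 more. This also
covers D = 1, where no second coordinate exists. -/
theorem integral_fourth (j : (Fin n → Bool) × (Fin m → Bool)) :
    ∫ ψ, ‖ψ.1 j‖ ^ 4 ∂(haarState n m) = 2 / (pureDim n m * (pureDim n m + 1)) := by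
  set I := ∫ ψ, ‖ψ.1 j‖ ^ 4 ∂(haarState n m) with hI
  have h : ∑ k, ∫ ψ, ‖ψ.1 j‖ ^ 2 * ‖ψ.1 k‖ ^ 2 ∂(haarState n m) = 1 / pureDim n m := by
    rw [← integral_finsetSum _ fun k _ => integrable_haarState
      (F := fun ψ => ‖ψ j‖ ^ 2 * ‖ψ k‖ ^ 2) (by fun_prop)]
    simp only [← Finset.mul_sum, sum_normSq_sphere, mul_one, integral_normSq]
  have h2 : ∀ k, ∫ ψ, ‖ψ.1 j‖ ^ 2 * ‖ψ.1 k‖ ^ 2 ∂(haarState n m) =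
      I / 2 + if k = j then I / 2 else 0 := by
    intro k
    split_ifs with hk
    · subst hk
      rw [add_halves, hI]
      congr 1; funext ψ; ring
    · rw [hI, integral_fourth_eq (Ne.symm hk)]; ring
  simp only [h2, Finset.sum_add_distrib, Finset.sum_const, Finset.sum_ite_eq', Finset.mem_univ,
    if_true, nsmul_eq_mul, Finset.card_univ, card_basis] at h
  have : 0 < pureDim n m := by positivity
  field_simp at h ⊢
  linarith

theorem integral_normSq_mul {j k : (Fin n → Bool) × (Fin m → Bool)} (hjk : j ≠ k) :
    ∫ ψ, ‖ψ.1 j‖ ^ 2 * ‖ψ.1 k‖ ^ 2 ∂(haarState n m) =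
      1 / (pureDim n m * (pureDim n m + 1)) := by
  have h1 := integral_fourth_eq hjk
  have h2 := integral_fourth j
  rw [h2] at h1
  have h3 : 1 / (pureDim n m * (pureDim n m + 1)) = 2 / (pureDim n m * (pureDim n m + 1)) / 2 := by
    ring
  rw [h3, h1]
  ring

theorem integral_normSq_mul_le (j k : (Fin n → Bool) × (Fin m → Bool)) :
    ∫ ψ, ‖ψ.1 j‖ ^ 2 * ‖ψ.1 k‖ ^ 2 ∂(haarState n m) ≤ 2 / pureDim n m ^ 2 := by
  have hD : 0 < pureDim n m := by positivity
  have h : ∀ x : ℝ, 0 ≤ x → x ≤ 2 →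
      x / (pureDim n m * (pureDim n m + 1)) ≤ 2 / pureDim n m ^ 2 := fun x h0 hx => by
    apply div_le_div₀ (by norm_num) hx (by positivity)
    nlinarith
  by_cases hjk : j = k
  · subst hjk
    have : ∀ ψ : Metric.sphere (0 : PureSpace n m) 1,
      ‖ψ.1 j‖ ^ 2 * ‖ψ.1 j‖ ^ 2 = ‖ψ.1 j‖ ^ 4 := fun ψ => by ring
    simp only [this, integral_fourth]
    exact h 2 (by norm_num) le_rfl
  · rw [integral_normSq_mul hjk]
    exact h 1 (by norm_num) (by norm_num)

end

/-! ## The generalized Hilbert–Schmidt ensemble is close to the maximally mixed state -/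

section
variable {n m t : ℕ}

/-- The register number `j` of a basis state of `t` registers of `n` qubits. -/
def regState (x : Fin (t * n) → Bool) (j : Fin t) : Fin n → Bool :=
  fun i => x (finProdFinEquiv (j, i))

theorem regState_injective : (regState : (Fin (t * n) → Bool) → _).Injective :=
  (splitState finProdFinEquiv).injective

/-- `⨂ⱼ ψ_{z j}` for the components `ψ_w ∈ ℂ^{2^n}` of a pure state. -/
def tupleVec (ψ : PureSpace n m) (z : Fin t → Fin m → Bool) (x : Fin (t * n) → Bool) : ℂ :=
  ∏ j, ψ (regState x j, z j)

theorem tupleVec_continuous (z : Fin t → Fin m → Bool) (x : Fin (t * n) → Bool) :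
    Continuous fun ψ : PureSpace n m => tupleVec ψ z x := by
  unfold tupleVec
  fun_prop

theorem copies_reducedState (ψ : PureSpace n m) :
    copies n t (reducedState n m ψ) =
      ∑ z, Matrix.vecMulVec (tupleVec ψ z) (star (tupleVec ψ z)) := by
  ext x y
  simp only [copies, reducedState, Matrix.of_apply, Matrix.sum_apply, Matrix.vecMulVec_apply,
    tupleVec, Pi.star_apply, star_prod, ← Finset.prod_mul_distrib]
  rw [Finset.prod_univ_sum, Fintype.piFinset_univ]
  rfl

/-- Flip the sign of the coordinate (x_j, z_j) at a register j where x and y differ. As z has no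
repetition, this coordinate occurs exactly once in the product for x and never in that for y, so the
integral equals its negative. -/
theorem integral_tupleVec_of_ne {z : Fin t → Fin m → Bool} (hz : z.Injective)
    {x y : Fin (t * n) → Bool} (hxy : x ≠ y) :
    ∫ ψ, tupleVec ψ.1 z x * star (tupleVec ψ.1 z y) ∂(haarState n m) = 0 := by
  obtain ⟨j, hj⟩ : ∃ j, regState x j ≠ regState y j :=
    Function.ne_iff.1 (regState_injective.ne hxy)
  have h := integral_haarState_comp (phaseIsometry (Function.update 1 (regState x j, z j) (-1)))
    fun ψ : PureSpace n m => tupleVec ψ z x * star (tupleVec ψ z y)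
  have h1 : ∀ ψ : PureSpace n m,
      tupleVec (phaseIsometry (Function.update 1 (regState x j, z j) (-1)) ψ) z x =
        - tupleVec ψ z x := by
    intro ψ
    simp only [tupleVec, phaseIsometry_apply]
    rw [Finset.prod_mul_distrib, Finset.prod_eq_single j]
    · simp
    · intro l _ hl
      rw [Function.update_of_ne]
      · simp
      · exact fun e => hl (hz (Prod.ext_iff.1 e).2)
    · simp
  have h2 : ∀ ψ : PureSpace n m,
      tupleVec (phaseIsometry (Function.update 1 (regState x j, z j) (-1)) ψ) z y =
        tupleVec ψ z y := by
    intro ψ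
    simp only [tupleVec, phaseIsometry_apply]
    rw [Finset.prod_mul_distrib, Finset.prod_eq_one, one_mul]
    intro l _
    rw [Function.update_of_ne]
    · simp
    · intro e
      obtain rfl := hz (Prod.ext_iff.1 e).2
      exact hj (Prod.ext_iff.1 e).1.symm
  simp only [h1, h2, neg_mul, integral_neg] at h
  exact self_eq_neg.1 h.symm

/-- Distinct entries of z address distinct components of ψ, so x_j and y_j can be exchanged in
component z_j independently for every j by one permutation of coordinates. -/
theorem integral_normSq_tupleVec_eq {z : Fin t → Fin m → Bool} (hz : z.Injective)
    (x y : Fin (t * n) → Bool) :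
    ∫ ψ, ‖tupleVec ψ.1 z x‖ ^ 2 ∂(haarState n m) =
      ∫ ψ, ‖tupleVec ψ.1 z y‖ ^ 2 ∂(haarState n m) := by
  rw [← integral_haarState_comp (permIsometry (Equiv.prodCongrLeft
    (Function.extend z (fun j => Equiv.swap (regState x j) (regState y j)) 1)))
    fun ψ => ‖tupleVec ψ z x‖ ^ 2]
  congr 1
  funext ψ
  simp only [tupleVec, permIsometry_apply, Equiv.prodCongrLeft_apply, hz.extend_apply,
    Equiv.swap_apply_left]

/-! ### Component weights and the collision bound -/

/-- The weight of the component `w` of a pure state. -/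
def compWeight (ψ : PureSpace n m) (w : Fin m → Bool) : ℝ := ∑ x, ‖ψ (x, w)‖ ^ 2

theorem compWeight_nonneg (ψ : PureSpace n m) (w : Fin m → Bool) : 0 ≤ compWeight ψ w :=
  Finset.sum_nonneg fun _ _ => by positivity

theorem compWeight_continuous (w : Fin m → Bool) :
    Continuous fun ψ : PureSpace n m => compWeight ψ w := by
  unfold compWeight
  fun_prop

theorem sum_compWeight (ψ : Metric.sphere (0 : PureSpace n m) 1) :
    ∑ w, compWeight ψ.1 w = 1 := by
  have h := sum_normSq_sphere ψ
  rw [Fintype.sum_prod_type_right] at h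
  exact h

theorem sum_normSq_tupleVec (ψ : PureSpace n m) (z : Fin t → Fin m → Bool) :
    ∑ x, ‖tupleVec ψ z x‖ ^ 2 = ∏ j, compWeight ψ (z j) := by
  simp only [tupleVec, norm_prod, ← Finset.prod_pow, compWeight]
  exact sum_prod_split finProdFinEquiv fun j x => ‖ψ (x, z j)‖ ^ 2

theorem integral_normSq_tupleVec {z : Fin t → Fin m → Bool} (hz : z.Injective)
    (x : Fin (t * n) → Bool) :
    ∫ ψ, ‖tupleVec ψ.1 z x‖ ^ 2 ∂(haarState n m) =
      (∫ ψ, ∏ j, compWeight ψ.1 (z j) ∂(haarState n m)) / 2 ^ (t * n) := by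
  have h : ∑ y, ∫ ψ, ‖tupleVec ψ.1 z y‖ ^ 2 ∂(haarState n m) =
      ∫ ψ, ∏ j, compWeight ψ.1 (z j) ∂(haarState n m) := by
    rw [← integral_finsetSum _ fun y _ => integrable_haarState
      (F := fun ψ => ‖tupleVec ψ z y‖ ^ 2) ((tupleVec_continuous z y).norm.pow 2)]
    simp only [sum_normSq_tupleVec]
  rw [← h, Finset.sum_congr rfl fun y _ => integral_normSq_tupleVec_eq hz y x]
  simp

/-- The square has 4^n terms, each of mean at most 2/(2^n 2^m)². -/
theorem integral_compWeight_sq (w : Fin m → Bool) :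
    ∫ ψ, compWeight ψ.1 w ^ 2 ∂(haarState n m) ≤ 2 / (2 ^ m) ^ 2 := by
  have h : ∀ ψ : PureSpace n m,
      compWeight ψ w ^ 2 = ∑ x, ∑ y, ‖ψ (x, w)‖ ^ 2 * ‖ψ (y, w)‖ ^ 2 := fun ψ => by
    rw [sq, compWeight, Finset.sum_mul_sum]
  simp only [h]
  rw [integral_finsetSum _ fun x _ => integrable_haarState
    (F := fun ψ => ∑ y, ‖ψ (x, w)‖ ^ 2 * ‖ψ (y, w)‖ ^ 2) (by fun_prop)]
  have h2 : ∀ x, ∫ ψ, ∑ y, ‖ψ.1 (x, w)‖ ^ 2 * ‖ψ.1 (y, w)‖ ^ 2 ∂(haarState n m) ≤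
      ∑ _y : Fin n → Bool, 2 / pureDim n m ^ 2 := fun x => by
    rw [integral_finsetSum _ fun y _ => integrable_haarState
      (F := fun ψ => ‖ψ (x, w)‖ ^ 2 * ‖ψ (y, w)‖ ^ 2) (by fun_prop)]
    exact Finset.sum_le_sum fun y _ => integral_normSq_mul_le _ _
  refine (Finset.sum_le_sum fun x _ => h2 x).trans (le_of_eq ?_)
  simp [pureDim]
  field_simp

open Classical in
/-- The tuples without repetition. -/
def distinctTuples (t : ℕ) (W : Type) [Fintype W] : Finset (Fin t → W) :=
  Finset.univ.filter Function.Injective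

theorem mem_distinctTuples {W : Type} [Fintype W] {z : Fin t → W} :
    z ∈ distinctTuples t W ↔ z.Injective := by
  simp [distinctTuples]

/-- Collision bound: `t` independent samples from the weights are rarely not distinct. -/
theorem sum_injective_ge {W : Type} [Fintype W] [DecidableEq W] (p : W → ℝ) (hp : ∀ w, 0 ≤ p w)
    (h1 : ∑ w, p w = 1) :
    1 - (t : ℝ) ^ 2 * ∑ w, p w ^ 2 ≤
      ∑ z ∈ distinctTuples t W, ∏ j, p (z j) := by
  classical
  have hall : ∑ z : Fin t → W, ∏ j, p (z j) = 1 := by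
    have := Finset.prod_univ_sum (fun _ : Fin t => (Finset.univ : Finset W)) fun _ w => p w
    rw [Fintype.piFinset_univ] at this
    rw [← this]
    simp [h1]
  -- For independent samples from p, the probability that samples i and j coincide is ∑ p².
  have hpair : ∀ i j : Fin t, i ≠ j →
      ∑ z : Fin t → W, (if z i = z j then ∏ l, p (z l) else 0) = ∑ w, p w ^ 2 := by
    intro i j hij
    -- The event z_i = z_j is summed over the common value w; for fixed w the constraint is imposed
    -- factor by factor, so the sum over z factorises.
    have e : ∀ z : Fin t → W, (if z i = z j then ∏ l, p (z l) else 0) =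
        ∑ w, ∏ l, if (l = i ∨ l = j) ∧ z l ≠ w then 0 else p (z l) := by
      intro z
      have e2 : ∀ w, (∏ l, if (l = i ∨ l = j) ∧ z l ≠ w then 0 else p (z l)) =
          if w = z i then (if z i = z j then ∏ l, p (z l) else 0) else 0 := by
        intro w
        by_cases hi : w = z i
        · subst hi
          by_cases hj : z i = z j
          · rw [if_pos rfl, if_pos hj]
            refine Finset.prod_congr rfl fun l _ => if_neg ?_
            rintro ⟨rfl | rfl, h⟩
            · exact h rfl
            · exact h hj.symm
          · rw [if_pos rfl, if_neg hj]
            exact Finset.prod_eq_zero (Finset.mem_univ j) (if_pos ⟨Or.inr rfl, fun h => hj h.symm⟩)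
        · rw [if_neg hi]
          exact Finset.prod_eq_zero (Finset.mem_univ i) (if_pos ⟨Or.inl rfl, fun h => hi h.symm⟩)
      simp only [e2, Finset.sum_ite_eq', Finset.mem_univ, if_true]
    simp only [e]
    rw [Finset.sum_comm]
    refine Finset.sum_congr rfl fun w _ => ?_
    have := Finset.prod_univ_sum (fun _ : Fin t => (Finset.univ : Finset W))
      fun l v => if (l = i ∨ l = j) ∧ v ≠ w then 0 else p v
    rw [Fintype.piFinset_univ] at this
    rw [← this]
    have e3 : ∀ l : Fin t, (∑ v, if (l = i ∨ l = j) ∧ v ≠ w then 0 else p v) =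
        (if l = i then p w else 1) * (if l = j then p w else 1) := by
      intro l
      by_cases hl : l = i ∨ l = j
      · have : (∑ v, if (l = i ∨ l = j) ∧ v ≠ w then 0 else p v) = p w := by
          rw [Finset.sum_eq_single w]
          · simp
          · intro v _ hv; simp [hl, hv]
          · simp
        rw [this]
        rcases hl with rfl | rfl
        · simp [hij]
        · simp [hij.symm]
      · rw [not_or] at hl
        simp [hl.1, hl.2, h1]
    simp only [e3, Finset.prod_mul_distrib, Finset.prod_ite_eq', Finset.mem_univ, if_true, sq]
  -- Union bound: a non-injective tuple is counted by at least one ordered pair of colliding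
  -- positions.
  have hpt : ∀ z : Fin t → W, ∏ j, p (z j) ≤ (if z.Injective then ∏ j, p (z j) else 0) +
      ∑ i, ∑ j, if i ≠ j then (if z i = z j then ∏ l, p (z l) else 0) else 0 := by
    intro z
    have h0 : 0 ≤ ∏ j, p (z j) := Finset.prod_nonneg fun _ _ => hp _
    have hnn : ∀ i j : Fin t,
        0 ≤ (if i ≠ j then (if z i = z j then ∏ l, p (z l) else 0) else 0) := by
      intro i j; split_ifs <;> simp [h0]
    by_cases hz : z.Injective
    · rw [if_pos hz]
      exact le_add_of_nonneg_right (Finset.sum_nonneg fun i _ => Finset.sum_nonneg fun j _ => hnn i j)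
    · rw [if_neg hz, zero_add]
      simp only [Function.Injective, not_forall] at hz
      obtain ⟨i, j, hz, hij⟩ := hz
      calc ∏ j, p (z j) = if i ≠ j then (if z i = z j then ∏ l, p (z l) else 0) else 0 := by
            rw [if_pos hij, if_pos hz]
        _ ≤ ∑ j, if i ≠ j then (if z i = z j then ∏ l, p (z l) else 0) else 0 :=
            Finset.single_le_sum (f := fun j => if i ≠ j then
              (if z i = z j then ∏ l, p (z l) else 0) else 0) (fun j _ => hnn i j)
              (Finset.mem_univ j)
        _ ≤ _ := Finset.single_le_sum (f := fun i => ∑ j, if i ≠ j then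
              (if z i = z j then ∏ l, p (z l) else 0) else 0)
              (fun i _ => Finset.sum_nonneg fun j _ => hnn i j) (Finset.mem_univ i)
  have hsum := Finset.sum_le_sum fun z (_ : z ∈ Finset.univ) => hpt z
  rw [hall, Finset.sum_add_distrib, ← Finset.sum_filter, Finset.sum_comm] at hsum
  have hdist : ∑ z : Fin t → W with z.Injective, ∏ j, p (z j) = ∑ z ∈ distinctTuples t W, ∏ j, p (z j) :=
    Finset.sum_congr (by ext z; simp [distinctTuples]) fun _ _ => rfl
  rw [hdist] at hsum
  have hS : 0 ≤ ∑ w, p w ^ 2 := Finset.sum_nonneg fun _ _ => by positivity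
  have hb : ∑ i : Fin t, ∑ z : Fin t → W, ∑ j,
      (if i ≠ j then (if z i = z j then ∏ l, p (z l) else 0) else 0) ≤
      (t : ℝ) ^ 2 * ∑ w, p w ^ 2 := by
    have : ∀ i : Fin t, ∑ z : Fin t → W, ∑ j,
        (if i ≠ j then (if z i = z j then ∏ l, p (z l) else 0) else 0) ≤
        t * ∑ w, p w ^ 2 := by
      intro i
      rw [Finset.sum_comm]
      calc _ ≤ ∑ _j : Fin t, ∑ w, p w ^ 2 := Finset.sum_le_sum fun j _ => by
            by_cases hij : i = j
            · simpa [hij] using hS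
            · simp only [ne_eq, hij, not_false_eq_true, if_true]
              exact (hpair i j hij).le
        _ = _ := by simp
    calc _ ≤ ∑ _i : Fin t, t * ∑ w, p w ^ 2 := Finset.sum_le_sum fun i _ => this i
      _ = _ := by simp; ring
  linarith

/-- The component weights of a unit vector form a probability distribution, so the collision bound
holds for every ψ; integrating it gives an error of at most t²·2^m·2/(2^m)². -/
theorem integral_sum_injective_ge :
    1 - 2 * (t : ℝ) ^ 2 / 2 ^ m ≤
      ∑ z ∈ distinctTuples t (Fin m → Bool),
        ∫ ψ, ∏ j, compWeight ψ.1 (z j) ∂(haarState n m) := by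
  have hswap := integral_finsetSum (μ := haarState n m) (distinctTuples t (Fin m → Bool))
    (f := fun z ψ => ∏ j, compWeight ψ.1 (z j)) fun z _ => integrable_haarState
    (F := fun ψ => ∏ j, compWeight ψ (z j))
    (continuous_finsetProd _ fun j _ => compWeight_continuous (z j))
  rw [← hswap]
  have hi : Integrable (fun ψ : Metric.sphere (0 : PureSpace n m) 1 =>
      (t : ℝ) ^ 2 * ∑ w, compWeight ψ.1 w ^ 2) (haarState n m) :=
    integrable_haarState (F := fun ψ => (t : ℝ) ^ 2 * ∑ w, compWeight ψ w ^ 2)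
      (continuous_const.mul (continuous_finsetSum _ fun w _ => (compWeight_continuous w).pow 2))
  calc 1 - 2 * (t : ℝ) ^ 2 / 2 ^ m ≤
      1 - (t : ℝ) ^ 2 * ∑ w : Fin m → Bool, ∫ ψ, compWeight ψ.1 w ^ 2 ∂(haarState n m) := by
        have : ∑ w : Fin m → Bool, ∫ ψ, compWeight ψ.1 w ^ 2 ∂(haarState n m) ≤
            ∑ _w : Fin m → Bool, 2 / (2 ^ m) ^ 2 :=
          Finset.sum_le_sum fun w _ => integral_compWeight_sq w
        have h2 : ∑ _w : Fin m → Bool, 2 / ((2 : ℝ) ^ m) ^ 2 = 2 / 2 ^ m := by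
          simp; field_simp
        rw [h2] at this
        have := mul_le_mul_of_nonneg_left this (sq_nonneg (t : ℝ))
        rw [mul_div_assoc', mul_comm _ (2 : ℝ)] at this
        linarith
    _ = ∫ ψ, (1 - (t : ℝ) ^ 2 * ∑ w, compWeight ψ.1 w ^ 2) ∂(haarState n m) := by
        rw [integral_sub (integrable_const _) hi, integral_const_mul, integral_finsetSum _
          fun w _ => integrable_haarState (F := fun ψ => compWeight ψ w ^ 2)
            ((compWeight_continuous w).pow 2)]
        simp
    _ ≤ _ := by
        have hR : Integrable (fun ψ : Metric.sphere (0 : PureSpace n m) 1 =>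
            ∑ z ∈ distinctTuples t (Fin m → Bool), ∏ j, compWeight ψ.1 (z j))
            (haarState n m) := integrable_haarState (F := fun ψ =>
              ∑ z ∈ distinctTuples t (Fin m → Bool), ∏ j, compWeight ψ (z j))
          (continuous_finsetSum _ fun z _ =>
            continuous_finsetProd _ fun j _ => compWeight_continuous (z j))
        have hpt : ∀ ψ : Metric.sphere (0 : PureSpace n m) 1,
            1 - (t : ℝ) ^ 2 * ∑ w, compWeight ψ.1 w ^ 2 ≤
              ∑ z ∈ distinctTuples t (Fin m → Bool), ∏ j, compWeight ψ.1 (z j) := fun ψ =>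
          sum_injective_ge (compWeight ψ.1) (compWeight_nonneg ψ.1) (sum_compWeight ψ)
        have hL : Integrable (fun ψ : Metric.sphere (0 : PureSpace n m) 1 =>
            1 - (t : ℝ) ^ 2 * ∑ w, compWeight ψ.1 w ^ 2) (haarState n m) :=
          (integrable_const _).sub hi
        exact integral_mono hL hR hpt

/-! ### Averages of effects on copies of the ensemble -/

theorem trace_mul_rankOne (E : QOp (t * n)) (v : (Fin (t * n) → Bool) → ℂ) :
    (E * Matrix.vecMulVec v (star v)).trace = star v ⬝ᵥ E.mulVec v := by
  rw [Matrix.mul_vecMulVec, Matrix.trace_vecMulVec, dotProduct_comm]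

/-- By the symmetries, the mean of the rank-one term of a repetition-free tuple is scalar, with
trace equal to the mean product of its component weights. -/
theorem integral_trace_rankOne (E : QOp (t * n)) {z : Fin t → Fin m → Bool} (hz : z.Injective) :
    ∫ ψ, (E * Matrix.vecMulVec (tupleVec ψ.1 z) (star (tupleVec ψ.1 z))).trace.re
      ∂(haarState n m) =
      E.trace.re * ((∫ ψ, ∏ j, compWeight ψ.1 (z j) ∂(haarState n m)) / 2 ^ (t * n)) := by
  have h1 : ∀ ψ : PureSpace n m,
      (E * Matrix.vecMulVec (tupleVec ψ z) (star (tupleVec ψ z))).trace =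
      ∑ y, ∑ x, E y x * (tupleVec ψ z x * star (tupleVec ψ z y)) := by
    intro ψ
    simp [Matrix.trace, Matrix.mul_apply, Matrix.vecMulVec_apply]
  have hc : ∀ x y, Continuous fun ψ : PureSpace n m => tupleVec ψ z x * star (tupleVec ψ z y) :=
    fun x y => (tupleVec_continuous z x).mul (tupleVec_continuous z y).star
  have h2 : ∀ x, ∫ ψ, tupleVec ψ.1 z x * star (tupleVec ψ.1 z x) ∂(haarState n m) =
      (((∫ ψ, ∏ j, compWeight ψ.1 (z j) ∂(haarState n m)) / 2 ^ (t * n) : ℝ) : ℂ) := by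
    intro x
    rw [← integral_normSq_tupleVec hz x, ← integral_complex_ofReal]
    congr 1
    funext ψ
    simp [Complex.mul_conj, Complex.normSq_eq_norm_sq]
  have hre := integral_re (𝕜 := ℂ) (integrable_haarState (n := n) (m := m) (F := fun ψ =>
    ∑ y, ∑ x, E y x * (tupleVec ψ z x * star (tupleVec ψ z y)))
    (continuous_finsetSum _ fun y _ => continuous_finsetSum _ fun x _ =>
      continuous_const.mul (hc x y)))
  simp only [h1]
  refine hre.trans ?_
  rw [integral_finsetSum _ fun y _ => integrable_haarState (F := fun ψ =>
    ∑ x, E y x * (tupleVec ψ z x * star (tupleVec ψ z y)))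
    (continuous_finsetSum _ fun x _ => continuous_const.mul (hc x y))]
  have h3 : ∀ y, ∫ ψ, ∑ x, E y x * (tupleVec ψ.1 z x * star (tupleVec ψ.1 z y))
      ∂(haarState n m) =
      E y y * (((∫ ψ, ∏ j, compWeight ψ.1 (z j) ∂(haarState n m)) / 2 ^ (t * n) : ℝ) : ℂ) := by
    intro y
    rw [integral_finsetSum _ fun x _ => integrable_haarState (F := fun ψ =>
      E y x * (tupleVec ψ z x * star (tupleVec ψ z y))) (continuous_const.mul (hc x y)),
      Finset.sum_eq_single y]
    · rw [integral_const_mul, h2]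
    · intro x _ hx
      rw [integral_const_mul, integral_tupleVec_of_ne hz hx, mul_zero]
    · simp
  simp only [h3, ← Finset.sum_mul]
  exact Complex.re_mul_ofReal _ _

-- Positivity of E allows all tuples with repetitions to be discarded. The rest is a multiple of the
-- maximally mixed value with factor at least 1 − 2t²/2^m.
open scoped ComplexOrder in
theorem integral_trace_copies_ge {E : QOp (t * n)} (hE : E.PosSemidef) :
    (1 - 2 * (t : ℝ) ^ 2 / 2 ^ m) * (E.trace.re / 2 ^ (t * n)) ≤
      ∫ ψ, (E * copies n t (reducedState n m ψ.1)).trace.re ∂(haarState n m) := by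
  classical
  have hnn : ∀ v, 0 ≤ (E * Matrix.vecMulVec v (star v)).trace.re := fun v => by
    rw [trace_mul_rankOne]
    exact (Complex.le_def.1 (hE.dotProduct_mulVec_nonneg v)).1
  have htr : 0 ≤ E.trace.re := (Complex.le_def.1 hE.trace_nonneg).1
  have hc : ∀ z : Fin t → Fin m → Bool, Continuous fun ψ : PureSpace n m =>
      (E * Matrix.vecMulVec (tupleVec ψ z) (star (tupleVec ψ z))).trace.re := by
    intro z
    refine Complex.continuous_re.comp (Continuous.matrix_trace (continuous_const.mul ?_))
    exact Continuous.matrix_vecMulVec (continuous_pi fun x => tupleVec_continuous z x)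
      (continuous_pi fun x => (tupleVec_continuous z x).star)
  simp only [copies_reducedState, Finset.mul_sum, Matrix.trace_sum, Complex.re_sum]
  rw [integral_finsetSum _ fun z _ => integrable_haarState (hc z)]
  calc _ ≤ (∑ z ∈ distinctTuples t (Fin m → Bool),
        ∫ ψ, ∏ j, compWeight ψ.1 (z j) ∂(haarState n m)) * (E.trace.re / 2 ^ (t * n)) :=
        mul_le_mul_of_nonneg_right integral_sum_injective_ge (by positivity)
    _ = ∑ z ∈ distinctTuples t (Fin m → Bool),
        ∫ ψ, (E * Matrix.vecMulVec (tupleVec ψ.1 z) (star (tupleVec ψ.1 z))).trace.re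
          ∂(haarState n m) := by
        rw [Finset.sum_mul]
        refine Finset.sum_congr rfl fun z hz => ?_
        rw [integral_trace_rankOne E (mem_distinctTuples.1 hz)]
        ring
    _ ≤ _ := Finset.sum_le_sum_of_subset_of_nonneg (Finset.subset_univ _)
        fun z _ _ => integral_nonneg fun ψ => hnn _

/-! ### Closeness to the maximally mixed state for acceptance probabilities -/

theorem reducedState_trace (ψ : Metric.sphere (0 : PureSpace n m) 1) :
    (reducedState n m ψ.1).trace = 1 := by
  have h := sum_normSq_sphere ψ
  rw [Fintype.sum_prod_type] at h
  simp only [Matrix.trace, Matrix.diag, reducedState, Matrix.of_apply, RCLike.star_def,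
    Complex.mul_conj, Complex.normSq_eq_norm_sq]
  exact_mod_cast h

theorem copies_trace (σ : QOp n) : (copies n t σ).trace = σ.trace ^ t := by
  have := sum_prod_split (finProdFinEquiv : Fin t × Fin n ≃ _) fun _ x => σ x x
  simp only [Matrix.trace, Matrix.diag, copies, Matrix.of_apply]
  rw [this]
  simp

theorem copies_smul_one (c : ℂ) : copies n t (c • 1) = c ^ t • 1 := by
  rw [← tensorOp_one (finProdFinEquiv : Fin t × Fin n ≃ _)]
  ext x y
  simp only [copies, tensorOp, Matrix.of_apply, Matrix.smul_apply, smul_eq_mul,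
    Finset.prod_mul_distrib]
  simp

theorem reducedState_continuous : Continuous fun ψ : PureSpace n m => reducedState n m ψ := by
  refine continuous_matrix fun x y => ?_
  simp only [reducedState, Matrix.of_apply]
  fun_prop

theorem copies_continuous : Continuous (copies n t) := by
  refine continuous_matrix fun x y => ?_
  simp only [copies, Matrix.of_apply]
  exact continuous_finsetProd _ fun j _ => (continuous_apply_apply _ _)

theorem integral_ghse {f : QOp n → ℝ} (hf : Continuous f) :
    ∫ σ, f σ ∂(ghse n m) = ∫ ψ, f (reducedState n m ψ.1) ∂(haarState n m) := by
  have hc : Continuous fun ψ : Metric.sphere (0 : PureSpace n m) 1 => reducedState n m ψ.1 :=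
    reducedState_continuous.comp continuous_subtype_val
  exact integral_map hc.measurable.aemeasurable hf.measurable.aestronglyMeasurable

variable {ι : Type} (𝒢 : ι → Matrix.unitaryGroup Bool ℂ)

theorem acceptProb_copies_continuous (a : ℕ) (C : List (Gate ι ℕ)) :
    Continuous fun σ : QOp n => acceptProb 𝒢 (t * n) a C (copies n t σ) := by
  simp only [acceptProb_eq_trace]
  exact Complex.continuous_re.comp
    (Continuous.matrix_trace (continuous_const.mul copies_continuous))

/-- The maximally mixed state. -/
def maxMixed (n : ℕ) : QOp n := ((2 : ℂ) ^ n)⁻¹ • 1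

/-- The multiplicative lower bound is applied to the accepting effect and to its complement. Both
pairs of probabilities sum to 1, so the lower bound for the complement is an upper bound for
acceptance, and the multiplicative error is at most the additive one. -/
theorem abs_integral_acceptProb_sub_le (a : ℕ) (C : List (Gate ι ℕ)) :
    |∫ σ, acceptProb 𝒢 (t * n) a C (copies n t σ) ∂(ghse n m) -
      acceptProb 𝒢 (t * n) a C (copies n t (maxMixed n))| ≤ 2 * (t : ℝ) ^ 2 / 2 ^ m := by
  rw [integral_ghse (acceptProb_copies_continuous 𝒢 a C)]
  simp only [acceptProb_eq_trace]
  set E := effect 𝒢 (t * n) a C outputBit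
  set E' := effect 𝒢 (t * n) a C fun x z => ¬ outputBit x z
  have hsum : E + E' = 1 := effect_add_compl 𝒢 (t * n) a C outputBit
  have hE := effect_posSemidef 𝒢 (t * n) a C outputBit
  have hE' := effect_posSemidef 𝒢 (t * n) a C fun x z => ¬ outputBit x z
  have h1 := integral_trace_copies_ge (m := m) hE
  have h2 := integral_trace_copies_ge (m := m) hE'
  have hc : ∀ F : QOp (t * n), Integrable (fun ψ : Metric.sphere (0 : PureSpace n m) 1 =>
      (F * copies n t (reducedState n m ψ.1)).trace.re) (haarState n m) := fun F =>
    integrable_haarState (F := fun ψ => (F * copies n t (reducedState n m ψ)).trace.re)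
      (Complex.continuous_re.comp (Continuous.matrix_trace
        (continuous_const.mul (copies_continuous.comp reducedState_continuous))))
  have h3 : ∫ ψ, (E * copies n t (reducedState n m ψ.1)).trace.re ∂(haarState n m) +
      ∫ ψ, (E' * copies n t (reducedState n m ψ.1)).trace.re ∂(haarState n m) = 1 := by
    rw [← integral_add (hc E) (hc E')]
    have : ∀ ψ : Metric.sphere (0 : PureSpace n m) 1,
        (E * copies n t (reducedState n m ψ.1)).trace.re +
          (E' * copies n t (reducedState n m ψ.1)).trace.re = 1 := fun ψ => by
      rw [← Complex.add_re, ← Matrix.trace_add, ← Matrix.add_mul, hsum, one_mul, copies_trace,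
        reducedState_trace, one_pow, Complex.one_re]
    simp [this]
  have h4 : E.trace.re / 2 ^ (t * n) + E'.trace.re / 2 ^ (t * n) = 1 := by
    have : (Fintype.card (Fin (t * n) → Bool) : ℂ) = ((2 ^ (t * n) : ℝ) : ℂ) := by simp
    rw [← add_div, ← Complex.add_re, ← Matrix.trace_add, hsum, Matrix.trace_one, this,
      Complex.ofReal_re, div_self (by positivity)]
  have h5 : (E * copies n t (maxMixed n)).trace.re = E.trace.re / 2 ^ (t * n) := by
    rw [maxMixed, copies_smul_one, Matrix.mul_smul, mul_one, Matrix.trace_smul, inv_pow, ← pow_mul,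
      mul_comm n t, smul_eq_mul]
    have : ((2 : ℂ) ^ (t * n))⁻¹ = (((2 : ℝ) ^ (t * n))⁻¹ : ℝ) := by push_cast; rfl
    rw [this, Complex.re_ofReal_mul]
    ring
  have e1 : 0 ≤ E.trace.re / 2 ^ (t * n) := by
    open scoped ComplexOrder in
    have := (Complex.le_def.1 hE.trace_nonneg).1
    exact div_nonneg this (by positivity)
  have e2 : 0 ≤ E'.trace.re / 2 ^ (t * n) := by
    open scoped ComplexOrder in
    have := (Complex.le_def.1 hE'.trace_nonneg).1
    exact div_nonneg this (by positivity)
  have e3 : 0 ≤ 2 * (t : ℝ) ^ 2 / 2 ^ m := by positivity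
  rw [h5, abs_le]
  constructor <;> nlinarith

end

/-! ## Reasoning about programs -/

/-- `P` takes the stacks `s` to `s'` and writes `C` in at most `k` steps. -/
def Does {ι : Type} (P : Prog ι) (s s' : Store) (C : List (Gate ι ℕ)) (k : ℕ) : Prop :=
  ∃ T ≤ k, Runs P s s' C T

section
variable {ι : Type} {P Q : Prog ι} {s s' s'' : Store} {C D : List (Gate ι ℕ)} {k l : ℕ}

theorem Does.mono (h : Does P s s' C k) (hk : k ≤ l) : Does P s s' C l :=
  let ⟨T, hT, hr⟩ := h
  ⟨T, hT.trans hk, hr⟩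

theorem Does.conv (h : Does P s s' C k) (hs : s' = s'') (hC : C = D) (hk : k ≤ l) :
    Does P s s'' D l := hs ▸ hC ▸ h.mono hk

theorem Does.skip : Does (.skip : Prog ι) s s [] 1 := ⟨1, le_rfl, .skip s⟩

theorem Does.push (r : ℕ) (b : Bool) (h : s' = Function.update s r (b :: s r)) :
    Does (.push r b : Prog ι) s s' [] 1 := h ▸ ⟨1, le_rfl, .push s r b⟩

theorem Does.pop (r : ℕ) (h : s' = Function.update s r (s r).tail) :
    Does (.pop r : Prog ι) s s' [] 1 := h ▸ ⟨1, le_rfl, .pop s r⟩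

theorem Does.emit (g : Gate ι ℕ) : Does (.emit g) s s [g.map fun r => (s r).length] 1 :=
  ⟨1, le_rfl, .emit s g⟩

theorem Does.seq (hP : Does P s s' C k) (hQ : Does Q s' s'' D l) :
    Does (.seq P Q) s s'' (C ++ D) (k + l) :=
  let ⟨_, h1, r1⟩ := hP
  let ⟨_, h2, r2⟩ := hQ
  ⟨_, add_le_add h1 h2, .seq r1 r2⟩

theorem Does.seq_nil (hP : Does P s s' [] k) (hQ : Does Q s' s'' D l) :
    Does (.seq P Q) s s'' D (k + l) := hP.seq hQ

theorem Does.branch_true {r : ℕ} (hr : (s r).head? = some true) (h : Does P s s' C k) :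
    Does (.branch r P Q) s s' C (k + 1) :=
  let ⟨_, h1, r1⟩ := h
  ⟨_, add_le_add_left h1 1, .branch_true hr r1⟩

theorem Does.branch_false {r : ℕ} (hr : (s r).head? ≠ some true) (h : Does Q s s' C k) :
    Does (.branch r P Q) s s' C (k + 1) :=
  let ⟨_, h1, r1⟩ := h
  ⟨_, add_le_add_left h1 1, .branch_false hr r1⟩

theorem Does.loop_done {r : ℕ} (hr : s r = []) : Does (.loop r P) s s [] 1 :=
  ⟨1, le_rfl, .loop_done hr⟩

theorem Does.loop_step {r : ℕ} (hr : s r ≠ []) (hP : Does P s s' C k)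
    (hQ : Does (.loop r P) s' s'' D l) : Does (.loop r P) s s'' (C ++ D) (k + l + 1) :=
  let ⟨_, h1, r1⟩ := hP
  let ⟨_, h2, r2⟩ := hQ
  ⟨_, add_le_add_left (add_le_add h1 h2) 1, .loop_step hr r1 r2⟩

/-- A loop that runs through the states `S 0, …, S n`. -/
theorem Does.loop_range {r : ℕ} (n : ℕ) (S : ℕ → Store) (O : ℕ → List (Gate ι ℕ))
    (hne : ∀ i < n, S i r ≠ []) (hstep : ∀ i < n, Does P (S i) (S (i + 1)) (O i) k)
    (hend : S n r = []) :
    Does (.loop r P) (S 0) (S n) ((List.range n).flatMap O) (n * (k + 1) + 1) := by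
  -- A loop unfolds at its first iteration, so the induction is on the number j of iterations still
  -- to be done.
  suffices H : ∀ j ≤ n, Does (.loop r P) (S (n - j)) (S n)
      ((List.range' (n - j) j).flatMap O) (j * (k + 1) + 1) by
    have := H n le_rfl
    rwa [Nat.sub_self, ← List.range_eq_range'] at this
  intro j
  induction j with
  | zero => intro _; simpa using Does.loop_done hend
  | succ j ih =>
    intro hj
    have e : n - (j + 1) + 1 = n - j := by omega
    rw [List.range'_succ, List.flatMap_cons, e]
    have hlt : n - (j + 1) < n := by omega
    have h1 := hstep _ hlt
    rw [e] at h1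
    refine (Does.loop_step (hne _ hlt) h1 (ih (by omega))).mono (le_of_eq ?_)
    ring

end

theorem unary_succ (n : ℕ) : unary (n + 1) = true :: unary n := rfl

theorem unary_add (m n : ℕ) : unary m ++ unary n = unary (m + n) := by
  simp [unary]

theorem unary_length (n : ℕ) : (unary n).length = n := by simp [unary]

theorem unary_zero : unary 0 = [] := rfl

theorem unary_tail (n : ℕ) : (unary n).tail = unary (n - 1) := by
  cases n <;> simp [unary, List.replicate_succ]

theorem unary_head_succ (n : ℕ) : (unary (n + 1)).head? = some true := rfl

/-! ### Elementary programs -/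

/-- Empty a stack. -/
def Prog.clear {ι : Type} (r : ℕ) : Prog ι := .loop r (.pop r)

/-- Move stack `a` to stack `b`, as a unary number. -/
def Prog.move {ι : Type} (a b : ℕ) : Prog ι := .loop a (.seq (.pop a) (.push b true))

/-- Add the unary number on stack `a` to the one on stack `b`, with a temporary stack `c`. -/
def Prog.add {ι : Type} (a b c : ℕ) : Prog ι :=
  .seq (.loop a (.seq (.pop a) (.seq (.push b true) (.push c true)))) (.move c a)

section
variable {ι : Type}

theorem does_clear (r : ℕ) (s : Store) :
    Does (Prog.clear r : Prog ι) s (Function.update s r []) [] (2 * (s r).length + 1) := by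
  generalize hl : s r = l
  induction l generalizing s with
  | nil => rw [← hl, Function.update_eq_self]; exact (Does.loop_done hl).mono (by omega)
  | cons x l ih =>
    have h := ih (Function.update s r l) (by simp)
    refine Does.conv (Does.loop_step (by simp [hl]) (Does.pop r (by rw [hl]; rfl)) h) ?_ rfl ?_
    · simp
    · simp; omega

theorem does_move {a b : ℕ} (hab : a ≠ b) (s : Store) :
    Does (Prog.move a b : Prog ι) s
      (Function.update (Function.update s a []) b (unary (s a).length ++ s b)) []
      (3 * (s a).length + 1) := by
  generalize hl : s a = l
  induction l generalizing s with
  | nil =>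
    have : Function.update (Function.update s a []) b (unary ([] : List Bool).length ++ s b) = s := by
      rw [← hl, Function.update_eq_self]
      simp [hl, unary]
    rw [this]
    exact (Does.loop_done hl).mono (by omega)
  | cons x l ih =>
    have h := ih (Function.update (Function.update s a l) b (true :: s b)) (by simp [hab])
    have h1 : Does (.seq (.pop a) (.push b true) : Prog ι) s
        (Function.update (Function.update s a l) b (true :: s b)) [] 2 :=
      (Does.pop a rfl).seq_nil (Does.push b true (by simp [hl, hab.symm]))
    refine Does.conv (Does.loop_step (by simp [hl]) h1 h) ?_ rfl ?_
    · funext r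
      by_cases h1 : r = b
      · subst h1
        simp [unary, List.replicate_succ']
      · by_cases h2 : r = a
        · subst h2; simp [hab]
        · simp [h1, h2]
    · simp; omega

/-- Reading a unary number destroys it, so it is copied to `c` at the same time and moved back: 4h +
1 steps out and 3h + 1 steps back. -/
theorem does_add {a b c : ℕ} (hab : a ≠ b) (hac : a ≠ c) (hbc : b ≠ c) (s : Store) (h : ℕ)
    (ha : s a = unary h) (hc : s c = []) :
    Does (Prog.add a b c : Prog ι) s (Function.update s b (unary h ++ s b)) [] (7 * h + 2) := by
  have hloop : Does (.loop a (.seq (.pop a) (.seq (.push b true) (.push c true))) : Prog ι) s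
      (Function.update (Function.update (Function.update s a []) b (unary h ++ s b)) c (unary h))
      [] (4 * h + 1) := by
    have := Does.loop_range (ι := ι) (r := a) (k := 3)
      (P := .seq (.pop a) (.seq (.push b true) (.push c true))) h
      (fun i => Function.update (Function.update (Function.update s a (unary (h - i))) b
        (unary i ++ s b)) c (unary i)) (fun _ => []) ?_ ?_ ?_
    · convert this.mono (l := 4 * h + 1) (by omega) using 1
      · funext r
        by_cases h1 : r = c
        · subst h1; simp [hc, unary]
        · by_cases h2 : r = b
          · subst h2; simp [h1, unary]
          · by_cases h3 : r = a
            · subst h3; simp [h1, h2, ha]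
            · simp [h1, h2, h3]
      · simp [unary]
      · simp
    · intro i hi
      simp [hab, hac, unary]
      omega
    · intro i hi
      refine ((Does.pop a rfl).seq_nil ((Does.push b true rfl).seq_nil (Does.push c true ?_)))
      funext r
      by_cases h1 : r = c
      · subst h1; simp [hac.symm, hbc.symm, unary_succ]
      · by_cases h2 : r = b
        · subst h2; simp [h1, hab.symm, unary_succ]
        · by_cases h3 : r = a
          · subst h3; simp [h1, h2, unary_tail]; congr 1
          · simp [h1, h2, h3]
    · simp [hab, hac, unary]
  refine Does.conv (hloop.seq_nil (does_move hac.symm _)) ?_ rfl ?_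
  · funext r
    by_cases h1 : r = c
    · subst h1; simp [hbc.symm, hac.symm, hc]
    · by_cases h2 : r = b
      · subst h2; simp [h1, hab.symm]
      · by_cases h3 : r = a
        · subst h3; simp [h1, h2, ha, unary]
        · simp [h1, h2, h3]
  · simp [unary]; omega

end

/-! ### Evaluation of polynomials -/

/-- Push `c` ones. -/
def Prog.pushes {ι : Type} (r : ℕ) : ℕ → Prog ι
  | 0 => .skip
  | c + 1 => .seq (.push r true) (.pushes r c)

theorem does_pushes {ι : Type} (r c : ℕ) (s : Store) :
    Does (Prog.pushes r c : Prog ι) s (Function.update s r (unary c ++ s r)) [] (c + 1) := by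
  induction c generalizing s with
  | zero => exact Does.conv Does.skip (by simp [unary]) rfl le_rfl
  | succ c ih =>
    refine Does.conv ((Does.push r true rfl).seq_nil (ih _)) ?_ rfl (by omega)
    simp [unary, List.replicate_succ']

/-- Multiply the unary number on stack `r` by the one on stack `0`. -/
def Prog.mulInput {ι : Type} (r : ℕ) : Prog ι :=
  .seq (.move r 9) (.loop 9 (.seq (.pop 9) (.add 0 r 11)))

theorem does_mulInput {ι : Type} {r : ℕ} (h0 : r ≠ 0) (h9 : r ≠ 9) (h11 : r ≠ 11) (s : Store)
    (n h : ℕ) (hn : s 0 = unary n) (hr : s r = unary h) (s9 : s 9 = []) (s11 : s 11 = []) :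
    Does (Prog.mulInput r : Prog ι) s (Function.update s r (unary (h * n))) []
      (3 * h + 1 + (h * (7 * n + 4) + 1)) := by
  refine ((does_move h9 s).mono (l := 3 * h + 1) (by simp [hr, unary])).seq_nil ?_
  have := Does.loop_range (ι := ι) (r := 9) (k := 7 * n + 3)
      (P := .seq (.pop 9) (.add 0 r 11)) h
      (fun i => Function.update (Function.update s r (unary (i * n))) 9 (unary (h - i)))
      (fun _ => []) ?_ ?_ ?_
  · convert this using 1
    · funext q
      by_cases h1 : q = 9
      · subst h1; simp [hr, unary, s9]
      · by_cases h2 : q = r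
        · subst h2; simp [h1, unary]
        · simp [h1, h2]
    · funext q
      by_cases h1 : q = 9
      · subst h1; simp [h9.symm, unary, s9]
      · simp [h1]
    · simp
  · intro i hi
    simp [unary]
    omega
  · intro i hi
    refine Does.conv ((Does.pop 9 rfl).seq_nil (does_add h0.symm (by norm_num) h11 _ n ?_ ?_))
      ?_ rfl (by omega)
    · simp [h0.symm, hn]
    · simp [h11.symm, s11]
    · funext q
      by_cases h1 : q = 9
      · subst h1; simp [h9.symm, unary_tail]; congr 1
      · by_cases h2 : q = r
        · subst h2; simp [h1, unary]; ring
        · simp [h1, h2]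
  · simp [unary]

/-- Horner's scheme: adding a constant is a fixed number of pushes, and multiplying by n is repeated
addition from stack 0. Stacks 9 and 11 are scratch and must be empty. -/
theorem exists_prog_eval {ι : Type} (p : Polynomial ℕ) {r : ℕ} (h0 : r ≠ 0) (h9 : r ≠ 9)
    (h11 : r ≠ 11) : ∃ (P : Prog ι) (q : Polynomial ℕ), ∀ (s : Store) (n : ℕ),
      s 0 = unary n → s r = [] → s 9 = [] → s 11 = [] →
        Does P s (Function.update s r (unary (p.eval n))) [] (q.eval n) := by
  induction p using Polynomial.recOnHorner with
  | M0 =>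
    refine ⟨.skip, 1, fun s n _ hr _ _ => ?_⟩
    have : Function.update s r (unary ((0 : Polynomial ℕ).eval n)) = s := by
      rw [Polynomial.eval_zero, unary_zero, ← hr, Function.update_eq_self]
    rw [this]
    simpa using Does.skip (ι := ι) (s := s)
  | MC p a _ _ ih =>
    obtain ⟨P, q, h⟩ := ih
    refine ⟨.seq P (.pushes r a), q + Polynomial.C (a + 1), fun s n hn hr s9 s11 => ?_⟩
    refine Does.conv ((h s n hn hr s9 s11).seq_nil (does_pushes r a _)) ?_ rfl (by simp)
    simp [unary_add, add_comm]
  | MX p _ ih =>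
    obtain ⟨P, q, h⟩ := ih
    refine ⟨.seq P (.mulInput r), q + (3 * p + 1 + (p * (7 * Polynomial.X + 4) + 1)),
      fun s n hn hr s9 s11 => ?_⟩
    refine Does.conv ((h s n hn hr s9 s11).seq_nil (does_mulInput h0 h9 h11 _ n (p.eval n)
      ?_ ?_ ?_ ?_)) ?_ rfl ?_
    · simp [h0.symm, hn]
    · simp
    · simp [h9.symm, s9]
    · simp [h11.symm, s11]
    · simp
    · simp

/-! ### Renaming the stacks of a program -/

/-- Rename the stacks of a program. -/
def Prog.rename {ι : Type} (f : ℕ → ℕ) : Prog ι → Prog ι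
  | .skip => .skip
  | .push r b => .push (f r) b
  | .pop r => .pop (f r)
  | .emit g => .emit (g.map f)
  | .seq P Q => .seq (P.rename f) (Q.rename f)
  | .branch r P Q => .branch (f r) (P.rename f) (Q.rename f)
  | .loop r P => .loop (f r) (P.rename f)

/-- Rename the stacks of a program, and replace its output instructions. -/
def Prog.transform {ι : Type} (f : ℕ → ℕ) (E : Gate ι ℕ → Prog ι) : Prog ι → Prog ι
  | .skip => .skip
  | .push r b => .push (f r) b
  | .pop r => .pop (f r)
  | .emit g => E g
  | .seq P Q => .seq (P.transform f E) (Q.transform f E)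
  | .branch r P Q => .branch (f r) (P.transform f E) (Q.transform f E)
  | .loop r P => .loop (f r) (P.transform f E)

section
variable {ι : Type}

/-- If `E g` writes the renamed gate and leaves all stacks as they are, whenever the stacks outside
of the image of `f` are as in `base`, then the transformed program writes the renamed circuit. -/
theorem Runs.transform {f : ℕ → ℕ} (hf : f.Injective) {E : Gate ι ℕ → Prog ι} {base : Store}
    {Good : Gate ι ℕ → Prop} {φ : ℕ → ℕ} {K : ℕ} (hK : 1 ≤ K)
    (hE : ∀ (g : Gate ι ℕ) (t : Store), (∀ q ∉ Set.range f, t q = base q) →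
      Good (g.map fun r => (t (f r)).length) →
      Does (E g) t t [(g.map fun r => (t (f r)).length).map φ] K)
    {P : Prog ι} {s s' : Store} {C : List (Gate ι ℕ)} {T : ℕ} (h : Runs P s s' C T)
    (hC : ∀ g ∈ C, Good g) (t : Store) (ht : ∀ r, t (f r) = s r)
    (hb : ∀ q ∉ Set.range f, t q = base q) :
    ∃ t', Does (P.transform f E) t t' (C.map (Gate.map φ)) (T * K) ∧ (∀ r, t' (f r) = s' r) ∧
      ∀ q ∉ Set.range f, t' q = base q := by
  have upd : ∀ (t s : Store) (r : ℕ) (l : List Bool), (∀ r, t (f r) = s r) →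
      (∀ q ∉ Set.range f, t q = base q) →
      (∀ q, Function.update t (f r) l (f q) = Function.update s r l q) ∧
      ∀ q ∉ Set.range f, Function.update t (f r) l q = base q := by
    intro t s r l ht hb
    constructor
    · intro q
      by_cases h : q = r
      · subst h; simp
      · rw [Function.update_of_ne h, Function.update_of_ne (hf.ne h), ht]
    · intro q hq
      rw [Function.update_of_ne, hb q hq]
      rintro rfl
      exact hq ⟨r, rfl⟩
  induction h generalizing t with
  | skip s => exact ⟨t, Does.skip.mono (by omega), ht, hb⟩
  | push s r b =>
    have := upd t s r (b :: s r) ht hb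
    exact ⟨_, (Does.push (f r) b (by rw [ht])).mono (by omega), this.1, this.2⟩
  | pop s r =>
    have := upd t s r (s r).tail ht hb
    exact ⟨_, (Does.pop (f r) (by rw [ht])).mono (by omega), this.1, this.2⟩
  | emit s g =>
    refine ⟨t, ?_, ht, hb⟩
    have e : (fun r => (t (f r)).length) = fun r => (s r).length := by funext r; rw [ht]
    have := hE g t hb (by rw [e]; exact hC _ (by simp))
    rw [e] at this
    exact Does.conv this rfl rfl (by omega)
  | @seq P Q s₀ s₁ s₂ C D T U _ _ ihP ihQ =>
    obtain ⟨t₁, h1, e1, b1⟩ := ihP (fun g hg => hC g (by simp [hg])) t ht hb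
    obtain ⟨t₂, h2, e2, b2⟩ := ihQ (fun g hg => hC g (by simp [hg])) t₁ e1 b1
    refine ⟨t₂, Does.conv (h1.seq h2) rfl (by simp) (by rw [add_mul]), e2, b2⟩
  | @branch_true r P Q s s' C T hr _ ih =>
    obtain ⟨t₁, h1, e1, b1⟩ := ih hC t ht hb
    exact ⟨t₁, (Does.branch_true (by rw [ht, hr]) h1).mono (by rw [add_mul]; omega), e1, b1⟩
  | @branch_false r P Q s s' C T hr _ ih =>
    obtain ⟨t₁, h1, e1, b1⟩ := ih hC t ht hb
    exact ⟨t₁, (Does.branch_false (by rwa [ht]) h1).mono (by rw [add_mul]; omega), e1, b1⟩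
  | @loop_done r P s hr => exact ⟨t, (Does.loop_done (by rw [ht, hr])).mono (by omega), ht, hb⟩
  | @loop_step r P s₀ s₁ s₂ C D T U hr _ _ ihP ihQ =>
    obtain ⟨t₁, h1, e1, b1⟩ := ihP (fun g hg => hC g (by simp [hg])) t ht hb
    obtain ⟨t₂, h2, e2, b2⟩ := ihQ (fun g hg => hC g (by simp [hg])) t₁ e1 b1
    refine ⟨t₂, Does.conv (Does.loop_step (by rwa [ht]) h1 h2) rfl (by simp) ?_, e2, b2⟩
    rw [add_mul, add_mul]; omega

theorem Prog.transform_emit (f : ℕ → ℕ) (P : Prog ι) :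
    P.transform f (fun g => .emit (g.map f)) = P.rename f := by
  induction P <;> simp_all [Prog.transform, Prog.rename]

theorem Gate.map_id' (g : Gate ι ℕ) : g.map (fun h => h) = g := by cases g <;> rfl

/-- The case of `Runs.transform` in which each output instruction stays one instruction and qubit
numbers do not change, so that there is no overhead. -/
theorem Runs.rename {f : ℕ → ℕ} (hf : f.Injective) {P : Prog ι} {s s' : Store}
    {C : List (Gate ι ℕ)} {T : ℕ} (h : Runs P s s' C T) (t : Store) (ht : ∀ r, t (f r) = s r) :
    ∃ t', Does (P.rename f) t t' C T ∧ (∀ r, t' (f r) = s' r) ∧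
      ∀ q ∉ Set.range f, t' q = t q := by
  obtain ⟨t', h1, h2, h3⟩ := Runs.transform hf (E := fun g => .emit (g.map f)) (base := t)
    (Good := fun _ => True) (φ := fun h => h) (K := 1) le_rfl (fun g t _ _ => by
      have := Does.emit (s := t) (g.map f)
      rw [Gate.map_map] at this
      rw [Gate.map_id']
      exact this) h (fun _ _ => trivial) t ht fun _ _ => rfl
  refine ⟨t', ?_, h2, h3⟩
  rw [Prog.transform_emit] at h1
  refine Does.conv h1 rfl ?_ (by omega)
  exact (List.map_congr_left fun g _ => Gate.map_id' g).trans (List.map_id C)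

/-! ### Stacks that a program does not mention -/

/-- All stacks mentioned by the program have smaller numbers. -/
def Prog.bound {ι : Type} : Prog ι → ℕ
  | .skip => 0
  | .push r _ => r + 1
  | .pop r => r + 1
  | .emit _ => 0
  | .seq P Q => max P.bound Q.bound
  | .branch _ P Q => max P.bound Q.bound
  | .loop _ P => P.bound

/-- Only `push` and `pop` alter a stack, and these are what `Prog.bound` records; stacks that are
merely tested or measured do not matter here. -/
theorem Runs.eq_of_bound_le {P : Prog ι} {s s' : Store} {C : List (Gate ι ℕ)} {T : ℕ}
    (h : Runs P s s' C T) {r : ℕ} (hr : P.bound ≤ r) : s' r = s r := by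
  induction h with
  | skip | emit | loop_done => rfl
  | push s q b => exact Function.update_of_ne (Nat.ne_of_gt hr) _ _
  | pop s q => exact Function.update_of_ne (Nat.ne_of_gt hr) _ _
  | seq _ _ ihP ihQ =>
    rw [Prog.bound, max_le_iff] at hr
    rw [ihQ hr.2, ihP hr.1]
  | branch_true _ _ ih =>
    rw [Prog.bound, max_le_iff] at hr
    exact ih hr.1
  | branch_false _ _ ih =>
    rw [Prog.bound, max_le_iff] at hr
    exact ih hr.2
  | loop_step _ _ _ ihP ihQ => rw [ihQ hr, ihP hr]

/-- One step pushes at most one bit. This bounds the cost of emptying the work stacks between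
repeated runs. -/
theorem Runs.length_le {P : Prog ι} {s s' : Store} {C : List (Gate ι ℕ)} {T : ℕ}
    (h : Runs P s s' C T) (r : ℕ) : (s' r).length ≤ (s r).length + T := by
  induction h with
  | skip | emit | loop_done => omega
  | push s q b =>
    by_cases hr : r = q
    · subst hr; simp
    · rw [Function.update_of_ne hr]; omega
  | pop s q =>
    by_cases hr : r = q
    · subst hr; simp; omega
    · rw [Function.update_of_ne hr]; omega
  | seq => omega
  | branch_true => omega
  | branch_false => omega
  | loop_step => omega

/-- Empty the stacks `f 0, …, f (R - 1)`. -/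
def Prog.clearAll {ι : Type} (f : ℕ → ℕ) : ℕ → Prog ι
  | 0 => .skip
  | R + 1 => .seq (.clearAll f R) (.clear (f R))

open Classical in
theorem does_clearAll {f : ℕ → ℕ} (hf : f.Injective) (R : ℕ) (s : Store) (L : ℕ)
    (hL : ∀ r, (s (f r)).length ≤ L) :
    Does (Prog.clearAll f R : Prog ι) s (fun q => if ∃ r < R, f r = q then [] else s q) []
      (R * (2 * L + 1) + 1) := by
  induction R with
  | zero => exact Does.conv Does.skip (by simp) rfl (by omega)
  | succ R ih =>
    refine Does.conv (ih.seq_nil (does_clear (f R) _)) ?_ rfl ?_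
    · funext q
      by_cases h : q = f R
      · subst h
        rw [Function.update_self, if_pos ⟨R, by omega, rfl⟩]
      · rw [Function.update_of_ne h]
        congr 1
        apply propext
        constructor
        · rintro ⟨r, hr, e⟩; exact ⟨r, by omega, e⟩
        · rintro ⟨r, hr, e⟩
          refine ⟨r, ?_, e⟩
          rcases Nat.lt_succ_iff_lt_or_eq.1 hr with h1 | h1
          · exact h1
          · subst h1; exact absurd e.symm h
    · rw [if_neg]
      · have := hL R
        rw [add_mul]; omega
      · rintro ⟨r, hr, e⟩
        exact absurd (hf e) (by omega)

/-! ### Relabelling the qubits that a program addresses -/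

theorem does_pushTop {q r : ℕ} {s : Store} {x : Bool} {l : List Bool} (h : s q = x :: l) :
    Does (.branch q (.push r true) (.push r false) : Prog ι) s (Function.update s r (x :: s r))
      [] 2 := by
  cases x
  · exact Does.branch_false (by simp [h]) (Does.push r false rfl)
  · exact Does.branch_true (by simp [h]) (Does.push r true rfl)

/-- Move the bits on stack `a` to stack `b`. -/
def Prog.moveBits {ι : Type} (a b : ℕ) : Prog ι :=
  .loop a (.seq (.branch a (.push b true) (.push b false)) (.pop a))

theorem does_moveBits {a b : ℕ} (hab : a ≠ b) (s : Store) :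
    Does (Prog.moveBits a b : Prog ι) s
      (Function.update (Function.update s a []) b ((s a).reverse ++ s b)) []
      (4 * (s a).length + 1) := by
  generalize hl : s a = l
  induction l generalizing s with
  | nil =>
    have : Function.update (Function.update s a []) b (([] : List Bool).reverse ++ s b) = s := by
      rw [← hl, Function.update_eq_self]
      simp [hl]
    rw [this]
    exact (Does.loop_done hl).mono (by omega)
  | cons x l ih =>
    have h := ih (Function.update (Function.update s b (x :: s b)) a l) (by simp)
    have h1 : Does (.seq (.branch a (.push b true) (.push b false)) (.pop a) : Prog ι) s
        (Function.update (Function.update s b (x :: s b)) a l) [] 3 :=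
      (does_pushTop hl).seq_nil (Does.pop a (by simp [hl, hab]))
    refine Does.conv (Does.loop_step (by simp [hl]) h1 h) ?_ rfl ?_
    · funext r
      by_cases h1 : r = b
      · subst h1; simp [hab.symm]
      · by_cases h2 : r = a
        · subst h2; simp [hab]
        · simp [h1, h2]
    · simp; omega

/-- The new number of qubit `h`. -/
def relabelIndex (N A B h : ℕ) : ℕ := if h < N then h + A else h + B

/-- The first half of `Prog.index`: copy the height of stack `q` to stack `U`, and subtract it from
stack `4`. -/
def Prog.measure {ι : Type} (q U : ℕ) : Prog ι :=
  .loop q (.seq (.branch q (.push 9 true) (.push 9 false)) (.seq (.pop q) (.seq (.push U true)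
    (.branch 4 (.seq (.pop 4) (.push 10 true)) .skip))))

/-- Compute the new number of the qubit given by the height of stack `q` on stack `U`. -/
def Prog.index {ι : Type} (q U : ℕ) : Prog ι :=
  .seq (.measure q U) (.seq (.branch 4 (.add 5 U 11) (.add 6 U 11))
    (.seq (.moveBits 9 q) (.move 10 4)))

/-- The parameters of the relabelling are on their stacks. -/
structure IndexReady (s : Store) (N A B : ℕ) : Prop where
  s4 : s 4 = unary N
  s5 : s 5 = unary A
  s6 : s 6 = unary B
  s9 : s 9 = []
  s10 : s 10 = []
  s11 : s 11 = []

/-- The states in the run of `Prog.measure`. -/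
def measureState (s : Store) (q U N i : ℕ) : Store :=
  Function.update (Function.update (Function.update (Function.update (Function.update s
    q ((s q).drop i)) 9 ((s q).take i).reverse) U (unary i)) 4 (unary (N - i))) 10
    (unary (min i N))

/-- Each bit taken from q also takes one from the number N on stack 4, as long as there is one.
Afterwards stack 4 is nonempty exactly if the height of q is below N, which is the test in
`relabelIndex`; stacks 9 and 10 hold what is needed for restoration. -/
theorem does_measure {q U : ℕ} (hq : q < 4 ∨ 12 ≤ q) (hU : U = 7 ∨ U = 8) {s : Store}
    {N A B : ℕ} (hs : IndexReady s N A B) (sU : s U = []) :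
    Does (Prog.measure q U : Prog ι) s (measureState s q U N (s q).length) []
      (8 * (s q).length + 1) := by
  have n1 : q ≠ 9 := by omega
  have n2 : q ≠ U := by omega
  have n3 : q ≠ 4 := by omega
  have n4 : q ≠ 10 := by omega
  have n5 : U ≠ 9 := by omega
  have n6 : U ≠ 4 := by omega
  have n7 : U ≠ 10 := by omega
  have := Does.loop_range (ι := ι) (r := q) (k := 7)
      (P := .seq (.branch q (.push 9 true) (.push 9 false)) (.seq (.pop q) (.seq (.push U true)
        (.branch 4 (.seq (.pop 4) (.push 10 true)) .skip)))) (s q).length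
      (measureState s q U N) (fun _ => []) ?_ ?_ ?_
  · have hst : measureState s q U N 0 = s := by
      funext r
      unfold measureState
      by_cases h1 : r = 10
      · subst h1; simp [hs.s10, unary]
      by_cases h2 : r = 4
      · subst h2; simp [hs.s4]
      by_cases h3 : r = U
      · subst h3; simp [h1, h2, sU, unary]
      by_cases h4 : r = 9
      · subst h4; simp [h3, hs.s9]
      by_cases h5 : r = q
      · subst h5; simp [h1, h2, h3, h4]
      · simp [h1, h2, h3, h4]
    rw [hst] at this
    exact Does.conv this rfl (by simp) (by omega)
  · intro i hi
    simp [measureState, n1, n2, n3, n4]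
    omega
  · intro i hi
    have e0 : measureState s q U N i q = (s q)[i] :: (s q).drop (i + 1) := by
      simp [measureState, n1, n2, n3, n4]
    have e4 : measureState s q U N i 4 = unary (N - i) := by
      simp [measureState]
    have htake : ((s q).take (i + 1)).reverse = (s q)[i] :: ((s q).take i).reverse := by
      rw [List.take_add_one]; simp [hi]
    refine (Does.seq_nil (k := 2) (l := 5) (does_pushTop e0) (Does.seq_nil (k := 1) (l := 4)
      (Does.pop q rfl) (Does.seq_nil (k := 1) (l := 3) (Does.push U true rfl) ?_)))
    by_cases hN : i < N
    · obtain ⟨k, hk⟩ : ∃ k, N - i = k + 1 := ⟨N - i - 1, by omega⟩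
      refine Does.branch_true (k := 2) ?_ (Does.seq_nil (k := 1) (l := 1) (Does.pop 4 rfl)
        (Does.push 10 true ?_))
      · simp [n6.symm, n3.symm, e4, hk, unary_head_succ]
      · funext r
        by_cases h1 : r = 10
        · subst h1
          simp [measureState, n7.symm, n4.symm]
          rw [min_eq_left (by omega), min_eq_left (by omega), unary_succ]
        by_cases h2 : r = 4
        · subst h2
          simp [measureState, n6.symm, n3.symm, unary_tail]; congr 1
        by_cases h3 : r = U
        · subst h3; simp [measureState, h1, h2, n5, n2.symm, unary_succ]
        by_cases h4 : r = 9
        · subst h4; simp [measureState, h3, n1.symm, htake]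
        by_cases h5 : r = q
        · subst h5; simp [measureState, h1, h2, h3, h4]
        · simp [measureState, h1, h2, h3, h4, h5]
    · refine (Does.branch_false (k := 1) ?_ (Does.conv Does.skip ?_ rfl le_rfl)).mono (by omega)
      · have : N - i = 0 := by omega
        simp [n6.symm, n3.symm, e4, this, unary]
      · funext r
        by_cases h1 : r = 10
        · subst h1
          simp [measureState, n7.symm, n4.symm]
          rw [min_eq_right (by omega), min_eq_right (by omega)]
        by_cases h2 : r = 4
        · subst h2
          simp [measureState, n6.symm, n3.symm]; congr 1; omega
        by_cases h3 : r = U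
        · subst h3; simp [measureState, h1, h2, n5, n2.symm, unary_succ]
        by_cases h4 : r = 9
        · subst h4; simp [measureState, h3, n1.symm, htake]
        by_cases h5 : r = q
        · subst h5; simp [measureState, h1, h2, h3, h4]
        · simp [measureState, h1, h2, h3, h4, h5]
  · simp [measureState, n1, n2, n3, n4]

/-- The bits of q are reversed once onto stack 9 and once back, so q is restored exactly, and stack
4 is refilled from stack 10. The cost of the two passes and restorations is 8 + 4 + 3 = 15 per unit
of height. -/
theorem does_index {q U : ℕ} (hq : q < 4 ∨ 12 ≤ q) (hU : U = 7 ∨ U = 8) {s : Store}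
    {N A B : ℕ} (hs : IndexReady s N A B) (sU : s U = []) :
    Does (Prog.index q U : Prog ι) s
      (Function.update s U (unary (relabelIndex N A B (s q).length))) []
      (15 * (s q).length + 7 * (A + B) + 6) := by
  have n1 : q ≠ 9 := by omega
  have n2 : q ≠ U := by omega
  have n3 : q ≠ 4 := by omega
  have n4 : q ≠ 10 := by omega
  have n5 : U ≠ 9 := by omega
  have n6 : U ≠ 4 := by omega
  have n7 : U ≠ 10 := by omega
  have n8 : q ≠ 5 := by omega
  have n9 : q ≠ 6 := by omega
  have n10 : q ≠ 11 := by omega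
  have n11 : U ≠ 5 := by omega
  have n12 : U ≠ 6 := by omega
  have n13 : U ≠ 11 := by omega
  set h := (s q).length with hh
  set s₁ := measureState s q U N h with hs₁
  have hadd : Does (.branch 4 (.add 5 U 11) (.add 6 U 11) : Prog ι) s₁
      (Function.update s₁ U (unary (relabelIndex N A B h))) [] (7 * (A + B) + 3) := by
    have e4 : s₁ 4 = unary (N - h) := by simp [hs₁, measureState]
    have e5 : s₁ 5 = unary A := by simp [hs₁, measureState, n11.symm, n8.symm, hs.s5]
    have e6 : s₁ 6 = unary B := by simp [hs₁, measureState, n12.symm, n9.symm, hs.s6]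
    have e11 : s₁ 11 = [] := by simp [hs₁, measureState, n13.symm, n10.symm, hs.s11]
    have eU : s₁ U = unary h := by simp [hs₁, measureState, n6, n7]
    by_cases hN : h < N
    · obtain ⟨k, hk⟩ : ∃ k, N - h = k + 1 := ⟨N - h - 1, by omega⟩
      refine Does.conv (Does.branch_true (by rw [e4, hk]; rfl)
        (does_add n11.symm (by norm_num) n13 s₁ A e5 e11)) ?_ rfl (by omega)
      rw [eU, unary_add, relabelIndex, if_pos hN, add_comm]
    · refine Does.conv (Does.branch_false (by rw [e4, Nat.sub_eq_zero_of_le (by omega)]; simp [unary])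
        (does_add n12.symm (by norm_num) n13 s₁ B e6 e11)) ?_ rfl (by omega)
      rw [eU, unary_add, relabelIndex, if_neg hN, add_comm]
  refine Does.conv ((does_measure hq hU hs sU).seq_nil (hadd.seq_nil
    ((does_moveBits n1.symm _).seq_nil (does_move (by norm_num) _)))) ?_ rfl ?_
  · funext r
    have hmin : min h N + (N - h) = N := by omega
    by_cases h1 : r = 10
    · subst h1; simp [n7.symm, hs.s10]
    by_cases h2 : r = 4
    · subst h2; simp [hs₁, measureState, n6.symm, n3.symm, n4.symm, n7.symm, hs.s4, unary_length,
        unary_add, hmin]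
    by_cases h3 : r = U
    · subst h3; simp [h1, h2, n2.symm, n5]
    by_cases h4 : r = 9
    · subst h4; simp [h3, n1.symm, hs.s9]
    by_cases h5 : r = q
    · subst h5; simp [hs₁, measureState, h1, h2, h3, h4, n5.symm, hh]
    · simp [hs₁, measureState, h1, h2, h3, h4, h5]
  · simp [hs₁, measureState, n5.symm, n7.symm, n4.symm, unary_length, hh.symm]
    omega

/-- Write the gate `g` with relabelled qubits. -/
def Prog.emitIndexed {ι : Type} (f : ℕ → ℕ) : Gate ι ℕ → Prog ι
  | .hadamard r => .seq (.index (f r) 7) (.seq (.emit (.hadamard 7)) (.clear 7))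
  | .tgate r => .seq (.index (f r) 7) (.seq (.emit (.tgate 7)) (.clear 7))
  | .extra i r => .seq (.index (f r) 7) (.seq (.emit (.extra i 7)) (.clear 7))
  | .cnot c t => .seq (.index (f c) 7) (.seq (.index (f t) 8) (.seq (.emit (.cnot 7 8))
      (.seq (.clear 7) (.clear 8))))

theorem relabelIndex_le (N A B h : ℕ) : relabelIndex N A B h ≤ h + (A + B) := by
  unfold relabelIndex; split_ifs <;> omega

/-- The stated bound is the cost for a CNOT: two index computations, one output, and clearing of two
numbers of size at most W + A + B. -/
theorem does_emitIndexed {f : ℕ → ℕ} (hf : ∀ r, f r < 4 ∨ 12 ≤ f r) {s : Store} {N A B W : ℕ}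
    (hs : IndexReady s N A B) (s7 : s 7 = []) (s8 : s 8 = []) (g : Gate ι ℕ)
    (hg : (g.map fun r => (s (f r)).length).Valid W) :
    Does (Prog.emitIndexed f g) s s
      [(g.map fun r => (s (f r)).length).map (relabelIndex N A B)]
      (34 * W + 18 * (A + B) + 15) := by
  have one : ∀ (r : ℕ) (g : Gate ι ℕ) (out : Gate ι ℕ), (s (f r)).length < W →
      (∀ t : Store, t 7 = unary (relabelIndex N A B (s (f r)).length) →
        g.map (fun r => (t r).length) = out) →
      Does (.seq (.index (f r) 7) (.seq (.emit g) (.clear 7))) s s [out]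
        (34 * W + 18 * (A + B) + 15) := by
    intro r g out hr hout
    have h1 := does_index (ι := ι) (hf r) (Or.inl rfl) hs s7
    refine Does.conv (h1.seq_nil ((Does.emit g).seq (does_clear 7 _))) ?_ ?_ ?_
    · rw [Function.update_idem, ← s7, Function.update_eq_self]
    · rw [hout _ (Function.update_self ..)]; rfl
    · rw [Function.update_self, unary_length]
      have := relabelIndex_le N A B (s (f r)).length
      omega
  cases g with
  | hadamard r => exact one r _ _ hg fun t ht => by simp [Gate.map, ht, unary_length]
  | tgate r => exact one r _ _ hg fun t ht => by simp [Gate.map, ht, unary_length]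
  | extra i r => exact one r _ _ hg fun t ht => by simp [Gate.map, ht, unary_length]
  | cnot c t =>
    have hc : (s (f c)).length < W := hg.1
    have ht : (s (f t)).length < W := hg.2.1
    have h1 := does_index (ι := ι) (hf c) (Or.inl rfl) hs s7
    set s₁ := Function.update s 7 (unary (relabelIndex N A B (s (f c)).length)) with hs₁
    have hr₁ : IndexReady s₁ N A B :=
      ⟨by simp [hs₁, hs.s4], by simp [hs₁, hs.s5], by simp [hs₁, hs.s6], by simp [hs₁, hs.s9],
        by simp [hs₁, hs.s10], by simp [hs₁, hs.s11]⟩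
    have e : s₁ (f t) = s (f t) := by
      rw [hs₁, Function.update_of_ne]
      have := hf t
      omega
    have h2 := does_index (ι := ι) (hf t) (Or.inr rfl) hr₁ (by simp [hs₁, s8])
    rw [e] at h2
    refine Does.conv (h1.seq_nil (h2.seq_nil ((Does.emit _).seq
      ((does_clear 7 _).seq_nil (does_clear 8 _))))) ?_ ?_ ?_
    · funext r
      by_cases h8 : r = 8
      · subst h8; simp [s8]
      by_cases h7 : r = 7
      · subst h7; simp [s7]
      · simp [h7, h8, hs₁]
    · simp [Gate.map, hs₁, unary_length]
    · have i1 := relabelIndex_le N A B (s (f c)).length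
      have i2 := relabelIndex_le N A B (s (f t)).length
      simp [hs₁, unary_length]
      omega

/-- Running a program on renamed stacks, with relabelled qubits. -/
theorem Runs.relabel {f : ℕ → ℕ} (hf : f.Injective) (hf' : ∀ r, f r < 4 ∨ 12 ≤ f r)
    {P : Prog ι} {s s' : Store} {C : List (Gate ι ℕ)} {T W : ℕ} (h : Runs P s s' C T)
    (hC : ∀ g ∈ C, g.Valid W) {N A B : ℕ} {t : Store} (hr : IndexReady t N A B) (t7 : t 7 = [])
    (t8 : t 8 = []) (ht : ∀ r, t (f r) = s r) :
    ∃ t', Does (P.transform f (Prog.emitIndexed f)) t t' (C.map (Gate.map (relabelIndex N A B)))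
      (T * (34 * W + 18 * (A + B) + 15)) ∧ (∀ r, t' (f r) = s' r) ∧
      ∀ q ∉ Set.range f, t' q = t q := by
  have hn : ∀ q, 4 ≤ q → q < 12 → q ∉ Set.range f := by
    rintro q h1 h2 ⟨r, rfl⟩
    have := hf' r
    omega
  refine Runs.transform hf (base := t) (Good := fun g => g.Valid W) (by omega) ?_ h hC t ht
    fun _ _ => rfl
  intro g u hu hg
  have e : ∀ q, 4 ≤ q → q < 12 → u q = t q := fun q h1 h2 => hu q (hn q h1 h2)
  refine does_emitIndexed hf' ⟨?_, ?_, ?_, ?_, ?_, ?_⟩ ?_ ?_ g hg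
  · rw [e 4 (by norm_num) (by norm_num), hr.s4]
  · rw [e 5 (by norm_num) (by norm_num), hr.s5]
  · rw [e 6 (by norm_num) (by norm_num), hr.s6]
  · rw [e 9 (by norm_num) (by norm_num), hr.s9]
  · rw [e 10 (by norm_num) (by norm_num), hr.s10]
  · rw [e 11 (by norm_num) (by norm_num), hr.s11]
  · rw [e 7 (by norm_num) (by norm_num), t7]
  · rw [e 8 (by norm_num) (by norm_num), t8]

end

/-! ## Uniformity of composed circuit families -/

/-- Stacks of the second of two programs that are run one after the other. -/
def outerStack (r : ℕ) : ℕ := if r < 4 then r else 2 * r + 100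

/-- Stacks of the program for a channel. -/
def innerStack (r : ℕ) : ℕ := 2 * r + 101

theorem outerStack_injective : outerStack.Injective := by
  intro r q h
  unfold outerStack at h
  split_ifs at h <;> omega

theorem innerStack_injective : innerStack.Injective := by
  intro r q h
  unfold innerStack at h
  omega

/-- Stacks 4 to 11 are reserved for relabelling and scratch. Beyond the four inputs, outer stacks
are even and at least 108, while inner stacks are odd and at least 101; thus the two simulated
programs never interfere with each other or with stacks 12 and 13. -/
theorem outerStack_free (r : ℕ) : outerStack r < 4 ∨ 12 ≤ outerStack r := by
  unfold outerStack
  split_ifs <;> omega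

theorem innerStack_free (r : ℕ) : innerStack r < 4 ∨ 12 ≤ innerStack r := by
  unfold innerStack
  omega

theorem inputStore_of_le {l : List (List Bool)} {r : ℕ} (h : l.length ≤ r) :
    inputStore l r = [] := List.getD_eq_default _ _ h

theorem inputStore_outerStack {l : List (List Bool)} (hl : l.length ≤ 4) (r : ℕ) :
    inputStore l (outerStack r) = inputStore l r := by
  unfold outerStack
  split_ifs with h
  · rfl
  · rw [inputStore_of_le (by omega), inputStore_of_le (by omega)]

section
variable {ι : Type}

/-- The body of the loop that applies a channel program to every input. -/
def Prog.applyBody (P : Prog ι) : Prog ι :=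
  .seq (.pop 13) (.seq (.add 0 101 11) (.seq (P.transform innerStack (Prog.emitIndexed innerStack))
    (.seq (.clearAll innerStack (P.bound + 1)) (.seq (.add 0 5 11) (.add 12 6 11)))))

/-- The states in the loop that applies a channel program to every input. -/
def applyState (s : Store) (n t a b j : ℕ) : Store :=
  Function.update (Function.update (Function.update s 5 (unary (n * j))) 6 (unary (b + a * j))) 13
    (unary (t - j))

/-- Writes the channel circuit for copy j. Stack 101 is the image of input stack 0, so it receives
n; afterwards all simulated stacks are emptied and the offsets grow by n and a. The time bound uses
j < t to be independent of j, as needed for the loop. -/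
theorem does_applyBody {P : Prog ι} {s' s : Store} {C : List (Gate ι ℕ)} {T n t a b j : ℕ}
    (hj : j < t) (h : Runs P (inputStore [unary n]) s' C T) (hC : ∀ g ∈ C, g.Valid (n + a))
    (s0 : s 0 = unary n) (s4 : s 4 = unary n) (s12 : s 12 = unary a)
    (he : ∀ q ∈ [7, 8, 9, 10, 11], s q = []) (hi : ∀ r, s (innerStack r) = []) :
    Does P.applyBody (applyState s n t a b j) (applyState s n t a b (j + 1))
      (C.map (Gate.map (relabelIndex n (n * j) (b + a * j))))
      (1 + (7 * n + 2) + T * (34 * (n + a) + 18 * (n * t + (b + a * t)) + 15) +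
        ((P.bound + 1) * (2 * (n + T) + 1) + 1) + (7 * n + 2) + (7 * a + 2)) := by
  classical
  set s₁ := applyState s n t a b j with hs₁
  have hne : ∀ r, innerStack r ≠ 13 ∧ innerStack r ≠ 6 ∧ innerStack r ≠ 5 := fun r => by
    unfold innerStack; omega
  set s₂ := Function.update s₁ 13 (unary (t - (j + 1))) with hs₂
  have h₁ : Does (.pop 13 : Prog ι) s₁ s₂ [] 1 := Does.pop 13 (by
    simp [hs₂, hs₁, applyState, unary_tail]; congr 1)
  set s₃ := Function.update s₂ 101 (unary n) with hs₃
  have h₂ : Does (.add 0 101 11 : Prog ι) s₂ s₃ [] (7 * n + 2) := by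
    refine Does.conv (does_add (by norm_num) (by norm_num) (by norm_num) s₂ n ?_ ?_) ?_ rfl le_rfl
    · simp [hs₂, hs₁, applyState, s0]
    · simp [hs₂, hs₁, applyState, he]
    · have e := hi 0
      simp only [innerStack] at e
      simp [hs₃, hs₂, hs₁, applyState, e]
  have hr : IndexReady s₃ n (n * j) (b + a * j) := by
    refine ⟨?_, ?_, ?_, ?_, ?_, ?_⟩ <;> simp [hs₃, hs₂, hs₁, applyState, s4, he]
  obtain ⟨s₄, h₃, e₄, f₄⟩ := h.relabel innerStack_injective innerStack_free hC hr
    (by simp [hs₃, hs₂, hs₁, applyState, he]) (by simp [hs₃, hs₂, hs₁, applyState, he]) (by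
      intro r
      by_cases h0 : r = 0
      · subst h0; simp [hs₃, innerStack, inputStore]
      · rw [inputStore_of_le (by simp; omega)]
        have : innerStack r ≠ 101 := by unfold innerStack; omega
        simp [hs₃, hs₂, hs₁, applyState, hi, this, hne r])
  -- One stack more than the bound is cleared, since the input stack 0 has to be emptied even if the
  -- program never changes a stack.
  have h₄ : Does (.clearAll innerStack (P.bound + 1) : Prog ι) s₄ s₂ []
      ((P.bound + 1) * (2 * (n + T) + 1) + 1) := by
    refine Does.conv (does_clearAll innerStack_injective (P.bound + 1) s₄ (n + T) ?_) ?_ rfl le_rfl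
    · intro r
      rw [e₄]
      refine (h.length_le r).trans (Nat.add_le_add_right ?_ _)
      by_cases h0 : r = 0
      · subst h0; simp [inputStore, unary]
      · rw [inputStore_of_le (by simp; omega)]; simp
    · funext q
      by_cases hq : q ∈ Set.range innerStack
      · obtain ⟨r, rfl⟩ := hq
        have e : s₂ (innerStack r) = [] := by simp [hs₂, hs₁, applyState, hi, hne r]
        rw [e]
        split_ifs with hex
        · rfl
        · have hrb : P.bound + 1 ≤ r := by
            by_contra hlt
            exact hex ⟨r, by omega, rfl⟩
          rw [e₄, h.eq_of_bound_le (by omega), inputStore_of_le (by simp; omega)]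
      · rw [if_neg (fun ⟨r, _, e⟩ => hq ⟨r, e⟩), f₄ q hq, hs₃, Function.update_of_ne]
        rintro rfl
        exact hq ⟨0, rfl⟩
  have h₅ : Does (.add 0 5 11 : Prog ι) s₂ (Function.update s₂ 5 (unary (n * (j + 1)))) []
      (7 * n + 2) := by
    refine Does.conv (does_add (by norm_num) (by norm_num) (by norm_num) s₂ n ?_ ?_) ?_ rfl le_rfl
    · simp [hs₂, hs₁, applyState, s0]
    · simp [hs₂, hs₁, applyState, he]
    · congr 1
      simp [hs₂, hs₁, applyState, unary_add]
      congr 1; ring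
  have h₆ : Does (.add 12 6 11 : Prog ι) (Function.update s₂ 5 (unary (n * (j + 1))))
      (applyState s n t a b (j + 1)) [] (7 * a + 2) := by
    refine Does.conv (does_add (by norm_num) (by norm_num) (by norm_num) _ a ?_ ?_) ?_ rfl le_rfl
    · simp [hs₂, hs₁, applyState, s12]
    · simp [hs₂, hs₁, applyState, he]
    · funext q
      by_cases h6 : q = 6
      · subst h6
        simp [hs₂, hs₁, applyState, unary_add]
        congr 1; ring
      by_cases h5 : q = 5
      · subst h5; simp [applyState]
      by_cases h13 : q = 13
      · subst h13; simp [hs₂, applyState]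
      · simp [hs₂, hs₁, applyState, h5, h6, h13]
  refine Does.conv (h₁.seq_nil (h₂.seq_nil (h₃.seq (h₄.seq_nil (h₅.seq_nil h₆))))) rfl
    (List.append_nil _) ?_
  have i1 : n * j ≤ n * t := Nat.mul_le_mul_left _ hj.le
  have i2 : a * j ≤ a * t := Nat.mul_le_mul_left _ hj.le
  have i3 : T * (34 * (n + a) + 18 * (n * j + (b + a * j)) + 15) ≤
      T * (34 * (n + a) + 18 * (n * t + (b + a * t)) + 15) :=
    Nat.mul_le_mul_left _ (by omega)
  omega

/-- Placing a qubit in run j and then making room for the b adversary ancillas amounts to one of two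
constant shifts, chosen by whether it is a system qubit or an ancilla. Since j < t forces n ≤ t·n,
the truncated subtractions are exact. -/
theorem relabelIndex_eq_shift_parallel {n t a b j : ℕ} (hj : j < t) :
    relabelIndex n (n * j) (t * n + b - n + a * j) =
      shiftAncillas (t * n) b ∘ parallelIndex n t a j := by
  funext h
  have h1 : n * (j + 1) ≤ n * t := Nat.mul_le_mul_left _ hj
  have h2 : n ≤ t * n := Nat.le_mul_of_pos_left _ (by omega)
  rw [mul_comm n t] at h1
  change relabelIndex n (n * j) (t * n + b - n + a * j) h =
    shiftAncillas (t * n) b (parallelIndex n t a j h)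
  by_cases hn : h < n
  · have hp : parallelIndex n t a j h = h + n * j := if_pos hn
    have hr : relabelIndex n (n * j) (t * n + b - n + a * j) h = h + n * j := if_pos hn
    rw [hp, hr, shiftAncillas, if_pos]
    rw [mul_add] at h1; omega
  · have hp : parallelIndex n t a j h = h + (t * n - n + a * j) := if_neg hn
    have hr : relabelIndex n (n * j) (t * n + b - n + a * j) h =
      h + (t * n + b - n + a * j) := if_neg hn
    rw [hp, hr, shiftAncillas, if_neg]
    · omega
    · generalize a * j = u at *; omega

/-- The circuit that applies the channel circuit `CG` to all `t` inputs, and then `CA`. -/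
def channelThen (n t a b : ℕ) (CG CA : List (Gate ι ℕ)) : List (Gate ι ℕ) :=
  (parallelCircuit n t a CG).map (Gate.map (shiftAncillas (t * n) b)) ++ CA

/-- The program computes a(n) and the offset t·n + b − n, writes the relabelled channel circuit once
per copy, and finally runs the adversary's program, whose own stacks still show the original input.
-/
theorem uniformCircuits_channelThen {κ m : ℕ → ℕ} {t a b : Polynomial ℕ}
    {CG CA : ℕ → List (Gate ι ℕ)}
    (hG : UniformCircuits (fun n => n) (fun n => [unary n]) (fun n => n + a.eval n) CG)
    (hA : UniformCircuits (fun n => n) (fun n => publicParams κ m n ++ [unary (t.eval n)])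
      (fun n => t.eval n * n + b.eval n) CA) :
    UniformCircuits (fun n => n) (fun n => publicParams κ m n ++ [unary (t.eval n)])
      (fun n => t.eval n * n + (b + t * a).eval n)
      (fun n => channelThen n (t.eval n) (a.eval n) (b.eval n) (CG n) (CA n)) := by
  obtain ⟨PG, pG, hG⟩ := hG
  obtain ⟨PA, pA, hA⟩ := hA
  obtain ⟨Pa, qa, ha⟩ := exists_prog_eval (ι := ι) a (r := 12) (by norm_num) (by norm_num)
    (by norm_num)
  obtain ⟨Pb, qb, hb⟩ := exists_prog_eval (ι := ι) (t * .X + b) (r := 6) (by norm_num)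
    (by norm_num) (by norm_num)
  refine ⟨.seq (.add 0 4 11) (.seq Pa (.seq Pb (.seq (.add 0 13 11)
    (.seq (.loop 13 (.seq (.pop 13) (.pop 6))) (.seq (.add 3 13 11)
    (.seq (.loop 13 PG.applyBody) (PA.rename outerStack))))))),
    (7 * .X + 2) + qa + qb + (7 * .X + 2) + (.X * 3 + 1) + (7 * t + 2) +
    (t * ((1 + (7 * .X + 2) + pG * (34 * (.X + a) + 18 * (.X * t + ((t * .X + b) + a * t)) + 15) +
        ((.C PG.bound + 1) * (2 * (.X + pG) + 1) + 1) + (7 * .X + 2) + (7 * a + 2)) + 1) + 1) + pA,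
    fun n => ⟨?_, ?_⟩⟩
  · obtain ⟨⟨sG, TG, hrG, hTG⟩, hvG⟩ := hG n
    obtain ⟨⟨sA, TA, hrA, hTA⟩, -⟩ := hA n
    dsimp only at hTG hTA
    set l := publicParams κ m n ++ [unary (t.eval n)] with hl
    set s := inputStore l with hs
    have s0 : s 0 = unary n := rfl
    have s3 : s 3 = unary (t.eval n) := rfl
    have hlen : l.length = 4 := rfl
    have se : ∀ q, 4 ≤ q → s q = [] := fun q hq => inputStore_of_le (by omega)
    set s₁ := Function.update s 4 (unary n) with hs₁
    set s₂ := Function.update s₁ 12 (unary (a.eval n)) with hs₂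
    set B := t.eval n * n + b.eval n with hB
    have h₁ : Does (.add 0 4 11 : Prog ι) s s₁ [] (7 * n + 2) := by
      refine Does.conv (does_add (by norm_num) (by norm_num) (by norm_num) s n s0
        (se _ (by norm_num))) ?_ rfl le_rfl
      rw [hs₁, se 4 le_rfl, List.append_nil]
    have h₂ : Does Pa s₁ s₂ [] (qa.eval n) :=
      ha s₁ n (by simp [hs₁, s0]) (by simp [hs₁, se]) (by simp [hs₁, se]) (by simp [hs₁, se])
    have h₃ : Does Pb s₂ (Function.update s₂ 6 (unary B)) [] (qb.eval n) := by
      refine Does.conv (hb s₂ n ?_ ?_ ?_ ?_) ?_ rfl le_rfl <;> simp [hs₂, hs₁, s0, se, hB]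
    have h₄ : Does (.add 0 13 11 : Prog ι) (Function.update s₂ 6 (unary B))
        (Function.update (Function.update s₂ 6 (unary B)) 13 (unary n)) [] (7 * n + 2) := by
      refine Does.conv (does_add (by norm_num) (by norm_num) (by norm_num) _ n ?_ ?_) ?_ rfl le_rfl
        <;> simp [hs₂, hs₁, s0, se]
    -- Stack 13 first serves to subtract n from the ancilla offset. For t = 0 the subtraction may
    -- truncate, but then the loop over the copies is empty.
    have h₅ : Does (.loop 13 (.seq (.pop 13) (.pop 6)) : Prog ι)
        (Function.update (Function.update s₂ 6 (unary B)) 13 (unary n))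
        (Function.update s₂ 6 (unary (B - n))) [] (n * 3 + 1) := by
      refine Does.conv (Does.loop_range n (fun i => Function.update (Function.update s₂ 6
        (unary (B - i))) 13 (unary (n - i))) (fun _ => []) ?_ ?_ ?_) ?_ (by simp) le_rfl
      · intro i hi
        simp [unary]; omega
      · intro i hi
        refine (Does.pop 13 rfl).seq_nil (Does.pop 6 ?_)
        funext q
        by_cases h6 : q = 6
        · subst h6; simp [unary_tail]; congr 1
        by_cases h13 : q = 13
        · subst h13; simp [unary_tail]; congr 1
        · simp [h6, h13]
      · simp [unary]
      · funext q
        by_cases h13 : q = 13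
        · subst h13; simp [unary, hs₂, hs₁, se]
        · simp [h13]
    have h₆ : Does (.add 3 13 11 : Prog ι) (Function.update s₂ 6 (unary (B - n)))
        (applyState s₂ n (t.eval n) (a.eval n) (B - n) 0) [] (7 * t.eval n + 2) := by
      refine Does.conv (does_add (by norm_num) (by norm_num) (by norm_num) _ (t.eval n) ?_ ?_) ?_
        rfl le_rfl
      · simp [hs₂, hs₁, s3]
      · simp [hs₂, hs₁, se]
      · funext q
        by_cases h13 : q = 13
        · subst h13; simp [applyState, hs₂, hs₁, se]
        by_cases h6 : q = 6
        · subst h6; simp [applyState]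
        by_cases h5 : q = 5
        · subst h5; simp [applyState, unary, hs₂, hs₁, se]
        · simp [applyState, h13, h6, h5]
    have h₇ : Does (.loop 13 PG.applyBody) (applyState s₂ n (t.eval n) (a.eval n) (B - n) 0)
        (applyState s₂ n (t.eval n) (a.eval n) (B - n) (t.eval n))
        ((parallelCircuit n (t.eval n) (a.eval n) (CG n)).map
          (Gate.map (shiftAncillas (t.eval n * n) (b.eval n))))
        (t.eval n * ((1 + (7 * n + 2) + TG * (34 * (n + a.eval n) + 18 * (n * t.eval n +
          ((B - n) + a.eval n * t.eval n)) + 15) +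
          ((PG.bound + 1) * (2 * (n + TG) + 1) + 1) + (7 * n + 2) + (7 * a.eval n + 2)) + 1) + 1) := by
      refine Does.conv (Does.loop_range (t.eval n)
        (applyState s₂ n (t.eval n) (a.eval n) (B - n)) (fun j => (CG n).map (Gate.map
        (relabelIndex n (n * j) (B - n + a.eval n * j)))) ?_ ?_ ?_) rfl ?_ le_rfl
      · intro j hj
        simp [applyState, unary]; omega
      · intro j hj
        refine does_applyBody hj hrG hvG ?_ ?_ ?_ ?_ ?_
        · simp [hs₂, hs₁, s0]
        · simp [hs₂, hs₁]
        · simp [hs₂]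
        · simp [hs₂, hs₁, se]
        · intro r
          have h1 : innerStack r ≠ 12 := by unfold innerStack; omega
          have h2 : innerStack r ≠ 4 := by unfold innerStack; omega
          simp only [hs₂, hs₁, Function.update_of_ne h1, Function.update_of_ne h2]
          exact se _ (by unfold innerStack; omega)
      · simp [applyState, unary]
      · rw [parallelCircuit, List.map_flatMap]
        refine List.flatMap_congr fun j hj => ?_
        rw [List.map_map, relabelIndex_eq_shift_parallel (List.mem_range.1 hj)]
        exact List.map_congr_left fun g _ => (Gate.map_map _ _ g).symm
    -- The stacks still holding data from the channel phase (4, 5, 6 and 12) lie outside the range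
    -- of `outerStack`, so the adversary's program sees a clean input store.
    obtain ⟨s₉, h₈, -, -⟩ := hrA.rename outerStack_injective
      (applyState s₂ n (t.eval n) (a.eval n) (B - n) (t.eval n)) (by
        intro r
        have hr := outerStack_free r
        have e : s (outerStack r) = l.getD r [] := inputStore_outerStack hlen.le r
        refine Eq.trans ?_ e
        by_cases h13 : outerStack r = 13
        · rw [h13]; simp [applyState, unary, se]
        by_cases h12 : outerStack r = 12
        · unfold outerStack at h12; split_ifs at h12 <;> omega
        · have h4 : outerStack r ≠ 4 := by omega
          have h5 : outerStack r ≠ 5 := by omega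
          have h6 : outerStack r ≠ 6 := by omega
          simp [applyState, hs₂, hs₁, h13, h12, h4, h5, h6])
    obtain ⟨T, hT, hR⟩ := h₁.seq_nil (h₂.seq_nil (h₃.seq_nil (h₄.seq_nil (h₅.seq_nil
      (h₆.seq_nil (h₇.seq h₈))))))
    refine ⟨_, T, hR, hT.trans ?_⟩
    simp only [Polynomial.eval_add, Polynomial.eval_mul, Polynomial.eval_X, Polynomial.eval_C,
      Polynomial.eval_ofNat, Polynomial.eval_one, ← hB]
    have i1 : TG * (34 * (n + a.eval n) + 18 * (n * t.eval n + ((B - n) + a.eval n * t.eval n)) +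
        15) ≤ pG.eval n * (34 * (n + a.eval n) + 18 * (n * t.eval n +
        (B + a.eval n * t.eval n)) + 15) := by
      refine Nat.mul_le_mul hTG ?_
      omega
    have i2 : (PG.bound + 1) * (2 * (n + TG) + 1) ≤ (PG.bound + 1) * (2 * (n + pG.eval n) + 1) :=
      Nat.mul_le_mul_left _ (by omega)
    have i3 := Nat.mul_le_mul_left (t.eval n) (show
      1 + (7 * n + 2) + TG * (34 * (n + a.eval n) + 18 * (n * t.eval n +
          ((B - n) + a.eval n * t.eval n)) + 15) +
          ((PG.bound + 1) * (2 * (n + TG) + 1) + 1) + (7 * n + 2) + (7 * a.eval n + 2) + 1 ≤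
      1 + (7 * n + 2) + pG.eval n * (34 * (n + a.eval n) + 18 * (n * t.eval n +
          (B + a.eval n * t.eval n)) + 15) +
          ((PG.bound + 1) * (2 * (n + pG.eval n) + 1) + 1) + (7 * n + 2) + (7 * a.eval n + 2) + 1
      by omega)
    omega
  · intro g hg
    simp only [Polynomial.eval_add, Polynomial.eval_mul]
    simp only [channelThen, List.mem_append, List.mem_map] at hg
    rcases hg with ⟨g, hg, rfl⟩ | hg
    · exact (parallelCircuit_valid (hG n).2 g hg).map (renames_shiftAncillas _ _ _)
    · exact ((hA n).2 g hg).mono (by dsimp only; omega)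

/-- The circuit that runs `CP` and then `CG` on the same qubits, with `a` ancillas for `CG`. -/
def prepareThen (n a : ℕ) (CP CG : List (Gate ι ℕ)) : List (Gate ι ℕ) :=
  CP.map (Gate.map (shiftAncillas n a)) ++ CG

/-- Here system qubits stay in place and only the ancillas of the preparation move, which is
relabelling with shifts 0 and a(n). The input of the channel program is put on stack 101 beforehand,
where the preparation program cannot touch it. -/
theorem uniformCircuits_prepareThen {κ m : ℕ → ℕ} {a b : Polynomial ℕ}
    {CG : ℕ → List (Gate ι ℕ)} {CP : (Σ n : ℕ, Fin (κ n) → Bool) → List (Gate ι ℕ)}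
    (hP : UniformCircuits (fun x => x.1) (fun x => publicParams κ m x.1 ++ [List.ofFn x.2])
      (fun x => x.1 + b.eval x.1) CP)
    (hG : UniformCircuits (fun n => n) (fun n => [unary n]) (fun n => n + a.eval n) CG) :
    UniformCircuits (fun x => x.1) (fun x => publicParams κ m x.1 ++ [List.ofFn x.2])
      (fun x => x.1 + (a + b).eval x.1)
      (fun x => prepareThen x.1 (a.eval x.1) (CP x) (CG x.1)) := by
  obtain ⟨PG, pG, hG⟩ := hG
  obtain ⟨PP, pP, hP⟩ := hP
  obtain ⟨Pa, qa, ha⟩ := exists_prog_eval (ι := ι) a (r := 6) (by norm_num) (by norm_num)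
    (by norm_num)
  refine ⟨.seq (.add 0 4 11) (.seq Pa (.seq (.add 0 101 11)
    (.seq (PP.transform outerStack (Prog.emitIndexed outerStack)) (PG.rename innerStack)))),
    (7 * .X + 2) + qa + (7 * .X + 2) + pP * (34 * (.X + b) + 18 * a + 15) + pG,
    fun x => ⟨?_, ?_⟩⟩
  · obtain ⟨n, k⟩ := x
    obtain ⟨⟨sG, TG, hrG, hTG⟩, -⟩ := hG n
    obtain ⟨⟨sP, TP, hrP, hTP⟩, hvP⟩ := hP ⟨n, k⟩
    dsimp only at hTG hrG hrP hTP hvP ⊢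
    set l := publicParams κ m n ++ [List.ofFn k] with hl
    set s := inputStore l with hs
    have s0 : s 0 = unary n := rfl
    have hlen : l.length = 4 := rfl
    have se : ∀ q, 4 ≤ q → s q = [] := fun q hq => inputStore_of_le (by omega)
    set s₁ := Function.update s 4 (unary n) with hs₁
    set s₂ := Function.update s₁ 6 (unary (a.eval n)) with hs₂
    set s₃ := Function.update s₂ 101 (unary n) with hs₃
    have h₁ : Does (.add 0 4 11 : Prog ι) s s₁ [] (7 * n + 2) := by
      refine Does.conv (does_add (by norm_num) (by norm_num) (by norm_num) s n s0
        (se _ (by norm_num))) ?_ rfl le_rfl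
      rw [hs₁, se 4 le_rfl, List.append_nil]
    have h₂ : Does Pa s₁ s₂ [] (qa.eval n) :=
      ha s₁ n (by simp [hs₁, s0]) (by simp [hs₁, se]) (by simp [hs₁, se]) (by simp [hs₁, se])
    have h₃ : Does (.add 0 101 11 : Prog ι) s₂ s₃ [] (7 * n + 2) := by
      refine Does.conv (does_add (by norm_num) (by norm_num) (by norm_num) _ n ?_ ?_) ?_ rfl le_rfl
        <;> simp [hs₃, hs₂, hs₁, s0, se]
    have hr : IndexReady s₃ n 0 (a.eval n) := by
      refine ⟨?_, ?_, ?_, ?_, ?_, ?_⟩ <;> simp [hs₃, hs₂, hs₁, se, unary]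
    obtain ⟨s₄, h₄, -, f₄⟩ := hrP.relabel outerStack_injective outerStack_free hvP hr
      (by simp [hs₃, hs₂, hs₁, se]) (by simp [hs₃, hs₂, hs₁, se]) (by
        intro r
        refine Eq.trans ?_ (inputStore_outerStack hlen.le r)
        have hr := outerStack_free r
        have h4 : outerStack r ≠ 4 := by omega
        have h6 : outerStack r ≠ 6 := by omega
        have h101 : outerStack r ≠ 101 := by unfold outerStack; split_ifs <;> omega
        simp only [hs₃, hs₂, hs₁, ne_eq, h4, h6, h101, not_false_eq_true, Function.update_of_ne]
        rfl)
    obtain ⟨s₅, h₅, -, -⟩ := hrG.rename innerStack_injective s₄ (by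
        intro r
        rw [f₄]
        · by_cases h0 : r = 0
          · subst h0; simp [hs₃, innerStack, inputStore]
          · rw [inputStore_of_le (by simp; omega)]
            have h4 : innerStack r ≠ 4 := by unfold innerStack; omega
            have h6 : innerStack r ≠ 6 := by unfold innerStack; omega
            have h101 : innerStack r ≠ 101 := by unfold innerStack; omega
            simp only [hs₃, hs₂, hs₁, Function.update_of_ne h4, Function.update_of_ne h6,
              Function.update_of_ne h101]
            exact se _ (by unfold innerStack; omega)
        · rintro ⟨q, hq⟩
          unfold innerStack outerStack at hq
          split_ifs at hq <;> omega)
    obtain ⟨T, hT, hR⟩ := h₁.seq_nil (h₂.seq_nil (h₃.seq_nil (h₄.seq h₅)))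
    have e : relabelIndex n 0 (a.eval n) = shiftAncillas n (a.eval n) := by
      funext h; simp [relabelIndex, shiftAncillas]
    rw [e] at hR
    refine ⟨_, T, hR, hT.trans ?_⟩
    simp only [Polynomial.eval_add, Polynomial.eval_mul, Polynomial.eval_X,
      Polynomial.eval_ofNat]
    have i1 : TP * (34 * (n + b.eval n) + 18 * (0 + a.eval n) + 15) ≤
        pP.eval n * (34 * (n + b.eval n) + 18 * a.eval n + 15) :=
      Nat.mul_le_mul hTP (by omega)
    omega
  · intro g hg
    simp only [Polynomial.eval_add]
    simp only [prepareThen, List.mem_append, List.mem_map] at hg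
    rcases hg with ⟨g, hg, rfl⟩ | hg
    · exact ((hP x).2 g hg).map (renames_shiftAncillas _ _ _)
    · exact ((hG x.1).2 g hg).mono (by dsimp only; omega)

end

/-! ## Negligible functions -/

theorem Negligible.mono_of_lt {f g : ℕ → ℝ} (hg : Negligible g) (N : ℕ) (h : ∀ n > N, f n ≤ g n) :
    Negligible f := by
  intro c
  obtain ⟨n₀, hn₀⟩ := hg c
  refine ⟨max n₀ N, fun n hn => ?_⟩
  exact (h n (lt_of_le_of_lt (le_max_right _ _) hn)).trans_lt
    (hn₀ n (lt_of_le_of_lt (le_max_left _ _) hn))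

theorem Negligible.add {f g : ℕ → ℝ} (hf : Negligible f) (hg : Negligible g) :
    Negligible fun n => f n + g n := by
  intro c
  obtain ⟨n₀, hn₀⟩ := hf (c + 1)
  obtain ⟨n₁, hn₁⟩ := hg (c + 1)
  refine ⟨max (max n₀ n₁) 1, fun n hn => ?_⟩
  simp only [gt_iff_lt, max_lt_iff] at hn
  have h2 : (2 : ℝ) ≤ n := by exact_mod_cast hn.2
  have h0 : (0 : ℝ) < (n : ℝ) ^ c := by positivity
  have h3 : ((n : ℝ) ^ (c + 1))⁻¹ ≤ ((n : ℝ) ^ c)⁻¹ / 2 := by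
    rw [pow_succ, mul_inv, div_eq_mul_inv]
    gcongr
  linarith [hn₀ n hn.1.1, hn₁ n hn.1.2]

theorem exists_eval_le_pow (p : Polynomial ℕ) : ∃ d : ℕ, ∀ n ≥ 2, p.eval n ≤ n ^ d := by
  induction p using Polynomial.recOnHorner with
  | M0 => exact ⟨0, fun n _ => by simp⟩
  | MC p a _ _ ih =>
    obtain ⟨d, hd⟩ := ih
    refine ⟨d + a + 1, fun n hn => ?_⟩
    have h1 : n ^ d ≤ n ^ (d + a) := Nat.pow_le_pow_right (by omega) (by omega)
    have h2 : a ≤ n ^ (d + a) :=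
      (Nat.lt_pow_self (by omega)).le.trans (Nat.pow_le_pow_right (by omega) (Nat.le_add_left a d))
    have h3 : n ^ (d + a) * 2 ≤ n ^ (d + a + 1) := by
      rw [pow_succ]; exact Nat.mul_le_mul_left _ hn
    have := hd n hn
    simp only [Polynomial.eval_add, Polynomial.eval_C]
    omega
  | MX p _ ih =>
    obtain ⟨d, hd⟩ := ih
    refine ⟨d + 1, fun n hn => ?_⟩
    simp only [Polynomial.eval_mul, Polynomial.eval_X, pow_succ]
    exact Nat.mul_le_mul_right _ (hd n hn)

theorem negligible_div_two_pow {m : ℕ → ℕ}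
    (h : (fun n : ℕ => Real.log n) =o[Filter.atTop] (fun n : ℕ => (m n : ℝ))) (p : Polynomial ℕ) :
    Negligible fun n => ((p.eval n : ℕ) : ℝ) / 2 ^ m n := by
  obtain ⟨d, hd⟩ := exists_eval_le_pow p
  intro c
  -- The powers d and c absorb the polynomial and the target n^{-c}; the extra power makes the final
  -- inequality strict.
  set K := d + c + 1 with hK
  have hl : (0 : ℝ) < Real.log 2 := Real.log_pos one_lt_two
  obtain ⟨n₀, hn₀⟩ := Filter.eventually_atTop.1
    (h.bound (c := Real.log 2 / K) (by positivity))
  refine ⟨max n₀ 1, fun n hn => ?_⟩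
  simp only [gt_iff_lt, max_lt_iff] at hn
  have h2 : (2 : ℝ) ≤ n := by exact_mod_cast hn.2
  have h1 := hn₀ n hn.1.le
  rw [Real.norm_of_nonneg (Real.log_nonneg (by linarith)), Real.norm_of_nonneg (by positivity),
    div_mul_eq_mul_div, le_div_iff₀ (by positivity)] at h1
  have h3 : (n : ℝ) ^ K ≤ 2 ^ m n := by
    rw [← Real.log_le_log_iff (by positivity) (by positivity), Real.log_pow, Real.log_pow]
    linarith
  have h4 : ((p.eval n : ℕ) : ℝ) ≤ (n : ℝ) ^ d := by exact_mod_cast hd n (by omega)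
  have h5 : (n : ℝ) ^ d * n ^ c < (n : ℝ) ^ K := by
    rw [hK, ← pow_add]
    exact pow_lt_pow_right₀ (by linarith) (by omega)
  rw [div_lt_iff₀ (by positivity), inv_mul_eq_div, lt_div_iff₀ (by positivity)]
  calc ((p.eval n : ℕ) : ℝ) * n ^ c ≤ n ^ d * n ^ c := by gcongr
    _ < n ^ K := h5
    _ ≤ _ := h3

/-- For each c, negligibility with exponent c + 1 gives n^c ≤ 2^m eventually, the spare factor n
absorbing r. Taking logarithms with c > log 2 / ε gives log n ≤ ε·m. -/
theorem isLittleO_log_of_negligible {m : ℕ → ℕ} {r : ℝ} (hr : 0 < r)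
    (h : Negligible fun n => r / 2 ^ m n) :
    (fun n : ℕ => Real.log n) =o[Filter.atTop] (fun n : ℕ => (m n : ℝ)) := by
  have hl : (0 : ℝ) < Real.log 2 := Real.log_pos one_lt_two
  refine Asymptotics.IsLittleO.of_bound fun ε hε => ?_
  obtain ⟨c, hc⟩ := exists_nat_gt (Real.log 2 / ε)
  have hc0 : (0 : ℝ) < c := lt_trans (by positivity) hc
  obtain ⟨n₀, hn₀⟩ := h (c + 1)
  obtain ⟨n₁, hn₁⟩ := exists_nat_gt (r⁻¹)
  filter_upwards [Filter.eventually_gt_atTop (max (max n₀ n₁) 1)] with n hn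
  simp only [max_lt_iff] at hn
  have h1 : (1 : ℝ) < n := by exact_mod_cast hn.2
  have h2 : r⁻¹ < n := hn₁.trans (by exact_mod_cast hn.1.2)
  have h3 := hn₀ n hn.1.1
  rw [div_lt_iff₀ (by positivity), inv_mul_eq_div, lt_div_iff₀ (by positivity)] at h3
  have h4 : (n : ℝ) ^ c ≤ 2 ^ m n := by
    refine le_trans ?_ h3.le
    rw [pow_succ]
    have : 1 ≤ r * n := by
      rw [← mul_inv_cancel₀ hr.ne']; gcongr
    nlinarith [show (0 : ℝ) < (n : ℝ) ^ c by positivity]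
  rw [← Real.log_le_log_iff (by positivity) (by positivity), Real.log_pow, Real.log_pow] at h4
  rw [Real.norm_of_nonneg (Real.log_nonneg h1.le), Real.norm_of_nonneg (by positivity)]
  have h5 : Real.log 2 ≤ ε * c := by
    rw [div_lt_iff₀ hε] at hc; linarith
  have h6 : c * Real.log n ≤ c * (ε * m n) := by
    calc c * Real.log n ≤ m n * Real.log 2 := h4
      _ ≤ m n * (ε * c) := by gcongr
      _ = _ := by ring
  exact le_of_mul_le_mul_left h6 hc0

/-! ## Noise applied to all copies -/

instance ghse_isProbabilityMeasure (n m : ℕ) : IsProbabilityMeasure (ghse n m) :=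
  Measure.isProbabilityMeasure_map
    (reducedState_continuous.comp continuous_subtype_val).measurable.aemeasurable

section
variable {ι : Type} (𝒢 : ι → Matrix.unitaryGroup Bool ℂ)

theorem acceptProb_channelThen {n t a b : ℕ} {CG CA : List (Gate ι ℕ)}
    (hG : ∀ g ∈ CG, g.Valid (n + a)) (hA : ∀ g ∈ CA, g.Valid (t * n + b)) (h : 0 < t * n + b)
    (σ : QOp n) :
    acceptProb 𝒢 (t * n) (b + t * a) (channelThen n t a b CG CA) (copies n t σ) =
      acceptProb 𝒢 (t * n) b CA (copies n t (circuitChannel 𝒢 n a CG σ)) := by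
  rw [channelThen, acceptProb_comp 𝒢 (parallelCircuit_valid hG) hA _ h,
    circuitChannel_parallelCircuit 𝒢 hG]

theorem copies_zero (n : ℕ) (σ σ' : QOp n) : copies n 0 σ = copies n 0 σ' := by
  ext x y
  simp [copies]

/-- A distinguisher of the noisy keyed states from the noisy ensemble, preceded by the noise on
every copy, is an efficient distinguisher of the original ones. No unitality is involved, so both
directions of the theorem can use this. -/
theorem negligible_advantage_channel {κ m : ℕ → ℕ} {ρ : KeyedFamily κ}
    (hρ : ComputationallyIndistinguishable 𝒢 κ m ρ) {Γ : (n : ℕ) → QOp n → QOp n}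
    (hΓ : EfficientlyImplementable 𝒢 Γ) {t b : Polynomial ℕ} {CA : ℕ → List (Gate ι ℕ)}
    (hA : UniformCircuits (fun n => n) (fun n => publicParams κ m n ++ [unary (t.eval n)])
      (fun n => t.eval n * n + b.eval n) CA) :
    Negligible fun n =>
      |(∑ k, acceptProb 𝒢 (t.eval n * n) (b.eval n) (CA n) (copies n (t.eval n) (Γ n (ρ n k)))) /
          2 ^ κ n -
        ∫ σ, acceptProb 𝒢 (t.eval n * n) (b.eval n) (CA n) (copies n (t.eval n) (Γ n σ))
          ∂(ghse n (m n))| := by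
  obtain ⟨a, CG, hG, hΓ⟩ := hΓ
  refine (hρ t (b + t * a) _ (uniformCircuits_channelThen hG hA)).mono_of_lt 0 fun n hn => ?_
  simp only [hΓ]
  -- Without copies the composition lemma may fail, as the measured qubit need not belong to the
  -- adversary. In that case nothing depends on the state and the left side is zero.
  rcases Nat.eq_zero_or_pos (t.eval n) with h | h
  · rw [h]
    simp only [fun σ => copies_zero n (circuitChannel 𝒢 n (a.eval n) (CG n) σ) 0, integral_const,
      Finset.sum_const]
    simp [advantage]
  · obtain ⟨_, _, h1⟩ := hG
    obtain ⟨_, _, h2⟩ := hA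
    have h0 : 0 < t.eval n * n + b.eval n := Nat.add_pos_left (Nat.mul_pos h hn) _
    simp only [← acceptProb_channelThen 𝒢 (h1 n).2 (h2 n).2 h0]
    simp only [Polynomial.eval_add, Polynomial.eval_mul, advantage, le_refl]

/-- By linearity and unitality the channel fixes the maximally mixed state, so the adversary with
and without noise accepts that state equally often. Each of the two is within 2t²/2^m of this common
value on the ensemble. -/
theorem abs_integral_channel_sub_le {n t a b m : ℕ} {CG CA : List (Gate ι ℕ)}
    (hG : ∀ g ∈ CG, g.Valid (n + a)) (hA : ∀ g ∈ CA, g.Valid (t * n + b)) (hn : 0 < n)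
    (h1 : circuitChannel 𝒢 n a CG 1 = 1) :
    |∫ σ, acceptProb 𝒢 (t * n) b CA (copies n t (circuitChannel 𝒢 n a CG σ)) ∂(ghse n m) -
      ∫ σ, acceptProb 𝒢 (t * n) b CA (copies n t σ) ∂(ghse n m)| ≤ 4 * (t : ℝ) ^ 2 / 2 ^ m := by
  rcases Nat.eq_zero_or_pos t with rfl | h
  · simp only [fun σ => copies_zero n σ 0]
    simp
  · have e := acceptProb_channelThen 𝒢 hG hA (Nat.add_pos_left (Nat.mul_pos h hn) _)
    have h2 := abs_integral_acceptProb_sub_le (n := n) (m := m) (t := t) 𝒢 b CA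
    have h3 := abs_integral_acceptProb_sub_le (n := n) (m := m) (t := t) 𝒢 (b + t * a)
      (channelThen n t a b CG CA)
    simp only [e] at h3
    rw [maxMixed, circuitChannel_smul, h1, ← maxMixed] at h3
    rw [abs_le] at *
    have : 4 * (t : ℝ) ^ 2 / 2 ^ m = 2 * (t : ℝ) ^ 2 / 2 ^ m + 2 * (t : ℝ) ^ 2 / 2 ^ m := by ring
    constructor <;> linarith [h2.1, h2.2, h3.1, h3.2]

/-- Triangle inequality through the noisy ensemble: a reduction to the original adversary bound for
the first step, closeness to the maximally mixed state for the second. -/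
theorem IsPRDM.noiseRobust {κ m : ℕ → ℕ} {ρ : KeyedFamily κ}
    (hm : (fun n : ℕ => Real.log n) =o[Filter.atTop] (fun n : ℕ => (m n : ℝ)))
    {Γ : (n : ℕ) → QOp n → QOp n} (hu : ∀ n, IsUnital n (Γ n))
    (hΓ : EfficientlyImplementable 𝒢 Γ) : NoiseRobust 𝒢 κ m ρ Γ := by
  intro hρ
  refine ⟨hρ.poly_key, ?_, fun t b CA hA => ?_⟩
  · obtain ⟨a, CG, hG, hΓ⟩ := hΓ
    obtain ⟨b, CP, hP, hρ⟩ := hρ.preparable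
    refine ⟨a + b, _, uniformCircuits_prepareThen hP hG, fun n k => ?_⟩
    obtain ⟨_, _, h1⟩ := hG
    obtain ⟨_, _, h2⟩ := hP
    rw [Polynomial.eval_add, prepareThen, circuitChannel_comp 𝒢 (h2 ⟨n, k⟩).2 (h1 n).2, ← hρ, ← hΓ]
  · refine ((negligible_advantage_channel 𝒢 hρ.indistinguishable hΓ hA).add
      (negligible_div_two_pow hm (4 * t ^ 2))).mono_of_lt 0 fun n hn => ?_
    obtain ⟨a, CG, hG, hΓ⟩ := hΓ
    obtain ⟨_, _, h1⟩ := hG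
    obtain ⟨_, _, h2⟩ := hA
    have h3 := abs_integral_channel_sub_le (m := m n) 𝒢 (h1 n).2 (h2 n).2 hn
      ((hΓ n 1).symm.trans (hu n))
    simp only [← hΓ] at h3
    simp only [Polynomial.eval_mul, Polynomial.eval_pow, Polynomial.eval_ofNat, Nat.cast_mul,
      Nat.cast_pow, Nat.cast_ofNat]
    exact (abs_sub_le _ _ _).trans (add_le_add_right h3 _)

end

/-! ## Circuits acting on vectors -/

section
open Matrix
variable {N : ℕ}

theorem onQubit_mulVec (q : Fin N) (u : Matrix Bool Bool ℂ) (v : (Fin N → Bool) → ℂ) :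
    onQubit N q u *ᵥ v = fun X => ∑ b, u (X q) b * v (Function.update X q b) := by
  funext X
  rw [onQubit, dif_pos q.2, mulVec, dotProduct]
  have hinj : Function.Injective fun b => Function.update X q b := Function.update_injective X q
  rw [← Finset.sum_subset (Finset.subset_univ (Finset.univ.map ⟨_, hinj⟩)), Finset.sum_map]
  · refine Finset.sum_congr rfl fun b _ => ?_
    simp only [Matrix.of_apply, Function.Embedding.coeFn_mk, Fin.eta, Function.update_self]
    rw [if_pos]
    intro j hj
    rw [Function.update_of_ne hj]
  · intro Y _ hY
    simp only [Matrix.of_apply, Fin.eta]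
    rw [if_neg, zero_mul]
    intro h
    refine hY (Finset.mem_map.2 ⟨Y q, Finset.mem_univ _, ?_⟩)
    funext j
    by_cases hj : j = q
    · subst hj; simp
    · simpa [hj] using h j hj

theorem cnotMatrix_mulVec {c t : Fin N} (h : c ≠ t) (v : (Fin N → Bool) → ℂ) :
    cnotMatrix N c t *ᵥ v = fun X => v (Function.update X t (xor (X t) (X c))) := by
  funext X
  have h' : (c : ℕ) ≠ t := fun e => h (Fin.ext e)
  rw [cnotMatrix, dif_pos ⟨c.2, t.2, h'⟩, mulVec, dotProduct,
    Finset.sum_eq_single (Function.update X t (xor (X t) (X c)))]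
  · simp [h]
  · intro Y _ hY
    simp only [Matrix.of_apply, Fin.eta]
    rw [if_neg, zero_mul]
    rintro rfl
    refine hY ?_
    simp [h]
  · simp

variable {ι : Type} (𝒢 : ι → Matrix.unitaryGroup Bool ℂ)

theorem circuitMatrix_nil_mulVec (v : (Fin N → Bool) → ℂ) : circuitMatrix 𝒢 N [] *ᵥ v = v :=
  one_mulVec v

theorem circuitMatrix_cons_mulVec (g : Gate ι ℕ) (C : List (Gate ι ℕ)) (v : (Fin N → Bool) → ℂ) :
    circuitMatrix 𝒢 N (g :: C) *ᵥ v = circuitMatrix 𝒢 N C *ᵥ (g.toMatrix 𝒢 N *ᵥ v) :=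
  (mulVec_mulVec v _ _).symm

theorem circuitMatrix_append_mulVec (C D : List (Gate ι ℕ)) (v : (Fin N → Bool) → ℂ) :
    circuitMatrix 𝒢 N (C ++ D) *ᵥ v = circuitMatrix 𝒢 N D *ᵥ (circuitMatrix 𝒢 N C *ᵥ v) := by
  rw [circuitMatrix_append, mulVec_mulVec]

/-- The eighth root of unity `e^{iπ/4}`. -/
def omega8 : ℂ := Complex.exp (Complex.I * (Real.pi / 4 : ℝ))

theorem omega8_pow_four : omega8 ^ 4 = -1 := by
  rw [omega8, ← Complex.exp_nat_mul, ← Complex.exp_pi_mul_I]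
  congr 1
  push_cast
  ring

theorem tgate_mulVec (q : Fin N) (v : (Fin N → Bool) → ℂ) :
    (Gate.tgate (q : ℕ)).toMatrix 𝒢 N *ᵥ v = fun X => (if X q then omega8 else 1) * v X := by
  funext X
  rw [Gate.toMatrix, onQubit_mulVec]
  have e : Function.update X q (X q) = X := Function.update_eq_self q X
  cases h : X q <;> rw [h] at e <;> simp [tMatrix, diagonal, omega8, e, h]

theorem tgates_mulVec (q : Fin N) (k : ℕ) (C : List (Gate ι ℕ)) (v : (Fin N → Bool) → ℂ) :
    circuitMatrix 𝒢 N (List.replicate k (Gate.tgate (q : ℕ)) ++ C) *ᵥ v =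
      circuitMatrix 𝒢 N C *ᵥ fun X => (if X q then omega8 ^ k else 1) * v X := by
  induction k generalizing v with
  | zero => simp
  | succ k ih =>
    rw [List.replicate_succ, List.cons_append, circuitMatrix_cons_mulVec, ih, tgate_mulVec]
    congr 1
    funext X
    cases h : X q <;> simp [h, pow_succ, mul_assoc]

theorem cnot_mulVec {c t : Fin N} (h : c ≠ t) (v : (Fin N → Bool) → ℂ) :
    (Gate.cnot (c : ℕ) t).toMatrix 𝒢 N *ᵥ v =
      fun X => v (Function.update X t (xor (X t) (X c))) := cnotMatrix_mulVec h v

theorem hadamard_mulVec (q : Fin N) (v : (Fin N → Bool) → ℂ) :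
    (Gate.hadamard (q : ℕ)).toMatrix 𝒢 N *ᵥ v = fun X => (v (Function.update X q false) +
      (if X q then -1 else 1) * v (Function.update X q true)) / (Real.sqrt 2 : ℂ) := by
  rw [Gate.toMatrix, onQubit_mulVec]
  funext X
  cases X q <;> simp [hadamardMatrix] <;> ring

/-! ### Controlled swaps -/

/-- The doubly controlled `Z` gate. -/
def ccz {Q : Type} (c a b : Q) : List (Gate ι Q) :=
  List.replicate 1 (.tgate a) ++ (List.replicate 1 (.tgate b) ++ (List.replicate 1 (.tgate c) ++
  (.cnot a b :: (List.replicate 7 (.tgate b) ++ (.cnot c b :: (List.replicate 1 (.tgate b) ++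
  (.cnot a b :: (List.replicate 7 (.tgate b) ++ (.cnot c b :: .cnot a c ::
  (List.replicate 7 (.tgate c) ++ [.cnot a c]))))))))))

/-- For bits, a + b + c − (a⊕b) − (b⊕c) − (a⊕c) + (a⊕b⊕c) = 4abc. The CNOTs produce these parities
in turn, a T gate or its inverse T⁷ adds the phase, and ω⁴ = −1. -/
theorem ccz_mulVec {c a b : Fin N} (hca : c ≠ a) (hcb : c ≠ b) (hab : a ≠ b)
    (v : (Fin N → Bool) → ℂ) :
    circuitMatrix 𝒢 N (ccz (c : ℕ) (a : ℕ) (b : ℕ)) *ᵥ v =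
      fun X => (if X c && X a && X b then -1 else 1) * v X := by
  simp only [ccz, tgates_mulVec, circuitMatrix_cons_mulVec, cnot_mulVec 𝒢 hcb, cnot_mulVec 𝒢 hab,
    cnot_mulVec 𝒢 hca.symm, circuitMatrix_nil_mulVec]
  funext X
  simp only [Function.update_self, Function.update_of_ne hcb, Function.update_of_ne hab,
    Function.update_of_ne hca.symm, Function.update_of_ne hcb.symm]
  have e : ∀ Y, Y = X → v Y = v X := fun Y h => h ▸ rfl
  rw [e _ (by
    funext q
    by_cases h1 : q = b
    · subst h1
      simp only [Function.update_self]
      cases X q <;> cases X c <;> cases X a <;> rfl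
    · by_cases h2 : q = c
      · subst h2; simp [hcb]
      · simp [h1])]
  have h4 := omega8_pow_four
  have h8 : omega8 ^ 8 = 1 := by
    rw [show 8 = 4 * 2 by norm_num, pow_mul, h4]; norm_num
  have h16 : omega8 ^ 16 = 1 := by
    rw [show 16 = 8 * 2 by norm_num, pow_mul, h8]; norm_num
  have h4' : omega8 * omega8 * omega8 * omega8 = -1 := by rw [← h4]; ring
  simp only [← mul_assoc]
  congr 1
  cases X a <;> cases X b <;> cases X c <;> norm_num [← pow_add, ← pow_succ, ← pow_succ', h4, h4', h8, h16]

/-- Conjugating the target by Hadamards turns the controlled phase flip into a controlled bit flip.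
-/
theorem toffoli_mulVec {c a b : Fin N} (hca : c ≠ a) (hcb : c ≠ b) (hab : a ≠ b)
    (v : (Fin N → Bool) → ℂ) :
    circuitMatrix 𝒢 N (.hadamard (b : ℕ) :: (ccz (c : ℕ) (a : ℕ) (b : ℕ) ++
      [.hadamard (b : ℕ)])) *ᵥ v =
      fun X => v (Function.update X b (xor (X b) (X c && X a))) := by
  simp only [circuitMatrix_cons_mulVec, circuitMatrix_append_mulVec, ccz_mulVec 𝒢 hca hcb hab,
    hadamard_mulVec, circuitMatrix_nil_mulVec]
  funext X
  simp only [Function.update_self, Function.update_of_ne hcb,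
    Function.update_of_ne hab, Function.update_idem, Bool.and_false, Bool.and_true]
  have h2 : ((Real.sqrt 2 : ℝ) : ℂ) * (Real.sqrt 2 : ℝ) = 2 := by
    rw [← Complex.ofReal_mul, Real.mul_self_sqrt (by norm_num)]; simp
  have h0 : ((Real.sqrt 2 : ℝ) : ℂ) ≠ 0 := by
    intro h; rw [h] at h2; norm_num at h2
  cases X a <;> cases X b <;> cases X c <;> simp <;> field_simp <;>
    rw [pow_two, h2] <;> ring

/-- The controlled swap. -/
def cswap {Q : Type} (c a b : Q) : List (Gate ι Q) :=
  .cnot b a :: ((.hadamard b :: (ccz c a b ++ [.hadamard b])) ++ [.cnot b a])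

/-- A swap is three CNOTs; controlling only the middle one suffices, since the outer two cancel when
the control is 0. -/
theorem cswap_mulVec {c a b : Fin N} (hca : c ≠ a) (hcb : c ≠ b) (hab : a ≠ b)
    (v : (Fin N → Bool) → ℂ) :
    circuitMatrix 𝒢 N (cswap (c : ℕ) (a : ℕ) (b : ℕ)) *ᵥ v =
      fun X => v (if X c then X ∘ Equiv.swap a b else X) := by
  rw [cswap, circuitMatrix_cons_mulVec, circuitMatrix_append_mulVec, toffoli_mulVec 𝒢 hca hcb hab,
    circuitMatrix_cons_mulVec, circuitMatrix_nil_mulVec, cnot_mulVec 𝒢 hab.symm,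
    cnot_mulVec 𝒢 hab.symm]
  funext X
  simp only [Function.update_self, Function.update_of_ne hca, Function.update_of_ne hab,
    Function.update_of_ne hab.symm]
  congr 1
  funext q
  by_cases h1 : q = a
  · subst h1
    cases h : X c
    · simp
    · simp
  by_cases h2 : q = b
  · subst h2
    cases h : X c
    · simp [h1]
    · simp only [h1, ne_eq, not_false_eq_true, Function.update_of_ne, Function.update_self,
        if_true, Function.comp, Equiv.swap_apply_right, Bool.true_and]
      cases X q <;> cases X a <;> rfl
  · rw [Function.update_of_ne h1, Function.update_of_ne h2, Function.update_of_ne h1]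
    split_ifs
    · rw [Function.comp, Equiv.swap_apply_of_ne_of_ne h1 h2]
    · rfl

end

/-! ## Circuits with one block for each qubit of the input -/

/-- The qubits `i`, `n + i`, `2 * n` and `0`. -/
def blockQubit (n i : ℕ) : Fin 4 → ℕ := ![i, n + i, 2 * n, 0]

section
variable {ι : Type}

/-- The circuit `pre`, followed by a block for each `i < n` and by `post`. -/
def blockCircuit (pre body post : List (Gate ι (Fin 4))) (n : ℕ) : List (Gate ι ℕ) :=
  if n = 0 then [] else pre.map (Gate.map (blockQubit n 0)) ++
    ((List.range n).flatMap (fun i => body.map (Gate.map (blockQubit n i))) ++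
      post.map (Gate.map (blockQubit n n)))

/-- Write a list of gates. -/
def Prog.emits : List (Gate ι ℕ) → Prog ι
  | [] => .skip
  | g :: C => .seq (.emit g) (.emits C)

theorem does_emits (C : List (Gate ι ℕ)) (s : Store) :
    Does (Prog.emits C) s s (C.map fun g => g.map fun r => (s r).length) (C.length + 1) := by
  induction C with
  | nil => exact Does.skip
  | cons g C ih => exact ((Does.emit g).seq ih).mono (by simp; omega)

/-- The stacks that hold the numbers of the qubits of a block. -/
def blockStack : Fin 4 → ℕ := ![4, 5, 7, 8]

/-- The program for `blockCircuit`. -/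
def Prog.block (pre body post : List (Gate ι (Fin 4))) : Prog ι :=
  .branch 0 (.seq (.add 0 5 11) (.seq (.add 0 6 11) (.seq (.add 0 7 11) (.seq (.add 0 7 11)
    (.seq (.emits (pre.map (Gate.map blockStack)))
    (.seq (.loop 6 (.seq (.pop 6) (.seq (.emits (body.map (Gate.map blockStack)))
      (.seq (.push 4 true) (.push 5 true))))) (.emits (post.map (Gate.map blockStack))))))))) .skip

/-- The stacks after `i` blocks. -/
def blockState (s : Store) (n i : ℕ) : Store :=
  Function.update (Function.update (Function.update (Function.update s 7 (unary (2 * n))) 6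
    (unary (n - i))) 5 (unary (n + i))) 4 (unary i)

theorem does_blockEmits {s : Store} {n i : ℕ} (h4 : s 4 = unary i) (h5 : s 5 = unary (n + i))
    (h7 : s 7 = unary (2 * n)) (h8 : s 8 = []) (C : List (Gate ι (Fin 4))) :
    Does (Prog.emits (C.map (Gate.map blockStack))) s s (C.map (Gate.map (blockQubit n i)))
      (C.length + 1) := by
  refine Does.conv (does_emits _ _) rfl ?_ (by simp)
  rw [List.map_map]
  refine List.map_congr_left fun g _ => ?_
  rw [Function.comp, Gate.map_map]
  congr 1
  funext q
  fin_cases q <;> simp [blockStack, blockQubit, unary, h4, h5, h7, h8]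

/-- Stacks 4, 5, 7 have heights i, n + i, 2n, and stack 8 stays empty to name qubit 0; stack 6 is
the loop counter. The initial test of stack 0 catches n = 0, where the four qubit names collapse and
the circuit is empty by convention. -/
theorem uniformCircuits_block {pre body post : List (Gate ι (Fin 4))}
    {input : ℕ → List (List Bool)} {width : ℕ → ℕ} (hlen : ∀ n, (input n).length ≤ 4)
    (h0 : ∀ n, (input n).getD 0 [] = unary n)
    (hv : ∀ n, ∀ g ∈ blockCircuit pre body post n, g.Valid (width n)) :
    UniformCircuits (fun n => n) input width (blockCircuit pre body post) := by
  refine ⟨.block pre body post, (7 * .X + 2) + (7 * .X + 2) + (7 * .X + 2) + (7 * .X + 2) +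
    .C (pre.length + 1) + (.X * .C (body.length + 5) + 1) + .C (post.length + 1) + 2,
    fun n => ⟨?_, hv n⟩⟩
  set s := inputStore (input n) with hs
  have s0 : s 0 = unary n := h0 n
  have se : ∀ q, 4 ≤ q → s q = [] := fun q hq => inputStore_of_le ((hlen n).trans hq)
  suffices H : ∃ s', Does (.block pre body post) s s' (blockCircuit pre body post n)
      ((7 * n + 2) + (7 * n + 2) + (7 * n + 2) + (7 * n + 2) +
    (pre.length + 1) + (n * (body.length + 5) + 1) + (post.length + 1) + 2) by
    obtain ⟨s', T, hT, hR⟩ := H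
    exact ⟨s', T, hR, hT.trans (by simp)⟩
  rcases Nat.eq_zero_or_pos n with hn | hn
  · refine ⟨s, ?_⟩
    rw [blockCircuit, if_pos hn]
    refine (Does.branch_false ?_ Does.skip).mono (by omega)
    rw [s0, hn]; simp [unary]
  have h₁ : Does (.add 0 5 11 : Prog ι) s (Function.update s 5 (unary n)) [] (7 * n + 2) := by
    refine Does.conv (does_add (by norm_num) (by norm_num) (by norm_num) _ n s0
      (se _ (by norm_num))) ?_ rfl le_rfl
    rw [se 5 (by norm_num), List.append_nil]
  have h₂ : Does (.add 0 6 11 : Prog ι) (Function.update s 5 (unary n))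
      (Function.update (Function.update s 5 (unary n)) 6 (unary n)) [] (7 * n + 2) := by
    refine Does.conv (does_add (by norm_num) (by norm_num) (by norm_num) _ n ?_ ?_) ?_ rfl le_rfl
      <;> simp [s0, se]
  have h₃ : Does (.add 0 7 11 : Prog ι)
      (Function.update (Function.update s 5 (unary n)) 6 (unary n))
      (Function.update (Function.update (Function.update s 5 (unary n)) 6 (unary n)) 7 (unary n))
      [] (7 * n + 2) := by
    refine Does.conv (does_add (by norm_num) (by norm_num) (by norm_num) _ n ?_ ?_) ?_ rfl le_rfl
      <;> simp [s0, se]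
  have h₄ : Does (.add 0 7 11 : Prog ι)
      (Function.update (Function.update (Function.update s 5 (unary n)) 6 (unary n)) 7 (unary n))
      (blockState s n 0) [] (7 * n + 2) := by
    refine Does.conv (does_add (by norm_num) (by norm_num) (by norm_num) _ n ?_ ?_) ?_ rfl le_rfl
    · simp [s0]
    · simp [se]
    · funext q
      by_cases h7 : q = 7
      · subst h7; simp [blockState, unary_add, two_mul]
      by_cases h6 : q = 6
      · subst h6; simp [blockState]
      by_cases h5 : q = 5
      · subst h5; simp [blockState]
      by_cases h4 : q = 4
      · subst h4; simp [blockState, unary, se]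
      · simp [blockState, h7, h6, h5, h4]
  have s8 : s 8 = [] := se _ (by norm_num)
  have h₆ : Does (.loop 6 (.seq (.pop 6) (.seq (.emits (body.map (Gate.map blockStack)))
      (.seq (.push 4 true) (.push 5 true))))) (blockState s n 0) (blockState s n n)
      ((List.range n).flatMap fun i => body.map (Gate.map (blockQubit n i)))
      (n * (body.length + 5) + 1) := by
    refine Does.conv (Does.loop_range (k := body.length + 4) n (blockState s n)
      (fun i => body.map (Gate.map (blockQubit n i))) ?_ ?_ ?_) rfl rfl (by simp)
    · intro i hi
      simp [blockState, unary]; omega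
    · intro i hi
      have hp : Does (.pop 6 : Prog ι) (blockState s n i)
          (Function.update (blockState s n i) 6 (unary (n - (i + 1)))) [] 1 :=
        Does.pop 6 (by simp [blockState, unary_tail]; rfl)
      have hb : Does (Prog.emits (body.map (Gate.map blockStack)))
          (Function.update (blockState s n i) 6 (unary (n - (i + 1))))
          (Function.update (blockState s n i) 6 (unary (n - (i + 1))))
          (body.map (Gate.map (blockQubit n i))) (body.length + 1) := by
        apply does_blockEmits <;> simp [blockState, s8]
      have hq : Does (.seq (.push 4 true) (.push 5 true) : Prog ι)
          (Function.update (blockState s n i) 6 (unary (n - (i + 1)))) (blockState s n (i + 1))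
          [] 2 := by
        refine (Does.push 4 true rfl).seq_nil (Does.push 5 true ?_)
        funext q
        by_cases h5 : q = 5
        · subst h5; simp [blockState, unary_succ, ← add_assoc]
        by_cases h4 : q = 4
        · subst h4; simp [blockState, unary_succ]
        by_cases h6 : q = 6
        · subst h6; simp [blockState]
        · simp [blockState, h6, h5, h4]
      refine Does.conv (hp.seq_nil (hb.seq hq)) rfl (by simp) (by omega)
    · simp [blockState, unary]
  refine ⟨blockState s n n, ?_⟩
  rw [blockCircuit, if_neg hn.ne']
  have hpre : Does (Prog.emits (pre.map (Gate.map blockStack))) (blockState s n 0)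
      (blockState s n 0) (pre.map (Gate.map (blockQubit n 0))) (pre.length + 1) := by
    apply does_blockEmits <;> simp [blockState, s8]
  have hpost : Does (Prog.emits (post.map (Gate.map blockStack))) (blockState s n n)
      (blockState s n n) (post.map (Gate.map (blockQubit n n))) (post.length + 1) := by
    apply does_blockEmits <;> simp [blockState, s8]
  refine (Does.branch_true ?_ (h₁.seq_nil (h₂.seq_nil (h₃.seq_nil (h₄.seq_nil
    (hpre.seq (h₆.seq hpost))))))).mono (by omega)
  rw [s0]
  obtain ⟨k, rfl⟩ := Nat.exists_eq_succ_of_ne_zero hn.ne'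
  rfl

end

/-! ## The dephasing channel -/

section
open Matrix
variable {ι : Type} (𝒢 : ι → Matrix.unitaryGroup Bool ℂ)

/-- The circuit that copies all `n` qubits to ancillas. -/
def dephasingCircuit (ι : Type) (n : ℕ) : List (Gate ι ℕ) := blockCircuit [] [.cnot 0 1] [] n

theorem dephasingCircuit_eq (n : ℕ) :
    dephasingCircuit ι n = (List.range n).flatMap fun i => [.cnot i (n + i)] := by
  rw [dephasingCircuit, blockCircuit]
  split_ifs with h
  · subst h; rfl
  · simp [Gate.map, blockQubit]

theorem dephasingCircuit_valid (n : ℕ) : ∀ g ∈ dephasingCircuit ι n, g.Valid (n + n) := by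
  intro g hg
  rw [dephasingCircuit_eq] at hg
  simp only [List.mem_flatMap, List.mem_range, List.mem_singleton] at hg
  obtain ⟨i, hi, rfl⟩ := hg
  refine ⟨?_, ?_, ?_⟩ <;> omega

/-- Add the first `k` of `n` qubits to the next `n`. -/
def addQubits (n k : ℕ) (X : Fin (n + n) → Bool) (q : Fin (n + n)) : Bool :=
  if n ≤ q ∧ q < n + k then xor (X q) (X ⟨q - n, (Nat.sub_le _ _).trans_lt q.2⟩) else X q

theorem dephasing_mulVec (n : ℕ) {k : ℕ} (hk : k ≤ n) (v : (Fin (n + n) → Bool) → ℂ) :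
    circuitMatrix 𝒢 (n + n) ((List.range k).flatMap fun i => [.cnot i (n + i)]) *ᵥ v =
      fun X => v (addQubits n k X) := by
  induction k with
  | zero =>
    rw [List.range_zero, List.flatMap_nil, circuitMatrix_nil_mulVec]
    funext X
    congr 1
    funext q
    rw [addQubits, if_neg (by omega)]
  | succ k ih =>
    have hne : (⟨k, by omega⟩ : Fin (n + n)) ≠ ⟨n + k, by omega⟩ := by
      rw [Ne, Fin.mk.injEq]; omega
    rw [List.range_succ, List.flatMap_append, circuitMatrix_append_mulVec, ih (by omega),
      List.flatMap_singleton, circuitMatrix_cons_mulVec, circuitMatrix_nil_mulVec]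
    refine (cnot_mulVec 𝒢 hne _).trans ?_
    funext X
    congr 1
    funext q
    have hs : (⟨n + k - n, by omega⟩ : Fin (n + n)) = ⟨k, by omega⟩ := by
      rw [Fin.mk.injEq]; omega
    by_cases hq : q = ⟨n + k, by omega⟩
    · subst hq
      rw [addQubits, if_neg (by simp), addQubits, if_pos (by simp), Function.update_self]
      simp only [hs]
    · have hq' : (q : ℕ) ≠ n + k := fun h => hq (Fin.ext h)
      simp only [addQubits]
      rw [Function.update_of_ne hq]
      refine if_congr (by omega) ?_ rfl
      by_cases h : (q : ℕ) < n + n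
      · rw [Function.update_of_ne]
        rw [Ne, Fin.mk.injEq]; omega
      · omega

/-- The ancillas end up holding a copy of the basis state, so finding z in them projects onto |z⟩.
-/
theorem krausOp_dephasingCircuit (n : ℕ) (z : Fin n → Bool) :
    krausOp 𝒢 n n (dephasingCircuit ι n) z = Matrix.diagonal fun x => if z = x then 1 else 0 := by
  ext x y
  have h := congrFun (dephasing_mulVec 𝒢 n le_rfl (Pi.single (Fin.append y fun _ => false) 1))
    (Fin.append x z)
  rw [← dephasingCircuit_eq, mulVec_single_one] at h
  rw [krausOp, Matrix.of_apply]
  refine h.trans ?_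
  have e : addQubits n n (Fin.append x z) = Fin.append x fun i => xor (z i) (x i) := by
    funext q
    refine Fin.addCases (fun i => ?_) (fun i => ?_) q
    · rw [addQubits, if_neg (by simp)]; simp
    · rw [addQubits, if_pos (by simp)]
      simp only [Fin.append_right]
      congr 1
      have : (⟨(Fin.natAdd n i : Fin (n + n)) - n, (Nat.sub_le _ _).trans_lt (Fin.natAdd n i).2⟩ :
          Fin (n + n)) = Fin.castAdd n i := by ext; simp
      rw [this, Fin.append_left]
  rw [e, Pi.single_apply, Matrix.diagonal_apply]
  simp only [append_inj]
  by_cases h : x = y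
  · subst h
    have : ((fun i => xor (z i) (x i)) = fun _ => false) ↔ z = x := by
      simp [funext_iff]
    simp [this]
  · simp [h]

theorem circuitChannel_dephasingCircuit (n : ℕ) (σ : QOp n) :
    circuitChannel 𝒢 n n (dephasingCircuit ι n) σ = Matrix.diagonal σ.diag := by
  rw [circuitChannel_eq_sum]
  simp only [krausOp_dephasingCircuit, diagonal_conjTranspose]
  ext x y
  rw [Matrix.sum_apply]
  simp only [Matrix.mul_diagonal, Matrix.diagonal_mul]
  by_cases h : x = y
  · subst h
    simp
  · rw [Matrix.diagonal_apply_ne _ h]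
    refine Finset.sum_eq_zero fun z _ => ?_
    by_cases hz : z = x
    · subst hz; simp [h]
    · simp [hz]

theorem efficientlyImplementable_dephasing :
    EfficientlyImplementable 𝒢 fun _ σ => Matrix.diagonal σ.diag := by
  refine ⟨.X, dephasingCircuit ι, ?_, fun n σ => ?_⟩
  · refine uniformCircuits_block (by simp) (by simp) fun n => ?_
    rw [Polynomial.eval_X]
    exact dephasingCircuit_valid n
  · rw [Polynomial.eval_X, circuitChannel_dephasingCircuit]

/-- The dephasing circuit consists of CNOTs only, so a Kraus form can be read off with an empty set
of extra gates. -/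
theorem isQuantumChannel_dephasing (n : ℕ) :
    IsQuantumChannel n fun σ => Matrix.diagonal σ.diag := by
  have h := circuitChannel_isQuantumChannel (fun i : Empty => i.elim) n n (dephasingCircuit Empty n)
  rwa [funext (circuitChannel_dephasingCircuit _ n)] at h

theorem isUnital_dephasing (n : ℕ) : IsUnital n fun σ => Matrix.diagonal σ.diag := by
  ext x y
  simp [Matrix.one_apply, Matrix.diagonal_apply]

/-! ## The swap test -/

/-- The swap test on two registers of `n` qubits. -/
def swapTest (ι : Type) (n : ℕ) : List (Gate ι ℕ) :=
  blockCircuit [.hadamard 2] (cswap 2 0 1) [.hadamard 2, .cnot 3 2, .cnot 2 3] n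

theorem map_cswap {Q Q' : Type} (f : Q → Q') (c a b : Q) :
    (cswap c a b : List (Gate ι Q)).map (Gate.map f) = cswap (f c) (f a) (f b) := by
  simp [cswap, ccz, Gate.map]

theorem cswap_valid {N c a b : ℕ} (hc : c < N) (ha : a < N) (hb : b < N) (hca : c ≠ a)
    (hcb : c ≠ b) (hab : a ≠ b) : ∀ g ∈ (cswap c a b : List (Gate ι ℕ)), g.Valid N := by
  simp [cswap, ccz, Gate.Valid, hc, ha, hb, hcb, hab, hca.symm, hab.symm]

theorem swapTest_valid (n : ℕ) : ∀ g ∈ swapTest ι n, g.Valid (2 * n + 1) := by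
  rw [swapTest, blockCircuit]
  split_ifs with h
  · simp
  simp only [List.mem_append, List.mem_flatMap, map_cswap, List.mem_range]
  rintro g (hg | ⟨i, hi, hg⟩ | hg)
  · simp only [List.map_cons, List.map_nil, List.mem_singleton] at hg
    subst hg
    simp [Gate.map, Gate.Valid, blockQubit]
  · refine cswap_valid ?_ ?_ ?_ ?_ ?_ ?_ g hg <;> simp [blockQubit] <;> omega
  · simp only [List.map_cons, List.map_nil, List.mem_cons, List.not_mem_nil, or_false] at hg
    rcases hg with rfl | rfl | rfl <;> simp [Gate.map, Gate.Valid, blockQubit] <;> omega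

/-- Exchange the first `k` qubits of the two registers. -/
def blockSwap (n k : ℕ) (q : Fin (2 * n + 1)) : Fin (2 * n + 1) :=
  ⟨if q < k ∧ q < n then n + q else if n ≤ q ∧ q < n + k ∧ q < 2 * n then q - n else q, by
    split_ifs <;> omega⟩

theorem blockSwap_succ {n k : ℕ} (hk : k < n) (q : Fin (2 * n + 1)) :
    Equiv.swap (⟨k, by omega⟩ : Fin (2 * n + 1)) ⟨n + k, by omega⟩ (blockSwap n k q) =
      blockSwap n (k + 1) q := by
  have e1 : (blockSwap n k q : ℕ) =
    if q < k ∧ q < n then n + q else if n ≤ q ∧ q < n + k ∧ q < 2 * n then q - n else q := rfl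
  have e2 : (blockSwap n (k + 1) q : ℕ) = if q < k + 1 ∧ q < n then n + q else
    if n ≤ q ∧ q < n + (k + 1) ∧ q < 2 * n then q - n else q := rfl
  apply Fin.ext
  rw [Equiv.swap_apply_def, apply_ite Fin.val, apply_ite Fin.val, e2]
  simp only [Fin.ext_iff]
  split_ifs at e1 ⊢ <;> omega

theorem blocks_mulVec {n k : ℕ} (hk : k ≤ n) (v : (Fin (2 * n + 1) → Bool) → ℂ) :
    circuitMatrix 𝒢 (2 * n + 1) ((List.range k).flatMap fun i =>
      (cswap 2 0 1 : List (Gate ι (Fin 4))).map (Gate.map (blockQubit n i))) *ᵥ v =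
      fun X => v (if X (Fin.last _) then X ∘ blockSwap n k else X) := by
  induction k with
  | zero =>
    rw [List.range_zero, List.flatMap_nil, circuitMatrix_nil_mulVec]
    funext X
    have : X ∘ blockSwap n 0 = X := by
      funext q
      refine congrArg X (Fin.ext ?_)
      simp only [blockSwap]
      split_ifs <;> omega
    rw [this, ite_self]
  | succ k ih =>
    have h1 : (Fin.last (2 * n)) ≠ ⟨k, by omega⟩ := by rw [Ne, Fin.ext_iff]; simp; omega
    have h2 : (Fin.last (2 * n)) ≠ ⟨n + k, by omega⟩ := by rw [Ne, Fin.ext_iff]; simp; omega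
    have h3 : (⟨k, by omega⟩ : Fin (2 * n + 1)) ≠ ⟨n + k, by omega⟩ := by
      rw [Ne, Fin.ext_iff]; simp; omega
    rw [List.range_succ, List.flatMap_append, circuitMatrix_append_mulVec, ih (by omega),
      List.flatMap_singleton, map_cswap]
    refine (cswap_mulVec 𝒢 h1 h2 h3 _).trans ?_
    funext X
    congr 1
    cases h : X (Fin.last _)
    · simp [h]
    · simp only [if_true, Function.comp, Equiv.swap_apply_of_ne_of_ne h1 h2, h]
      funext q
      exact congrArg X (blockSwap_succ hk q)

/-- Exchange two registers of `n` qubits. -/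
def halfSwap (n : ℕ) : Equiv.Perm (Fin (2 * n)) :=
  finProdFinEquiv.permCongr ((Equiv.swap (0 : Fin 2) 1).prodCongr (Equiv.refl (Fin n)))

theorem halfSwap_apply {n : ℕ} (j : Fin 2) (i : Fin n) :
    halfSwap n (finProdFinEquiv (j, i)) = finProdFinEquiv (Equiv.swap 0 1 j, i) := by
  simp [halfSwap, Equiv.permCongr_apply]

theorem blockSwap_castSucc {n : ℕ} (q : Fin (2 * n)) :
    blockSwap n n q.castSucc = (halfSwap n q).castSucc := by
  obtain ⟨⟨j, i⟩, rfl⟩ := finProdFinEquiv.surjective q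
  rw [halfSwap_apply]
  apply Fin.ext
  have := i.2
  fin_cases j <;> simp [blockSwap, finProdFinEquiv] <;> omega

theorem append_last {n : ℕ} (x : Fin n → Bool) (z : Fin 1 → Bool) :
    Fin.append x z (Fin.last n) = z 0 := Fin.append_right x z 0

theorem append_castSucc {n : ℕ} (x : Fin n → Bool) (z : Fin 1 → Bool) (q : Fin n) :
    Fin.append x z q.castSucc = x q := Fin.append_left x z q

theorem update_append_last {n : ℕ} (x : Fin n → Bool) (z : Fin 1 → Bool) (b : Bool) :
    Function.update (Fin.append x z : Fin (n + 1) → Bool) (Fin.last n) b =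
      Fin.append x fun _ => b := by
  funext q
  refine Fin.lastCases ?_ (fun q => ?_) q
  · rw [Function.update_self, append_last]
  · rw [Function.update_of_ne q.castSucc_ne_last, append_castSucc, append_castSucc]

theorem update_append_castSucc {n : ℕ} (x : Fin n → Bool) (z : Fin 1 → Bool) (q : Fin n) (b : Bool) :
    Function.update (Fin.append x z : Fin (n + 1) → Bool) q.castSucc b =
      Fin.append (Function.update x q b) z := by
  funext r
  refine Fin.lastCases ?_ (fun r => ?_) r
  · rw [Function.update_of_ne q.castSucc_ne_last.symm, append_last, append_last]
  · rw [append_castSucc]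
    by_cases h : r = q
    · subst h; simp
    · rw [Function.update_of_ne h, Function.update_of_ne, append_castSucc]
      exact fun e => h (Fin.castSucc_injective n e)

theorem append_comp_blockSwap {n : ℕ} (x : Fin (2 * n) → Bool) (z : Fin 1 → Bool) :
    Fin.append x z ∘ blockSwap n n = Fin.append (x ∘ halfSwap n) z := by
  funext r
  refine Fin.lastCases ?_ (fun r => ?_) r
  · have : blockSwap n n (Fin.last (2 * n)) = Fin.last (2 * n) := by
      apply Fin.ext
      simp only [blockSwap, Fin.val_last]
      split_ifs <;> omega
    rw [Function.comp, this, append_last, append_last]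
  · rw [Function.comp, blockSwap_castSucc, append_castSucc, append_castSucc, Function.comp]

theorem single_append (n : ℕ) (x y : Fin n → Bool) (z : Fin 1 → Bool) :
    (Pi.single (Fin.append y fun _ => false) 1 : (Fin (n + 1) → Bool) → ℂ) (Fin.append x z) =
      if z 0 then 0 else if x = y then 1 else 0 := by
  rw [Pi.single_apply]
  simp only [append_inj, funext_iff (f := z), Fin.forall_fin_one]
  cases z 0 <;> simp

/-- The last two CNOTs move the test bit to qubit 0, where the output is measured. If qubit 0 ends
as 1 and the ancilla as z, then the test bit was 1 and qubit 0 held ¬z before; the amplitude is that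
of (1 − SWAP)/2. -/
theorem krausOp_swapTest {n : ℕ} (hn : 0 < n) {x : Fin (2 * n) → Bool} (y : Fin (2 * n) → Bool)
    (z : Fin 1 → Bool) (hx : x ⟨0, by omega⟩ = true) :
    krausOp 𝒢 (2 * n) 1 (swapTest ι n) z x y =
      ((if Function.update x ⟨0, by omega⟩ (!z 0) = y then 1 else 0) -
        if Function.update x ⟨0, by omega⟩ (!z 0) ∘ halfSwap n = y then 1 else 0) / 2 := by
  set q₀ : Fin (2 * n) := ⟨0, by omega⟩ with hq₀
  have h0l : q₀.castSucc ≠ Fin.last (2 * n) := by simp [Fin.ext_iff, hq₀]; omega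
  have h : krausOp 𝒢 (2 * n) 1 (swapTest ι n) z x y = (circuitMatrix 𝒢 (2 * n + 1)
      (swapTest ι n) *ᵥ (Pi.single (Fin.append y fun _ => false) 1)) (Fin.append x z) := by
    rw [mulVec_single_one]; rfl
  have hpre : ([.hadamard 2] : List (Gate ι (Fin 4))).map (Gate.map (blockQubit n 0)) =
    [.hadamard ((Fin.last (2 * n) : Fin (2 * n + 1)) : ℕ)] := rfl
  have hpost : ([.hadamard 2, .cnot 3 2, .cnot 2 3] : List (Gate ι (Fin 4))).map
      (Gate.map (blockQubit n n)) = [.hadamard ((Fin.last (2 * n) : Fin (2 * n + 1)) : ℕ),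
        .cnot ((q₀.castSucc : Fin (2 * n + 1)) : ℕ) ((Fin.last (2 * n) : Fin (2 * n + 1)) : ℕ),
        .cnot ((Fin.last (2 * n) : Fin (2 * n + 1)) : ℕ) ((q₀.castSucc : Fin (2 * n + 1)) : ℕ)] :=
    rfl
  rw [h, swapTest, blockCircuit, if_neg hn.ne', circuitMatrix_append_mulVec,
    circuitMatrix_append_mulVec, hpre, hpost]
  simp only [circuitMatrix_cons_mulVec, circuitMatrix_nil_mulVec, blocks_mulVec 𝒢 le_rfl,
    hadamard_mulVec, cnot_mulVec 𝒢 h0l, cnot_mulVec 𝒢 h0l.symm]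
  simp only [Function.update_self, Function.update_of_ne h0l.symm, append_last, append_castSucc, hx,
    update_append_last, update_append_castSucc, append_comp_blockSwap, single_append,
    Bool.false_eq_true, if_false, if_true]
  have h2 : ((Real.sqrt 2 : ℝ) : ℂ) * (Real.sqrt 2 : ℝ) = 2 := by
    rw [← Complex.ofReal_mul, Real.mul_self_sqrt (by norm_num)]; simp
  rw [← h2]
  cases z 0 <;> simp <;> ring

/-- The sum over all basis states, as a sum over those in which qubit `q` is `1`. -/
theorem sum_eq_sum_ite_update {Q : Type} [Fintype Q] [DecidableEq Q] (q : Q)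
    (F : (Q → Bool) → ℂ) :
    ∑ x, F x = ∑ x : Q → Bool, if x q = true then
      F (Function.update x q true) + F (Function.update x q false) else 0 := by
  have hinv : Function.Involutive fun x : Q → Bool => Function.update x q (!x q) := fun x => by simp
  have h := Equiv.sum_comp hinv.toPerm fun x => if x q = true then 0 else F x
  have h1 : ∑ x, F x = ∑ x : Q → Bool, ((if x q = true then F x else 0) +
      if x q = true then 0 else F x) :=
    Finset.sum_congr rfl fun x _ => by split_ifs <;> simp
  rw [h1, Finset.sum_add_distrib, ← h, ← Finset.sum_add_distrib]
  refine Finset.sum_congr rfl fun x _ => ?_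
  have e : Function.update x q (x q) = x := Function.update_eq_self q x
  cases hx : x q <;> rw [hx] at e <;> simp [Function.Involutive.coe_toPerm, hx, e]

/-- Summing over the final ancilla value restores the sum over all basis states before the last
CNOTs, and (1 − SWAP)/2 is a projection. Acceptance is therefore its expectation in R. -/
theorem acceptProb_swapTest {n : ℕ} (hn : 0 < n) (R : QOp (2 * n)) :
    acceptProb 𝒢 (2 * n) 1 (swapTest ι n) R =
      (R.trace - ∑ y, R y (y ∘ halfSwap n)).re / 2 := by
  classical
  set q₀ : Fin (2 * n) := ⟨0, by omega⟩ with hq₀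
  have hinv : ∀ y : Fin (2 * n) → Bool, (y ∘ halfSwap n) ∘ halfSwap n = y := by
    intro y
    funext q
    obtain ⟨⟨j, i⟩, rfl⟩ := finProdFinEquiv.surjective q
    simp only [Function.comp, halfSwap_apply, Equiv.swap_apply_self]
  -- The diagonal entry at y of (1 − SWAP)/2 · R · (1 − SWAP)/2.
  set F : (Fin (2 * n) → Bool) → ℂ := fun y => (R y y - R y (y ∘ halfSwap n) -
    R (y ∘ halfSwap n) y + R (y ∘ halfSwap n) (y ∘ halfSwap n)) / 4 with hF
  have hout : ∀ (x : Fin (2 * n) → Bool) (z : Fin 1 → Bool), outputBit x z ↔ x q₀ = true := by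
    intro x z
    constructor
    · rintro ⟨i, hi, h⟩
      rw [show i = q₀.castSucc from Fin.ext hi, append_castSucc] at h
      exact h
    · exact fun h => ⟨q₀.castSucc, rfl, by rw [append_castSucc]; exact h⟩
  have hK : ∀ (x : Fin (2 * n) → Bool) (z : Fin 1 → Bool), x q₀ = true →
      (krausOp 𝒢 (2 * n) 1 (swapTest ι n) z * R *
        (krausOp 𝒢 (2 * n) 1 (swapTest ι n) z).conjTranspose) x x =
          F (Function.update x q₀ (!z 0)) := by
    intro x z hx
    simp only [Matrix.mul_apply, Matrix.conjTranspose_apply, krausOp_swapTest 𝒢 hn _ z hx]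
    rw [← hq₀]
    set x' := Function.update x q₀ (!z 0) with hx'
    have hst : ∀ y, star (((if x' = y then 1 else 0) -
        if x' ∘ halfSwap n = y then 1 else 0) / 2 : ℂ) =
        (if x' = y then 1 else 0) / 2 - (if x' ∘ halfSwap n = y then 1 else 0) / 2 := by
      intro y
      rw [star_div₀, star_sub, apply_ite star, apply_ite star, star_one, star_zero, star_ofNat,
        sub_div]
    simp only [hst]
    simp only [sub_div, sub_mul, mul_sub, Finset.sum_sub_distrib, ite_div, zero_div, ite_mul,
      zero_mul, mul_ite, mul_zero, Finset.sum_ite_eq, Finset.mem_univ, if_true, hF]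
    ring
  have hs : ∑ y, F y = (R.trace - ∑ y, R y (y ∘ halfSwap n)) / 2 := by
    have e : ∀ G : (Fin (2 * n) → Bool) → ℂ, ∑ y, G (y ∘ halfSwap n) = ∑ y, G y := fun G =>
      Fintype.sum_bijective (fun y => y ∘ halfSwap n) (Function.Involutive.bijective hinv) _ _
        fun _ => rfl
    have e1 := e fun y => R y y
    have e2 := e fun y => R y (y ∘ halfSwap n)
    simp only [hinv] at e2
    simp only [hF, ← Finset.sum_div, Finset.sum_add_distrib, Finset.sum_sub_distrib, e1, e2,
      Matrix.trace, Matrix.diag]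
    ring
  rw [acceptProb_eq_sum, show ∀ w : ℂ, w.re / 2 = (w / 2).re from fun w => by simp, ← hs,
    sum_eq_sum_ite_update q₀, Complex.re_sum]
  refine Finset.sum_congr rfl fun x _ => ?_
  simp only [hout]
  split_ifs with hx
  · simp only [hK x _ hx]
    rw [← Complex.re_sum]
    congr 1
    refine (Fintype.sum_equiv (Equiv.funUnique (Fin 1) Bool) _
      (fun b => F (Function.update x q₀ (!b))) fun _ => rfl).trans ?_
    exact (Fintype.sum_bool _).trans (add_comm _ _)
  · simp

theorem acceptProb_swapTest_copies {n : ℕ} (hn : 0 < n) (σ : QOp n) :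
    acceptProb 𝒢 (2 * n) 1 (swapTest ι n) (copies n 2 σ) =
      (σ.trace ^ 2 - ∑ x, ∑ y, σ x y * σ y x).re / 2 := by
  rw [acceptProb_swapTest 𝒢 hn, copies_trace]
  congr 3
  rw [← Fintype.sum_prod_type' fun x y => σ x y * σ y x]
  refine Fintype.sum_equiv ((splitState (finProdFinEquiv : Fin 2 × Fin n ≃ Fin (2 * n))).trans
    (finTwoArrowEquiv _)) _ _ fun y => ?_
  simp only [copies, Matrix.of_apply, Fin.prod_univ_two, Function.comp, halfSwap_apply]
  simp [splitState_apply]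

end

/-! ## Purity of the generalized Hilbert–Schmidt ensemble -/

section
variable {n m : ℕ}

theorem reducedState_mul_symm (ψ : PureSpace n m) (x y : Fin n → Bool) :
    (reducedState n m ψ x y * reducedState n m ψ y x).re =
      ∑ z, ∑ w, (ψ (x, z) * star (ψ (y, z)) * (ψ (y, w) * star (ψ (x, w)))).re := by
  simp only [reducedState, Matrix.of_apply, Finset.sum_mul_sum, Complex.re_sum]

/-- Flipping the sign of the coordinate (x, z), which occurs only once in the integrand, negates the
integral. -/
theorem integral_cross_term {x y : Fin n → Bool} (hxy : x ≠ y) {z w : Fin m → Bool} (hzw : z ≠ w) :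
    ∫ ψ, (ψ.1 (x, z) * star (ψ.1 (y, z)) * (ψ.1 (y, w) * star (ψ.1 (x, w)))).re
      ∂(haarState n m) = 0 := by
  have h := integral_haarState_comp (phaseIsometry (Function.update 1 (x, z) (-1)))
    fun ψ : PureSpace n m =>
      (ψ (x, z) * star (ψ (y, z)) * (ψ (y, w) * star (ψ (x, w)))).re
  have h1 : (y, z) ≠ (x, z) := fun e => hxy (Prod.ext_iff.1 e).1.symm
  have h2 : (y, w) ≠ (x, z) := fun e => hxy (Prod.ext_iff.1 e).1.symm
  have h3 : (x, w) ≠ (x, z) := fun e => hzw (Prod.ext_iff.1 e).2.symm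
  simp only [phaseIsometry_apply, Function.update_self, Function.update_of_ne h1,
    Function.update_of_ne h2, Function.update_of_ne h3, Pi.one_apply, Circle.coe_one, one_mul,
    Circle.coe_neg, neg_mul, Complex.neg_re, integral_neg] at h
  linarith

/-- Only the terms z = w survive, and each of these 2^m terms is a mixed second moment of two
distinct coordinates. -/
theorem integral_reducedState_mul_symm {x y : Fin n → Bool} (hxy : x ≠ y) :
    ∫ ψ, (reducedState n m ψ.1 x y * reducedState n m ψ.1 y x).re ∂(haarState n m) =
      2 ^ m / (pureDim n m * (pureDim n m + 1)) := by
  simp only [reducedState_mul_symm]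
  rw [integral_finsetSum _ fun z _ => integrable_haarState (F := fun ψ : PureSpace n m =>
    ∑ w, (ψ (x, z) * star (ψ (y, z)) * (ψ (y, w) * star (ψ (x, w)))).re) (by fun_prop)]
  have h : ∀ z, ∫ ψ, ∑ w, (ψ.1 (x, z) * star (ψ.1 (y, z)) * (ψ.1 (y, w) * star (ψ.1 (x, w)))).re
      ∂(haarState n m) = 1 / (pureDim n m * (pureDim n m + 1)) := by
    intro z
    rw [integral_finsetSum _ fun w _ => integrable_haarState (F := fun ψ : PureSpace n m =>
      (ψ (x, z) * star (ψ (y, z)) * (ψ (y, w) * star (ψ (x, w)))).re) (by fun_prop),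
      Finset.sum_eq_single z (fun w _ hw => integral_cross_term hxy hw.symm) (by simp),
      ← integral_normSq_mul (show (x, z) ≠ (y, z) from fun e => hxy (Prod.ext_iff.1 e).1)]
    congr 1
    funext ψ
    have : ψ.1 (x, z) * star (ψ.1 (y, z)) * (ψ.1 (y, z) * star (ψ.1 (x, z))) =
        (ψ.1 (x, z) * (starRingEnd ℂ) (ψ.1 (x, z))) *
          (ψ.1 (y, z) * (starRingEnd ℂ) (ψ.1 (y, z))) := by
      simp only [← starRingEnd_apply]; ring
    rw [this, Complex.mul_conj, Complex.mul_conj, Complex.normSq_eq_norm_sq,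
      Complex.normSq_eq_norm_sq, ← Complex.ofReal_mul, Complex.ofReal_re]
  rw [Finset.sum_congr rfl fun z _ => h z]
  simp only [Finset.sum_const, Finset.card_univ, Fintype.card_fun, Fintype.card_bool,
    Fintype.card_fin, nsmul_eq_mul, Nat.cast_pow, Nat.cast_ofNat, mul_one_div]

/-- Dephasing preserves the trace and removes exactly the off-diagonal part of the purity, so the
gap is half the mean of ∑_{x≠y} |σ_xy|². -/
theorem le_integral_swapTest_sub {ι : Type} (𝒢 : ι → Matrix.unitaryGroup Bool ℂ) (hn : 0 < n) :
    1 / 8 / 2 ^ m ≤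
      ∫ σ, acceptProb 𝒢 (2 * n) 1 (swapTest ι n) (copies n 2 (Matrix.diagonal σ.diag))
        ∂(ghse n m) -
      ∫ σ, acceptProb 𝒢 (2 * n) 1 (swapTest ι n) (copies n 2 σ) ∂(ghse n m) := by
  have c1 := acceptProb_copies_continuous (n := n) (t := 2) 𝒢 1 (swapTest ι n)
  have c2 := c1.comp (continuous_id.matrix_diag.matrix_diagonal :
    Continuous fun σ : QOp n => Matrix.diagonal σ.diag)
  rw [integral_ghse c1, integral_ghse (f := fun σ => acceptProb 𝒢 (2 * n) 1 (swapTest ι n)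
    (copies n 2 (Matrix.diagonal σ.diag))) c2, ← integral_sub
    (integrable_haarState (F := fun ψ => acceptProb 𝒢 (2 * n) 1 (swapTest ι n)
      (copies n 2 (Matrix.diagonal (reducedState n m ψ).diag))) (c2.comp reducedState_continuous))
    (integrable_haarState (F := fun ψ => acceptProb 𝒢 (2 * n) 1 (swapTest ι n)
      (copies n 2 (reducedState n m ψ))) (c1.comp reducedState_continuous))]
  have h : ∀ σ : QOp n, acceptProb 𝒢 (2 * n) 1 (swapTest ι n)
      (copies n 2 (Matrix.diagonal σ.diag)) -
      acceptProb 𝒢 (2 * n) 1 (swapTest ι n) (copies n 2 σ) =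
        (∑ x, ∑ y ∈ Finset.univ.erase x, (σ x y * σ y x).re) / 2 := by
    intro σ
    rw [acceptProb_swapTest_copies 𝒢 hn, acceptProb_swapTest_copies 𝒢 hn]
    have e1 : (Matrix.diagonal σ.diag).trace = σ.trace := by simp [Matrix.trace]
    have e2 : ∀ x, ∑ y, Matrix.diagonal σ.diag x y * Matrix.diagonal σ.diag y x = σ x x * σ x x := by
      intro x
      rw [Finset.sum_eq_single x]
      · simp
      · intro y _ hy
        rw [Matrix.diagonal_apply_ne _ hy, mul_zero]
      · simp
    have e3 : ∀ x, ∑ y, σ x y * σ y x = σ x x * σ x x + ∑ y ∈ Finset.univ.erase x, σ x y * σ y x :=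
      fun x => (Finset.add_sum_erase _ _ (Finset.mem_univ x)).symm
    simp only [e1, e2, e3, Finset.sum_add_distrib, Complex.sub_re, Complex.add_re, Complex.re_sum]
    ring
  simp only [h]
  rw [integral_div, integral_finsetSum _ fun x _ => integrable_haarState (F := fun ψ : PureSpace n m =>
    ∑ y ∈ Finset.univ.erase x, (reducedState n m ψ x y * reducedState n m ψ y x).re) ?_]
  swap
  · have hc : ∀ x y, Continuous fun ψ : PureSpace n m => reducedState n m ψ x y := fun x y =>
      reducedState_continuous.matrix_elem x y
    fun_prop
  have h2 : ∀ x, ∫ ψ, ∑ y ∈ Finset.univ.erase x,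
      (reducedState n m ψ.1 x y * reducedState n m ψ.1 y x).re ∂(haarState n m) =
        (2 ^ n - 1) * (2 ^ m / (pureDim n m * (pureDim n m + 1))) := by
    intro x
    rw [integral_finsetSum _ fun y _ => integrable_haarState (F := fun ψ : PureSpace n m =>
      (reducedState n m ψ x y * reducedState n m ψ y x).re) ?_, Finset.sum_congr rfl fun y hy =>
      integral_reducedState_mul_symm (Finset.ne_of_mem_erase hy).symm]
    · simp [Finset.card_erase_of_mem]
    · have hc : ∀ x y, Continuous fun ψ : PureSpace n m => reducedState n m ψ x y := fun x y =>
        reducedState_continuous.matrix_elem x y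
      fun_prop
  rw [Finset.sum_congr rfl fun x _ => h2 x]
  simp only [Finset.sum_const, Finset.card_univ, Fintype.card_fun, Fintype.card_bool,
    Fintype.card_fin, nsmul_eq_mul, Nat.cast_pow, Nat.cast_ofNat, pureDim]
  have hN : (2 : ℝ) ≤ 2 ^ n := by
    calc (2 : ℝ) = 2 ^ 1 := (pow_one _).symm
      _ ≤ 2 ^ n := pow_le_pow_right₀ (by norm_num) hn
  have hM : (1 : ℝ) ≤ 2 ^ m := one_le_pow₀ (by norm_num)
  generalize (2 : ℝ) ^ n = N at *
  generalize (2 : ℝ) ^ m = M at *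
  -- With N = 2^n and M = 2^m the gap is (N − 1)/(2(NM + 1)). It is at least 1/(8M) because 6NM ≥ 8M
  -- + 2 for N ≥ 2 and M ≥ 1, which is where n > 0 enters.
  have e : N * ((N - 1) * (M / (N * M * (N * M + 1)))) / 2 = (N - 1) / (2 * (N * M + 1)) := by
    have : N * M + 1 ≠ 0 := by positivity
    field_simp
  rw [e, div_div, div_le_div_iff₀ (by positivity) (by positivity)]
  nlinarith

end

/-- The dephased keyed states are close both to the ensemble, by robustness, and to the dephased
ensemble, by the reduction. For the swap test these two are at least 1/(8·2^m) apart, and the keyed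
states drop out of the triangle inequality. -/
theorem isLittleO_log_of_noiseRobust {ι : Type} (𝒢 : ι → Matrix.unitaryGroup Bool ℂ)
    {κ m : ℕ → ℕ} {ρ : KeyedFamily κ} (hρ : IsPRDM 𝒢 κ m ρ)
    (h : NoiseRobust 𝒢 κ m ρ fun _ σ => Matrix.diagonal σ.diag) :
    (fun n : ℕ => Real.log n) =o[Filter.atTop] (fun n : ℕ => (m n : ℝ)) := by
  have e2 : ∀ n, (Polynomial.C 2 : Polynomial ℕ).eval n = 2 := fun n => Polynomial.eval_C
  have e1 : ∀ n, (Polynomial.C 1 : Polynomial ℕ).eval n = 1 := fun n => Polynomial.eval_C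
  have hA : UniformCircuits (fun n => n)
      (fun n => publicParams κ m n ++ [unary ((Polynomial.C 2 : Polynomial ℕ).eval n)])
      (fun n => (Polynomial.C 2 : Polynomial ℕ).eval n * n + (Polynomial.C 1 : Polynomial ℕ).eval n)
      (swapTest ι) := by
    refine uniformCircuits_block (fun n => le_rfl) (fun n => rfl) fun n => ?_
    rw [e2, e1]
    exact swapTest_valid n
  have h1 := (h hρ).indistinguishable _ _ _ hA
  have h2 := negligible_advantage_channel 𝒢 hρ.indistinguishable
    (efficientlyImplementable_dephasing 𝒢) hA
  refine isLittleO_log_of_negligible (r := 1 / 8) (by norm_num)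
    ((h1.add h2).mono_of_lt 0 fun n hn => ?_)
  rw [e2, e1]
  refine (le_integral_swapTest_sub 𝒢 hn).trans ?_
  rw [advantage, add_comm, abs_sub_comm]
  refine le_trans ?_ (abs_add_le _ _)
  rw [sub_add_sub_cancel]
  exact le_abs_self _

end

theorem mainTheorem7 {ι : Type} [Finite ι] (𝒢 : ι → Matrix.unitaryGroup Bool ℂ)
    (κ m : ℕ → ℕ) (ρ : KeyedFamily κ) (hρ : IsPRDM 𝒢 κ m ρ) :
    (∀ Γ : (n : ℕ) → QOp n → QOp n,
        (∀ n, IsQuantumChannel n (Γ n)) → (∀ n, IsUnital n (Γ n)) →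
        EfficientlyImplementable 𝒢 Γ → NoiseRobust 𝒢 κ m ρ Γ) ↔
      (fun n : ℕ => Real.log n) =o[Filter.atTop] (fun n : ℕ => (m n : ℝ)) :=
  ⟨fun h => isLittleO_log_of_noiseRobust 𝒢 hρ (h _ isQuantumChannel_dephasing isUnital_dephasing
    (efficientlyImplementable_dephasing 𝒢)),
    fun hm _ _ hu hΓ => IsPRDM.noiseRobust 𝒢 hm hu hΓ⟩
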